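/- Let $\zeta$ be the Riemann zeta-function and let $\gamma$ be Euler's constant. For $\operatorname{Re} s>1$ the integral $$\mathcal Z_1(s)=\int_1^\infty \left|\zeta\left(\tfrac12+ix\right)\right|^2x^{-s}\,dx$$ converges absolutely. The function $\mathcal Z_1$ so defined continues meromorphically to all of $\mathbb C$. The continuation is holomorphic except for a double pole at $s=1$, with principal part $$\frac1{(s-1)^2}+\frac{2\gamma-\log(2\pi)}{s-1}$$ of its Laurent expansion there, and at most simple poles at the points $s=-1,-3,-5,\ldots$ (at each of these points the function either is holomorphic or has a simple pole). -/

import Mathlib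

open Filter Topology MeasureTheory

/-- The integrand `|ζ(1/2 + ix)|² x^{-s}` of the modified Mellin transform. -/
noncomputable def mellinSqIntegrand (s : ℂ) (x : ℝ) : ℂ :=
  ((‖riemannZeta (1 / 2 + Complex.I * (x : ℂ))‖ ^ 2 : ℝ) : ℂ) * (x : ℂ) ^ (-s)

/-- The integral `∫_1^∞ |ζ(1/2 + ix)|² x^{-s} dx`, meaningful for `Re s > 1`. -/
noncomputable def mellinSqIntegral (s : ℂ) : ℂ :=
  ∫ x in Set.Ioi (1 : ℝ), mellinSqIntegrand s x

/-- The negative odd integers `-1, -3, -5, …`, as complex numbers. -/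
def negOddIntegers : Set ℂ :=
  {s : ℂ | ∃ n : ℕ, s = -(2 * (n : ℂ) + 1)}

/-!
The function `F(δ) = ∫_1^∞ |ζ(1/2 + it)|² e^{-δt} dt` (`laplaceTail`) has Mellin transform
`Γ(s) ∫_1^∞ |ζ(1/2 + ix)|² x^{-s} dx` for `Re s > 1`, so the continuation of the latter can be read
off the asymptotic expansion of `F` at `0⁺`: a term `δ^{k-1}` gives a simple pole of `Γ(s) Z(s)` at
`1 - k`, and a term `δ^{k-1} log δ` gives a double one. Dividing by `Γ(s)` lowers the order of each
pole at a non-positive integer by one. Hence poles survive only at `1` and at the points `1 - k`,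
`k ≥ 1`, at which a logarithmic term is present, and they are simple at the latter. The theorem
therefore amounts to an expansion

  `F(δ) ∼ ∑ (b_k - a_k log δ) δ^{k-1}`, with `a_0 = 1`, `b_0 = γ - log 2π`, `a_k = 0` for odd `k`

(`exists_laplaceTail_expansion`). The pole at `1` combines `a_0`, `b_0` with `1/Γ(s) = 1 + γ(s-1) + …`.

The expansion comes from Atkinson's formula (`integral_zetaWeight_mul_exp`). The Lambert series
`D(w) = ∑ d(n) e^{-nw}` minus its singular part `(γ - log w)/w` has Mellin transform `Γ(s) ζ(s)²` on
`0 < Re s < 1`. On the critical line the functional equation turns this into `|ζ|²` times an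
elementary factor, and Mellin inversion followed by continuation in `w` from the positive axis to
the right half-plane yields

  `∫ |ζ(1/2 + it)|² / (1 + i e^{-πt}) e^{-δt} dt = 2π e^{-iδ/2} D(2πi e^{-iδ}) + (elementary)`

over the whole real line. The weight differs from the indicator of `(1, ∞)` by something that makes
the integral holomorphic at `δ = 0`. Since `D` has period `2πi`, its argument may be replaced by
`w = 2πi (e^{-iδ} - 1) = 2πδ + O(δ²)` (`lambertArg`), which approaches `0` inside a sector.

There `D(w) = -log(1 - e^{-w})/w + ∑_m h(mw)` with `h(z) = 1/(e^z - 1) - e^{-z}/z` (`boseKernel`)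
holomorphic at `0`, and Euler–Maclaurin summation expands the last sum as `γ/w` plus a power series
(`exists_boseSum_expansion`). So the logarithms in `δ F(δ)` come only from `-log(1 - e^{-w})/w`; their
coefficient is `-2πδ e^{-iδ/2}/w = -(δ/2)/sin(δ/2)`, an even function of `δ`, which is why `a_k`
vanishes for odd `k`.
-/

section
open Complex Set Asymptotics

/-! ### Tools from complex analysis -/

/-- Two functions holomorphic on a connected open set agree there if they agree on a real
neighbourhood of a real point. Every analytic continuation below is an instance of this. -/
theorem eqOn_of_eventually_eq_ofReal {U : Set ℂ} (hU : IsOpen U) (hc : IsPreconnected U)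
    {f g : ℂ → ℂ} (hf : DifferentiableOn ℂ f U) (hg : DifferentiableOn ℂ g U)
    {x₀ : ℝ} (hx₀ : (x₀ : ℂ) ∈ U) (h : ∀ᶠ x : ℝ in 𝓝 x₀, f x = g x) : EqOn f g U := by
  refine (hf.analyticOnNhd hU).eqOn_of_preconnected_of_frequently_eq (hg.analyticOnNhd hU) hc hx₀ ?_
  have h1 : Tendsto (fun x : ℝ => (x : ℂ)) (𝓝[≠] x₀) (𝓝[≠] (x₀ : ℂ)) := by
    refine tendsto_nhdsWithin_iff.2 ⟨(continuous_ofReal.tendsto x₀).mono_left nhdsWithin_le_nhds, ?_⟩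
    filter_upwards [self_mem_nhdsWithin] with x hx
    simpa using hx
  exact h1.frequently (h.filter_mono nhdsWithin_le_nhds).frequently

/-- Trades a factor `|t|` for an arbitrarily small exponential. -/
theorem abs_le_exp_div {ε : ℝ} (hε : 0 < ε) (t : ℝ) : |t| ≤ Real.exp (ε * |t|) / ε := by
  rw [le_div_iff₀ hε]
  have := Real.add_one_le_exp (ε * |t|)
  linarith [mul_comm ε |t|]

theorem norm_cexp_mul_ofReal_le (z : ℂ) (t : ℝ) : ‖cexp (z * t)‖ ≤ Real.exp (|z.re| * |t|) := by
  rw [Complex.norm_exp]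
  gcongr
  simp only [mul_re, ofReal_re, ofReal_im, mul_zero, sub_zero]
  rw [← abs_mul]; exact le_abs_self _

/-- Two-sided Laplace transforms are holomorphic inside their strip of absolute convergence. -/
theorem differentiableAt_integral_mul_cexp {μ : Measure ℝ} {k : ℝ → ℂ} {A : ℝ}
    (hk : AEStronglyMeasurable k μ)
    (hint : ∀ a < A, Integrable (fun t => ‖k t‖ * Real.exp (a * |t|)) μ) {z : ℂ} (hz : |z.re| < A) :
    DifferentiableAt ℂ (fun z : ℂ => ∫ t, k t * cexp (z * t) ∂μ) z := by
  obtain ⟨ε, hε, hεA⟩ : ∃ ε > 0, |z.re| + 2 * ε < A := ⟨(A - |z.re|) / 3, by linarith, by linarith⟩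
  have hmeas : ∀ z : ℂ, AEStronglyMeasurable (fun t : ℝ => k t * cexp (z * t)) μ := fun z =>
    hk.mul (by fun_prop : Continuous fun t : ℝ => cexp (z * t)).aestronglyMeasurable
  refine (hasDerivAt_integral_of_dominated_loc_of_deriv_le (μ := μ)
    (F := fun z t => k t * cexp (z * t)) (F' := fun z t => k t * (cexp (z * t) * t))
    (bound := fun t => ε⁻¹ * (‖k t‖ * Real.exp ((|z.re| + 2 * ε) * |t|)))
    (Metric.ball_mem_nhds z hε) (Eventually.of_forall hmeas) ?_ ?_ ?_ ?_ ?_).2.differentiableAt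
  · refine (hint _ hz).mono (hmeas z) (Eventually.of_forall fun t => ?_)
    rw [norm_mul, norm_mul, norm_norm, Real.norm_eq_abs, abs_of_pos (Real.exp_pos _)]
    gcongr
    exact norm_cexp_mul_ofReal_le z t
  · exact hk.mul (by fun_prop : Continuous fun t : ℝ => cexp (z * t) * t).aestronglyMeasurable
  · refine Eventually.of_forall fun t w hw => ?_
    have hre : |w.re| ≤ |z.re| + ε := by
      have h1 : |(w - z).re| ≤ ‖w - z‖ := abs_re_le_norm _
      have h2 : ‖w - z‖ < ε := by simpa [dist_eq_norm] using hw
      have h3 : w.re = z.re + (w - z).re := by simp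
      rw [h3]; exact (abs_add_le _ _).trans (by linarith)
    rw [norm_mul, norm_mul, norm_real, Real.norm_eq_abs]
    calc ‖k t‖ * (‖cexp (w * t)‖ * |t|)
        ≤ ‖k t‖ * (Real.exp ((|z.re| + ε) * |t|) * (Real.exp (ε * |t|) / ε)) := by
          gcongr
          · refine (norm_cexp_mul_ofReal_le w t).trans ?_
            gcongr
          · exact abs_le_exp_div hε t
      _ = ε⁻¹ * (‖k t‖ * Real.exp ((|z.re| + 2 * ε) * |t|)) := by
          rw [show (|z.re| + 2 * ε) * |t| = (|z.re| + ε) * |t| + ε * |t| by ring, Real.exp_add]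
          field_simp
  · exact (hint _ hεA).const_mul _
  · refine Eventually.of_forall fun t w _ => ?_
    have h1 : HasDerivAt (fun w : ℂ => w * (t : ℂ)) (t : ℂ) w := by
      simpa using (hasDerivAt_id w).mul_const (t : ℂ)
    exact (h1.cexp).const_mul _

/-! ### Growth of zeta on the critical line -/

/-- The fractional part, cut off to `(1, ∞)`, so that its Mellin transform at `-s` is the integral in
`ζ(s) = s/(s - 1) - s ∫_1^∞ {t} t^{-s-1} dt`. -/
noncomputable def fractTail : ℝ → ℂ := indicator (Ioi 1) fun t => ((Int.fract t : ℝ) : ℂ)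

theorem norm_fractTail_le (t : ℝ) : ‖fractTail t‖ ≤ 1 := by
  unfold fractTail
  by_cases h : t ∈ Ioi (1 : ℝ)
  · rw [indicator_of_mem h, norm_real, Real.norm_eq_abs, abs_of_nonneg (Int.fract_nonneg t)]
    exact (Int.fract_lt_one t).le
  · rw [indicator_of_notMem h]; simp

theorem measurable_fractTail : Measurable fractTail :=
  (Complex.measurable_ofReal.comp measurable_fract).indicator measurableSet_Ioi

theorem locallyIntegrable_fractTail : LocallyIntegrable fractTail :=
  (locallyIntegrable_const (1 : ℝ)).mono measurable_fractTail.aestronglyMeasurable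
    (Eventually.of_forall fun t => by simpa using norm_fractTail_le t)

theorem fractTail_isBigO_top : fractTail =O[atTop] fun t : ℝ => t ^ (-(0 : ℝ)) := by
  simpa using Asymptotics.isBigO_of_le (g := fun _ : ℝ => (1 : ℝ)) atTop
    (fun t => by simpa using norm_fractTail_le t)

theorem fractTail_isBigO_zero (b : ℝ) : fractTail =O[𝓝[>] 0] fun t : ℝ => t ^ (-b) := by
  refine (Asymptotics.isBigO_zero _ _).congr' ?_ EventuallyEq.rfl
  filter_upwards [nhdsWithin_le_nhds (Iio_mem_nhds one_pos)] with t ht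
  simp only [fractTail]
  rw [indicator_of_notMem (by simpa using (mem_Iio.1 ht).le)]

theorem mellinConvergent_fractTail {s : ℂ} (hs : s.re < 0) : MellinConvergent fractTail s :=
  mellinConvergent_of_isBigO_rpow (locallyIntegrable_fractTail.locallyIntegrableOn _)
    fractTail_isBigO_top hs (fractTail_isBigO_zero (s.re - 1)) (by linarith)

theorem differentiableAt_mellin_fractTail {s : ℂ} (hs : s.re < 0) :
    DifferentiableAt ℂ (mellin fractTail) s :=
  mellin_differentiableAt_of_isBigO_rpow (locallyIntegrable_fractTail.locallyIntegrableOn _)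
    fractTail_isBigO_top hs (fractTail_isBigO_zero (s.re - 1)) (by linarith)

theorem mellin_fractTail (s : ℂ) :
    mellin fractTail (-s) = ∫ t in Ioi (1 : ℝ), ((Int.fract t : ℝ) : ℂ) * (t : ℂ) ^ (-(s + 1)) := by
  have h : ∀ t : ℝ, (t : ℂ) ^ (-s - 1) • fractTail t = indicator (Ioi 1)
      (fun t : ℝ => ((Int.fract t : ℝ) : ℂ) * (t : ℂ) ^ (-(s + 1))) t := by
    intro t
    by_cases ht : t ∈ Ioi (1 : ℝ)
    · simp only [fractTail, indicator_of_mem ht, smul_eq_mul, mul_comm]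
      ring_nf
    · simp only [fractTail, indicator_of_notMem ht, smul_zero]
  simp only [mellin, h]
  rw [setIntegral_indicator measurableSet_Ioi, inter_eq_self_of_subset_right]
  exact Ioi_subset_Ioi zero_le_one

theorem integrableOn_fract_mul_cpow {s : ℂ} (hs : 0 < s.re) :
    IntegrableOn (fun t : ℝ => ((Int.fract t : ℝ) : ℂ) * (t : ℂ) ^ (-(s + 1))) (Ioi 1) := by
  have h := (mellinConvergent_fractTail (s := -s) (by simpa using hs)).mono_set
    (Ioi_subset_Ioi zero_le_one)
  refine h.congr_fun (fun t ht => ?_) measurableSet_Ioi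
  simp only [fractTail, indicator_of_mem ht, smul_eq_mul, mul_comm]
  ring_nf

theorem riemannZeta_eq_sub_mul_integral_fract {s : ℂ} (hs : 1 < s.re) :
    riemannZeta s = s / (s - 1) - s * mellin fractTail (-s) := by
  have h1 : LSeries (fun n => ((1 : ℝ) : ℂ)) s = _ :=
    LSeries_eq_mul_integral_of_nonneg (fun _ => 1) zero_le_one hs
      (by simpa using Asymptotics.isBigO_refl (fun n : ℕ => (n : ℝ)) atTop)
      (fun _ => zero_le_one)
  have h2 : LSeries (fun n => ((1 : ℝ) : ℂ)) s = riemannZeta s := by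
    rw [← LSeries_one_eq_riemannZeta hs]; congr 1
  have hre : (-(s + 1)).re < -1 := by simp; linarith
  have hsub : ∫ t in Ioi (1 : ℝ), ((t : ℂ) ^ (-s) - ((Int.fract t : ℝ) : ℂ) * (t : ℂ) ^ (-(s + 1)))
      = 1 / (s - 1) - mellin fractTail (-s) := by
    rw [integral_sub (integrableOn_Ioi_cpow_of_lt (by simpa using hs) one_pos)
      (integrableOn_fract_mul_cpow (by linarith)), ← mellin_fractTail,
      integral_Ioi_cpow_of_lt (by simpa using hs) one_pos]
    congr 1
    have h3 : s - 1 ≠ 0 := by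
      intro h; rw [sub_eq_zero.1 h] at hs; simp at hs
    have h4 : -s + 1 ≠ 0 := by rwa [neg_add_eq_sub, ← neg_ne_zero, neg_sub]
    simp only [ofReal_one, one_cpow]
    field_simp
    ring
  rw [← h2, h1, show s / (s - 1) - s * mellin fractTail (-s)
    = s * (1 / (s - 1) - mellin fractTail (-s)) by ring, ← hsub]
  congr 1
  refine setIntegral_congr_fun measurableSet_Ioi fun t ht => ?_
  have ht0 : (0 : ℝ) < t := one_pos.trans ht
  have h5 : (t : ℂ) ^ (-s) = t * (t : ℂ) ^ (-(s + 1)) := by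
    rw [show -s = 1 + -(s + 1) by ring, cpow_add _ _ (by exact_mod_cast ht0.ne'), cpow_one]
  have h6 : ((⌊t⌋₊ : ℕ) : ℂ) = t - ((Int.fract t : ℝ) : ℂ) := by
    have : ((⌊t⌋₊ : ℕ) : ℝ) = t - Int.fract t := by
      rw [natCast_floor_eq_intCast_floor ht0.le]; linarith [Int.self_sub_floor t]
    exact_mod_cast congrArg ((↑) : ℝ → ℂ) this
  simp only [ofReal_one, Finset.sum_const, Nat.card_Icc, nsmul_eq_mul, mul_one, h5]
  rw [show ⌊t⌋₊ + 1 - 1 = ⌊t⌋₊ by omega, h6]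
  ring

theorem isPreconnected_re_pos : IsPreconnected {s : ℂ | 0 < s.re} :=
  (convex_halfSpace_re_gt 0).isPreconnected

theorem isOpen_re_pos : IsOpen {s : ℂ | 0 < s.re} := isOpen_lt continuous_const continuous_re

/-- Continuation of the previous formula to the critical strip, in terms of
`riemannZeta₁ s = (s - 1) ζ(s)` so that the pole plays no role. -/
theorem riemannZeta₁_eq_of_re_pos {s : ℂ} (hs : 0 < s.re) :
    riemannZeta₁ s = s - s * (s - 1) * mellin fractTail (-s) := by
  refine eqOn_of_eventually_eq_ofReal (f := riemannZeta₁)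
    (g := fun s => s - s * (s - 1) * mellin fractTail (-s)) isOpen_re_pos isPreconnected_re_pos
    differentiable_riemannZeta₁.differentiableOn ?_ (x₀ := 2) (by simp) ?_ hs
  · intro w hw
    have h : DifferentiableAt ℂ (fun w => mellin fractTail (-w)) w :=
      (differentiableAt_mellin_fractTail (by simpa using hw)).comp w (by fun_prop)
    exact (DifferentiableAt.sub (by fun_prop) (DifferentiableAt.mul (by fun_prop) h)).differentiableWithinAt
  · filter_upwards [Ioi_mem_nhds (show (1 : ℝ) < 2 by norm_num)] with x hx
    have hx1 : (x : ℂ) - 1 ≠ 0 := by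
      have : x - 1 ≠ 0 := sub_ne_zero.2 (mem_Ioi.1 hx).ne'
      exact_mod_cast this
    have h1 := riemannZeta_eq_sub_mul_integral_fract (s := x) (by simpa using hx)
    rw [riemannZeta_eq_inv_sub_mul (sub_ne_zero.1 hx1)] at h1
    field_simp at h1
    rw [h1]; ring

theorem norm_mellin_fractTail_le (t : ℝ) : ‖mellin fractTail (-(1 / 2 + I * t))‖ ≤ 2 := by
  rw [mellin_fractTail]
  have h : ∫ x in Ioi (1 : ℝ), x ^ (-(3 / 2) : ℝ) = 2 := by
    rw [integral_Ioi_rpow_of_lt (by norm_num) one_pos]; norm_num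
  rw [← h]
  refine norm_integral_le_of_norm_le (integrableOn_Ioi_rpow_of_lt (by norm_num) one_pos) ?_
  refine (ae_restrict_iff' measurableSet_Ioi).2 (Eventually.of_forall fun x hx => ?_)
  have hx0 : (0 : ℝ) < x := one_pos.trans hx
  rw [norm_mul, norm_cpow_eq_rpow_re_of_pos hx0, norm_real, Real.norm_eq_abs,
    abs_of_nonneg (Int.fract_nonneg x)]
  have : (-(1 / 2 + I * (t : ℂ) + 1)).re = -(3 / 2) := by simp; norm_num
  rw [this]
  exact mul_le_of_le_one_left (by positivity) (Int.fract_lt_one x).le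

/-- A linear bound, which suffices for the convergence of the Laplace transforms. -/
theorem norm_riemannZeta_half_le (t : ℝ) : ‖riemannZeta (1 / 2 + I * t)‖ ≤ 2 + 2 * |t| := by
  set s : ℂ := 1 / 2 + I * t with hs
  have hre : s.re = 1 / 2 := by simp [hs]
  have him : s.im = t := by simp [hs]
  have hs1 : s ≠ 1 := by intro h; rw [h] at hre; norm_num at hre
  have hs1' : ‖s - 1‖ ≠ 0 := norm_ne_zero_iff.2 (sub_ne_zero.2 hs1)
  have hn : ‖s‖ = ‖s - 1‖ := by
    rw [Complex.norm_def, Complex.norm_def, normSq_apply, normSq_apply]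
    simp [hre, him]; norm_num
  have hle : ‖s‖ ≤ 1 / 2 + |t| := by
    refine (norm_le_abs_re_add_abs_im s).trans ?_
    rw [hre, him]; norm_num
  have h := riemannZeta₁_eq_of_re_pos (s := s) (by rw [hre]; norm_num)
  have h2 : riemannZeta s = s * (s - 1)⁻¹ - s * mellin fractTail (-s) := by
    rw [riemannZeta_eq_inv_sub_mul hs1, h]
    have : s - 1 ≠ 0 := sub_ne_zero.2 hs1
    field_simp
  rw [h2]
  refine (norm_sub_le _ _).trans ?_
  rw [norm_mul, norm_inv, hn, mul_inv_cancel₀ hs1', norm_mul]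
  have := norm_mellin_fractTail_le t
  rw [← hs] at this
  nlinarith [norm_nonneg s]

/-! ### The weighted mean square on the critical line -/

theorem integrable_exp_neg_mul_abs {c : ℝ} (hc : 0 < c) :
    Integrable fun t : ℝ => Real.exp (-(c * |t|)) := by
  refine (integrable_inv_one_add_sq.const_mul (1 + 2 / c ^ 2)).mono
    (by fun_prop : Continuous fun t : ℝ => Real.exp (-(c * |t|))).aestronglyMeasurable
    (Eventually.of_forall fun t => ?_)
  have h1 := Real.quadratic_le_exp_of_nonneg (x := c * |t|) (by positivity)
  have h2 : (1 + t ^ 2) ≤ (1 + 2 / c ^ 2) * Real.exp (c * |t|) := by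
    have h3 : t ^ 2 = 2 / c ^ 2 * ((c * |t|) ^ 2 / 2) := by rw [mul_pow, sq_abs]; field_simp
    have h4 : 0 < 2 / c ^ 2 := by positivity
    have h5 : 0 ≤ c * |t| := by positivity
    have h6 : (c * |t|) ^ 2 / 2 ≤ Real.exp (c * |t|) := by linarith
    have h7 := mul_le_mul_of_nonneg_left h6 h4.le
    have h8 : 1 ≤ Real.exp (c * |t|) := by nlinarith [sq_nonneg (c * |t|)]
    rw [h3, add_mul, one_mul]
    exact add_le_add h8 h7
  rw [Real.norm_of_nonneg (Real.exp_pos _).le, Real.norm_of_nonneg (by positivity), Real.exp_neg,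
    ← div_eq_mul_inv, inv_eq_one_div, div_le_div_iff₀ (Real.exp_pos _) (by positivity), one_mul]
  exact h2

/-- The square `|ζ(1/2 + it)|²` of the modulus of zeta on the critical line. -/
noncomputable def zetaSq (t : ℝ) : ℝ := ‖riemannZeta (1 / 2 + I * t)‖ ^ 2

theorem zetaSq_nonneg (t : ℝ) : 0 ≤ zetaSq t := sq_nonneg _

theorem half_add_I_mul_ne_one (t : ℝ) : (1 / 2 + I * t : ℂ) ≠ 1 := by
  intro h
  have := congrArg re h
  norm_num at this

theorem continuous_zetaSq : Continuous zetaSq := by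
  have h : Continuous fun t : ℝ => riemannZeta (1 / 2 + I * t) := by
    refine continuous_iff_continuousAt.2 fun t => ?_
    exact ContinuousAt.comp (f := fun t : ℝ => (1 / 2 + I * t : ℂ)) (g := riemannZeta)
      (differentiableAt_riemannZeta (half_add_I_mul_ne_one t)).continuousAt
      (by fun_prop : Continuous fun t : ℝ => (1 / 2 + I * t : ℂ)).continuousAt
  exact h.norm.pow 2

theorem zetaSq_le {ε : ℝ} (hε : 0 < ε) (t : ℝ) :
    zetaSq t ≤ (2 + 4 / ε) ^ 2 * Real.exp (ε * |t|) := by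
  have h1 := abs_le_exp_div (half_pos hε) t
  have h2 : 1 ≤ Real.exp (ε / 2 * |t|) := Real.one_le_exp (by positivity)
  have h3 : ‖riemannZeta (1 / 2 + I * t)‖ ≤ (2 + 4 / ε) * Real.exp (ε / 2 * |t|) := by
    refine (norm_riemannZeta_half_le t).trans ?_
    have : Real.exp (ε / 2 * |t|) / (ε / 2) = 2 / ε * Real.exp (ε / 2 * |t|) := by field_simp
    rw [this] at h1
    have : (2 + 4 / ε) * Real.exp (ε / 2 * |t|)
      = 2 * Real.exp (ε / 2 * |t|) + 2 * (2 / ε * Real.exp (ε / 2 * |t|)) := by ring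
    linarith
  calc zetaSq t ≤ ((2 + 4 / ε) * Real.exp (ε / 2 * |t|)) ^ 2 :=
        pow_le_pow_left₀ (norm_nonneg _) h3 2
    _ = (2 + 4 / ε) ^ 2 * Real.exp (ε * |t|) := by
        rw [mul_pow, ← Real.exp_nat_mul]; congr 2; push_cast; ring

theorem integrable_of_norm_le_zetaSq {k : ℝ → ℂ} {μ : Measure ℝ} (hμ : μ ≤ volume) {A : ℝ}
    (hk : AEStronglyMeasurable k μ)
    (hle : ∀ᵐ t ∂μ, ‖k t‖ ≤ zetaSq t * Real.exp (-(A * |t|))) {a : ℝ} (ha : a < A) :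
    Integrable (fun t => ‖k t‖ * Real.exp (a * |t|)) μ := by
  have hε : 0 < (A - a) / 2 := by linarith
  refine (((integrable_exp_neg_mul_abs hε).const_mul
    ((2 + 4 / ((A - a) / 2)) ^ 2)).mono_measure hμ).mono (hk.norm.mul
    (by fun_prop : Continuous fun t : ℝ => Real.exp (a * |t|)).aestronglyMeasurable) ?_
  filter_upwards [hle] with t ht
  rw [Real.norm_of_nonneg (by positivity), Real.norm_of_nonneg (by positivity)]
  calc ‖k t‖ * Real.exp (a * |t|)
      ≤ (2 + 4 / ((A - a) / 2)) ^ 2 * Real.exp ((A - a) / 2 * |t|) * Real.exp (-(A * |t|))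
          * Real.exp (a * |t|) := by
        gcongr
        refine ht.trans ?_
        gcongr
        exact zetaSq_le hε t
    _ = _ := by
        rw [mul_assoc, mul_assoc, ← Real.exp_add, ← Real.exp_add]
        congr 2; ring

/-- The measure density on the critical line produced by the functional equation:
`|ζ(1/2 + it)|² / (1 + i e^{-πt})`. -/
noncomputable def zetaWeight (t : ℝ) : ℂ := zetaSq t / (1 + I * Real.exp (-(Real.pi * t)))

theorem one_le_norm_one_add_I_mul (x : ℝ) : 1 ≤ ‖1 + I * (x : ℂ)‖ := by
  have := abs_re_le_norm (1 + I * (x : ℂ))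
  simpa using this

theorem abs_le_norm_one_add_I_mul (x : ℝ) : |x| ≤ ‖1 + I * (x : ℂ)‖ := by
  have := abs_im_le_norm (1 + I * (x : ℂ))
  simpa using this

theorem one_add_I_mul_ne_zero (x : ℝ) : 1 + I * (x : ℂ) ≠ 0 :=
  norm_pos_iff.1 (one_pos.trans_le (one_le_norm_one_add_I_mul x))

theorem continuous_zetaWeight : Continuous zetaWeight := by
  unfold zetaWeight
  exact (continuous_ofReal.comp continuous_zetaSq).div (by fun_prop)
    fun t => one_add_I_mul_ne_zero _

theorem norm_zetaWeight_le (t : ℝ) : ‖zetaWeight t‖ ≤ zetaSq t := by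
  rw [zetaWeight, norm_div, norm_real, Real.norm_of_nonneg (zetaSq_nonneg t)]
  exact div_le_self (zetaSq_nonneg t) (one_le_norm_one_add_I_mul _)

theorem norm_zetaWeight_le' (t : ℝ) : ‖zetaWeight t‖ ≤ zetaSq t * Real.exp (Real.pi * t) := by
  rw [zetaWeight, norm_div, norm_real, Real.norm_of_nonneg (zetaSq_nonneg t)]
  have h := abs_le_norm_one_add_I_mul (Real.exp (-(Real.pi * t)))
  rw [abs_of_pos (Real.exp_pos _)] at h
  rw [div_le_iff₀ (one_pos.trans_le (one_le_norm_one_add_I_mul _))]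
  calc zetaSq t = zetaSq t * Real.exp (Real.pi * t) * Real.exp (-(Real.pi * t)) := by
        rw [mul_assoc, ← Real.exp_add, add_neg_cancel, Real.exp_zero, mul_one]
    _ ≤ _ := by
        gcongr
        exact mul_nonneg (zetaSq_nonneg t) (Real.exp_pos _).le

theorem norm_exp_mul_zetaWeight_le (t : ℝ) :
    ‖cexp (-(Real.pi / 2 * t)) * zetaWeight t‖
      ≤ zetaSq t * Real.exp (-(Real.pi / 2 * |t|)) := by
  have h0 : ‖cexp (-(Real.pi / 2 * t))‖ = Real.exp (-(Real.pi / 2 * t)) := by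
    rw [show (-(Real.pi / 2 * t) : ℂ) = ((-(Real.pi / 2 * t) : ℝ) : ℂ) by push_cast; ring,
      ← ofReal_exp, norm_real, Real.norm_of_nonneg (Real.exp_pos _).le]
  rw [norm_mul, h0]
  rcases le_total 0 t with ht | ht
  · rw [abs_of_nonneg ht, mul_comm]
    gcongr
    exact norm_zetaWeight_le t
  · rw [abs_of_nonpos ht]
    calc Real.exp (-(Real.pi / 2 * t)) * ‖zetaWeight t‖
        ≤ Real.exp (-(Real.pi / 2 * t)) * (zetaSq t * Real.exp (Real.pi * t)) := by
          gcongr; exact norm_zetaWeight_le' t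
      _ = zetaSq t * Real.exp (-(Real.pi / 2 * -t)) := by
          rw [mul_left_comm, ← Real.exp_add]; congr 2; ring

theorem continuous_exp_mul_zetaWeight :
    Continuous fun t : ℝ => cexp (-(Real.pi / 2 * t)) * zetaWeight t :=
  (by fun_prop : Continuous fun t : ℝ => cexp (-(Real.pi / 2 * t))).mul continuous_zetaWeight

theorem integrable_exp_mul_zetaWeight {a : ℝ} (ha : a < Real.pi / 2) :
    Integrable fun t : ℝ => ‖cexp (-(Real.pi / 2 * t)) * zetaWeight t‖ * Real.exp (a * |t|) :=
  integrable_of_norm_le_zetaSq le_rfl continuous_exp_mul_zetaWeight.aestronglyMeasurable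
    (Eventually.of_forall norm_exp_mul_zetaWeight_le) ha

/-- The cosine factor of the functional equation at `s = 1/2 + it`: this is where the weight
`1 + i e^{-πt}` comes from. -/
theorem two_mul_cos_critical (t : ℝ) :
    2 * Complex.cos (Real.pi * (1 / 2 + I * t) / 2)
      = cexp (-(I * Real.pi / 4)) * cexp (Real.pi / 2 * t)
        * (1 + I * Real.exp (-(Real.pi * t))) := by
  rw [Complex.two_cos]
  have hI : cexp (I * Real.pi / 2) = I := by
    rw [show I * Real.pi / 2 = Real.pi / 2 * I by ring, exp_pi_div_two_mul_I]
  have h1 : I * (Real.exp (-(Real.pi * t)) : ℂ) = cexp (I * Real.pi / 2 - Real.pi * t) := by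
    rw [sub_eq_add_neg, Complex.exp_add, hI]; push_cast; rfl
  have hII := I_mul_I
  have h2 : cexp (-(Real.pi * (1 / 2 + I * t) / 2) * I)
      = cexp (-(I * Real.pi / 4)) * cexp (Real.pi / 2 * t) := by
    rw [← Complex.exp_add]; congr 1
    linear_combination (-(Real.pi * t / 2) : ℂ) * hII
  have h3 : cexp (Real.pi * (1 / 2 + I * t) / 2 * I)
      = cexp (-(I * Real.pi / 4)) * cexp (Real.pi / 2 * t)
        * cexp (I * Real.pi / 2 - Real.pi * t) := by
    rw [← Complex.exp_add, ← Complex.exp_add]; congr 1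
    linear_combination (Real.pi * t / 2 : ℂ) * hII
  rw [h1, h2, h3]; ring

theorem norm_sq_riemannZeta_half (t : ℝ) :
    riemannZeta (1 / 2 + I * t) * riemannZeta (1 - (1 / 2 + I * t)) = zetaSq t := by
  have h : (1 - (1 / 2 + I * t) : ℂ) = (starRingEnd ℂ) (1 / 2 + I * t) := by
    apply Complex.ext <;> simp; norm_num
  rw [h, riemannZeta_conj, mul_conj, normSq_eq_norm_sq, zetaSq]

/-- The functional equation turns `Γ(s) ζ(s)²` on the critical line into `|ζ(s)|²` with an
elementary weight. -/
theorem Gamma_mul_riemannZeta_sq (t : ℝ) :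
    Gamma (1 / 2 + I * t) * riemannZeta (1 / 2 + I * t) ^ 2
      = (2 * Real.pi : ℂ) ^ (1 / 2 + I * t : ℂ) * cexp (I * Real.pi / 4)
        * (cexp (-(Real.pi / 2 * t)) * zetaWeight t) := by
  have hs : ∀ n : ℕ, (1 / 2 + I * t : ℂ) ≠ -n := by
    intro n h
    have := congrArg re h
    simp at this
    have hn : (0 : ℝ) ≤ n := n.cast_nonneg
    linarith
  have h1 := riemannZeta_one_sub hs (half_add_I_mul_ne_one t)
  have h2 := norm_sq_riemannZeta_half t
  have h3 := two_mul_cos_critical t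
  set s : ℂ := 1 / 2 + I * t
  have hpi : (2 * Real.pi : ℂ) ≠ 0 := by exact_mod_cast Real.two_pi_pos.ne'
  have h4 : (2 * Real.pi : ℂ) ^ s * (2 * Real.pi : ℂ) ^ (-s) = 1 := by
    rw [← cpow_add _ _ hpi, add_neg_cancel, cpow_zero]
  have h5 : cexp (I * Real.pi / 4) * cexp (-(I * Real.pi / 4)) = 1 := by
    rw [← Complex.exp_add, add_neg_cancel, Complex.exp_zero]
  have h6 : cexp (-(Real.pi / 2 * t)) * cexp (Real.pi / 2 * t) = 1 := by
    rw [← Complex.exp_add, neg_add_cancel, Complex.exp_zero]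
  have h7 := one_add_I_mul_ne_zero (Real.exp (-(Real.pi * t)))
  rw [zetaWeight, ← h2, h1]
  set E : ℂ := 1 + I * (Real.exp (-(Real.pi * t)) : ℂ)
  set c := Complex.cos (Real.pi * s / 2)
  set G := Gamma s
  set Z := riemannZeta s
  have h8 : (2 * Real.pi : ℂ) ^ s * (2 * Real.pi : ℂ) ^ (-s) * (cexp (I * Real.pi / 4) *
      cexp (-(Real.pi / 2 * t))) * (2 * c) = E := by
    rw [h3, h4]
    linear_combination (E * cexp (-(Real.pi / 2 * t)) * cexp (Real.pi / 2 * t)) * h5 + E * h6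
  have h9 : ∀ P Q e₁ e₂ : ℂ, P * e₁ * (e₂ * (Z * (2 * Q * G * c * Z) / E))
      = P * Q * (e₁ * e₂) * (2 * c) * (G * Z ^ 2) / E := fun P Q e₁ e₂ => by ring
  rw [h9, h8, mul_div_cancel_left₀ _ h7]

/-! ### The Lambert series of the divisor function -/

/-- The Lambert series `∑_{m,n ≥ 1} e^{-mnw} = ∑ d(n) e^{-nw}`, as a double sum. -/
noncomputable def divisorExp (w : ℂ) : ℂ :=
  ∑' p : ℕ × ℕ, cexp (-(((p.1 + 1 : ℕ) : ℂ) * ((p.2 + 1 : ℕ) : ℂ) * w))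

theorem norm_cexp_neg_natCast_mul (m n : ℕ) (w : ℂ) :
    ‖cexp (-((m : ℂ) * (n : ℂ) * w))‖ = Real.exp (-((m : ℝ) * n * w.re)) := by
  rw [Complex.norm_exp]
  congr 1
  rw [show (m : ℂ) * n * w = ((m * n : ℝ) : ℂ) * w by push_cast; ring, neg_re, re_ofReal_mul]

theorem summable_exp_neg_mul {ε : ℝ} (hε : 0 < ε) :
    Summable fun p : ℕ × ℕ => Real.exp (-(((p.1 + 1 : ℕ) : ℝ) * ((p.2 + 1 : ℕ) : ℝ) * ε)) := by
  have h1 : Summable fun n : ℕ => Real.exp (-ε) ^ n :=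
    summable_geometric_of_lt_one (Real.exp_pos _).le (by simpa using hε)
  refine Summable.of_nonneg_of_le (fun _ => (Real.exp_pos _).le) (fun p => ?_)
    (h1.mul_of_nonneg h1 (fun _ => by positivity) (fun _ => by positivity))
  rw [← Real.exp_nat_mul, ← Real.exp_nat_mul, ← Real.exp_add]
  apply Real.exp_le_exp.2
  push_cast
  have h2 : (0 : ℝ) ≤ p.1 := Nat.cast_nonneg _
  have h3 : (0 : ℝ) ≤ p.2 := Nat.cast_nonneg _
  nlinarith [mul_nonneg (mul_nonneg h2 h3) hε.le]

theorem summable_divisorExp {w : ℂ} (hw : 0 < w.re) :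
    Summable fun p : ℕ × ℕ => cexp (-(((p.1 + 1 : ℕ) : ℂ) * ((p.2 + 1 : ℕ) : ℂ) * w)) := by
  refine Summable.of_norm ?_
  simp only [norm_cexp_neg_natCast_mul]
  exact summable_exp_neg_mul hw

theorem differentiableOn_divisorExp : DifferentiableOn ℂ divisorExp {w | 0 < w.re} := by
  intro w hw
  have hw' : 0 < w.re := hw
  have h : DifferentiableOn ℂ divisorExp {z | w.re / 2 < z.re} := by
    refine differentiableOn_tsum_of_summable_norm (summable_exp_neg_mul (half_pos hw'))
      (fun p => by fun_prop) (isOpen_lt continuous_const continuous_re) fun p z hz => ?_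
    rw [norm_cexp_neg_natCast_mul]
    have : w.re / 2 < z.re := hz
    gcongr
  exact (h.differentiableAt ((isOpen_lt continuous_const continuous_re).mem_nhds
    (show w.re / 2 < w.re by linarith))).differentiableWithinAt

theorem divisorExp_add_two_pi_I (w : ℂ) : divisorExp (w + 2 * Real.pi * I) = divisorExp w := by
  unfold divisorExp
  refine tsum_congr fun p => ?_
  rw [show -(((p.1 + 1 : ℕ) : ℂ) * ((p.2 + 1 : ℕ) : ℂ) * (w + 2 * Real.pi * I))
    = -(((p.1 + 1 : ℕ) : ℂ) * ((p.2 + 1 : ℕ) : ℂ) * w)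
      - (((p.1 + 1) * (p.2 + 1) : ℕ) : ℂ) * (2 * Real.pi * I) by push_cast; ring,
    Complex.exp_sub, Complex.exp_nat_mul_two_pi_mul_I, div_one]

theorem hasSum_exp_geometric {w : ℂ} (hw : 0 < w.re) (m : ℕ) :
    HasSum (fun n : ℕ => cexp (-(((m + 1 : ℕ) : ℂ) * ((n + 1 : ℕ) : ℂ) * w)))
      (cexp (-(((m + 1 : ℕ) : ℂ) * w)) / (1 - cexp (-(((m + 1 : ℕ) : ℂ) * w)))) := by
  have hlt : ‖cexp (-(((m + 1 : ℕ) : ℂ) * w))‖ < 1 := by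
    have := norm_cexp_neg_natCast_mul (m + 1) 1 w
    rw [Nat.cast_one, mul_one] at this
    rw [this, Real.exp_lt_one_iff]
    simp only [Nat.cast_one, mul_one, Left.neg_neg_iff]
    exact mul_pos (by positivity) hw
  have h := (hasSum_geometric_of_norm_lt_one hlt).mul_left (cexp (-(((m + 1 : ℕ) : ℂ) * w)))
  rw [← div_eq_mul_inv] at h
  refine h.congr_fun fun n => ?_
  rw [← Complex.exp_nat_mul, ← Complex.exp_add]
  congr 1; push_cast; ring

theorem divisorExp_isBigO_top :
    (fun x : ℝ => divisorExp x) =O[atTop] fun x : ℝ => Real.exp (-(1 / 2) * x) := by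
  refine Asymptotics.IsBigO.of_bound (∑' p : ℕ × ℕ,
    Real.exp (-(((p.1 + 1 : ℕ) : ℝ) * ((p.2 + 1 : ℕ) : ℝ) * (1 / 2)))) ?_
  filter_upwards [eventually_ge_atTop 1] with x hx
  have hs := summable_exp_neg_mul (ε := x) (by linarith)
  rw [Real.norm_of_nonneg (Real.exp_pos _).le, ← tsum_mul_right]
  have hn : ∀ p : ℕ × ℕ, ‖cexp (-(((p.1 + 1 : ℕ) : ℂ) * ((p.2 + 1 : ℕ) : ℂ) * (x : ℂ)))‖
      = Real.exp (-(((p.1 + 1 : ℕ) : ℝ) * ((p.2 + 1 : ℕ) : ℝ) * x)) := fun p => by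
    rw [norm_cexp_neg_natCast_mul, ofReal_re]
  refine (norm_tsum_le_tsum_norm (by simpa only [hn] using hs)).trans ?_
  simp only [hn]
  refine hs.tsum_le_tsum (fun p => ?_)
    ((summable_exp_neg_mul (by norm_num : (0 : ℝ) < 1 / 2)).mul_right _)
  rw [← Real.exp_add]
  apply Real.exp_le_exp.2
  have h1 : (1 : ℝ) ≤ ((p.1 + 1 : ℕ) : ℝ) * ((p.2 + 1 : ℕ) : ℝ) := by
    exact_mod_cast Nat.mul_pos (Nat.succ_pos p.1) (Nat.succ_pos p.2)
  nlinarith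

theorem summable_one_div_nat_add_one_rpow {σ : ℝ} (hσ : 1 < σ) :
    Summable fun n : ℕ => 1 / ((n + 1 : ℕ) : ℝ) ^ σ :=
  (summable_nat_add_iff 1 (f := fun n : ℕ => 1 / (n : ℝ) ^ σ)).2
    (Real.summable_one_div_nat_rpow.2 hσ)

theorem mellin_divisorExp {s : ℂ} (hs : 1 < s.re) :
    mellin (fun x : ℝ => divisorExp x) s = Gamma s * riemannZeta s ^ 2 := by
  have hsum := summable_one_div_nat_add_one_rpow hs
  have h := hasSum_mellin (ι := ℕ × ℕ) (a := fun _ => 1)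
    (p := fun p => ((p.1 + 1 : ℕ) : ℝ) * ((p.2 + 1 : ℕ) : ℝ))
    (F := fun x : ℝ => divisorExp x) (s := s) (fun p => Or.inr (by positivity)) (by linarith)
    (fun t ht => by
      refine (summable_divisorExp (w := (t : ℂ)) (by simpa using ht)).hasSum.congr_fun fun p => ?_
      push_cast; ring_nf)
    (by
      refine (hsum.mul_of_nonneg hsum (fun _ => by positivity) fun _ => by positivity).congr
        fun p => ?_
      rw [norm_one, Real.mul_rpow (by positivity) (by positivity), one_div_mul_one_div])
  have hn : Summable fun n : ℕ => ‖1 / ((n : ℂ) + 1) ^ s‖ := by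
    refine hsum.congr fun n => ?_
    rw [norm_div, norm_one, ← Nat.cast_add_one, norm_natCast_cpow_of_pos n.succ_pos]
  rw [← h.tsum_eq, sq, zeta_eq_tsum_one_div_nat_add_one_cpow hs,
    tsum_mul_tsum_of_summable_norm hn hn, ← tsum_mul_left]
  refine tsum_congr fun p => ?_
  rw [ofReal_mul, mul_cpow_ofReal_nonneg (by positivity) (by positivity)]
  push_cast
  rw [one_div_mul_one_div, mul_one, mul_one_div]

/-- `x ↦ 1 / (e^x - 1)` has Mellin transform `Γ(s) ζ(s)`. -/
theorem mellin_exp_div_one_sub_exp {s : ℂ} (hs : 1 < s.re) :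
    mellin (fun x : ℝ => cexp (-(x : ℂ)) / (1 - cexp (-(x : ℂ)))) s
      = Gamma s * riemannZeta s := by
  have hsum := summable_one_div_nat_add_one_rpow hs
  have h := hasSum_mellin (ι := ℕ) (a := fun _ => 1) (p := fun n => ((n + 1 : ℕ) : ℝ))
    (F := fun x : ℝ => cexp (-(x : ℂ)) / (1 - cexp (-(x : ℂ)))) (s := s)
    (fun p => Or.inr (by positivity)) (by linarith)
    (fun t ht => by
      have := hasSum_exp_geometric (w := (t : ℂ)) (by simpa using ht) 0
      simp only [zero_add, Nat.cast_one, one_mul] at this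
      refine this.congr_fun fun p => ?_
      push_cast; ring_nf)
    (by simpa using hsum)
  rw [← h.tsum_eq, zeta_eq_tsum_one_div_nat_add_one_cpow hs, ← tsum_mul_left]
  refine tsum_congr fun n => ?_
  push_cast
  rw [mul_one, mul_one_div]

/-! ### The regularised Bose kernel -/

/-- The entire function `(1 - e^{-z}) / z`. -/
noncomputable def expQuot (z : ℂ) : ℂ := dslope (fun z => 1 - cexp (-z)) 0 z

/-- The entire function `(1 - expQuot z) / z`. -/
noncomputable def expQuotSlope (z : ℂ) : ℂ := dslope (fun z => 1 - expQuot z) 0 z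

/-- The kernel `1 / (e^z - 1) - e^{-z} / z`, written so that it is visibly holomorphic at `0`. -/
noncomputable def boseKernel (z : ℂ) : ℂ := cexp (-z) * (expQuotSlope z / expQuot z)

theorem differentiable_dslope {f : ℂ → ℂ} (hf : Differentiable ℂ f) (c : ℂ) :
    Differentiable ℂ (dslope f c) := by
  rw [← differentiableOn_univ] at hf ⊢
  exact (Complex.differentiableOn_dslope univ_mem).2 hf

theorem differentiable_expQuot : Differentiable ℂ expQuot :=
  differentiable_dslope (by fun_prop) 0

theorem differentiable_expQuotSlope : Differentiable ℂ expQuotSlope :=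
  differentiable_dslope ((differentiable_const 1).sub differentiable_expQuot) 0

theorem expQuot_zero : expQuot 0 = 1 := by
  have h : HasDerivAt (fun z : ℂ => 1 - cexp (-z)) 1 0 := by
    have := ((hasDerivAt_neg (0 : ℂ)).cexp).const_sub 1
    simpa using this
  rw [expQuot, dslope_same, h.deriv]

theorem mul_expQuot (z : ℂ) : z * expQuot z = 1 - cexp (-z) := by
  have := sub_smul_dslope (fun z => 1 - cexp (-z)) 0 z
  simpa [expQuot] using this

theorem mul_expQuotSlope (z : ℂ) : z * expQuotSlope z = 1 - expQuot z := by
  have := sub_smul_dslope (fun z => 1 - expQuot z) 0 z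
  simpa [expQuotSlope, expQuot_zero] using this

theorem expQuot_ne_zero {z : ℂ} (hz : |z.im| < 2 * Real.pi) : expQuot z ≠ 0 := by
  rcases eq_or_ne z 0 with rfl | h0
  · rw [expQuot_zero]; exact one_ne_zero
  intro h
  have h1 := mul_expQuot z
  rw [h, mul_zero, eq_comm, sub_eq_zero, eq_comm, Complex.exp_eq_one_iff] at h1
  obtain ⟨n, hn⟩ := h1
  have hre : z.re = 0 := by
    have := congrArg re hn
    simpa using this
  have him : -z.im = n * (2 * Real.pi) := by
    have := congrArg im hn
    simpa using this
  have hn0 : n = 0 := by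
    by_contra hne
    have h2 : (1 : ℝ) ≤ |(n : ℝ)| := by exact_mod_cast Int.one_le_abs hne
    rw [← abs_neg, him, abs_mul, abs_of_pos Real.two_pi_pos] at hz
    nlinarith [Real.two_pi_pos]
  rw [hn0] at him
  apply h0
  apply Complex.ext
  · simpa using hre
  · simpa using him

theorem boseKernel_eq {z : ℂ} (h0 : z ≠ 0) (h1 : expQuot z ≠ 0) :
    boseKernel z = cexp (-z) / (1 - cexp (-z)) - cexp (-z) / z := by
  have h2 : expQuotSlope z = (1 - expQuot z) / z := by
    rw [← mul_expQuotSlope, mul_div_cancel_left₀ _ h0]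
  rw [boseKernel, h2, ← mul_expQuot z]
  field_simp

theorem differentiableAt_boseKernel {z : ℂ} (h : expQuot z ≠ 0) :
    DifferentiableAt ℂ boseKernel z :=
  (by fun_prop : DifferentiableAt ℂ (fun z => cexp (-z)) z).mul
    ((differentiable_expQuotSlope z).div (differentiable_expQuot z) h)

/-- A right angle around the positive axis, with its vertex at `-1`. It contains the balls of radius
`1/2` around the points with `|im z| ≤ re z`, on which Cauchy's estimates are applied, and none of
the non-zero multiples of `2πi`, the poles of `boseKernel`. -/
def wideSector : Set ℂ := {z | |z.im| ≤ z.re + 1}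

theorem expQuot_ne_zero_of_mem_wideSector {z : ℂ} (hz : z ∈ wideSector) : expQuot z ≠ 0 := by
  by_cases h : |z.im| < 2 * Real.pi
  · exact expQuot_ne_zero h
  have h1 : |z.im| ≤ z.re + 1 := hz
  have h2 : 0 < z.re := by linarith [Real.pi_gt_three, not_lt.1 h]
  intro h3
  have h4 := mul_expQuot z
  rw [h3, mul_zero, eq_comm, sub_eq_zero] at h4
  have h5 := congrArg norm h4
  rw [norm_one, Complex.norm_exp, eq_comm, Real.exp_eq_one_iff, neg_re] at h5
  linarith

theorem exists_norm_boseKernel_le :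
    ∃ C, 0 ≤ C ∧ ∀ z ∈ wideSector, ‖boseKernel z‖ ≤ C * Real.exp (-z.re) := by
  have hclosed : IsClosed (wideSector ∩ {z | z.re ≤ 1}) :=
    (isClosed_le (continuous_abs.comp continuous_im) (continuous_re.add continuous_const)).inter
      (isClosed_le continuous_re continuous_const)
  have hcomp : IsCompact (wideSector ∩ {z | z.re ≤ 1}) := by
    refine (isCompact_closedBall (0 : ℂ) 4).of_isClosed_subset hclosed fun z hz => ?_
    have h1 : |z.im| ≤ z.re + 1 := hz.1
    have h2 : z.re ≤ 1 := hz.2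
    have h3 : |z.re| ≤ 1 := abs_le.2 ⟨by linarith [abs_nonneg z.im], h2⟩
    rw [mem_closedBall_zero_iff]
    linarith [norm_le_abs_re_add_abs_im z]
  obtain ⟨C, hC⟩ := hcomp.exists_bound_of_continuousOn (f := fun z => expQuotSlope z / expQuot z)
    (differentiable_expQuotSlope.continuous.continuousOn.div
      differentiable_expQuot.continuous.continuousOn
      fun z hz => expQuot_ne_zero_of_mem_wideSector hz.1)
  refine ⟨max C ((1 - Real.exp (-1))⁻¹ + 1), le_max_of_le_right ?_, fun z hz => ?_⟩
  · have : Real.exp (-1) < 1 := by simp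
    have : 0 < 1 - Real.exp (-1) := by linarith
    positivity
  rw [boseKernel, norm_mul, Complex.norm_exp, neg_re, mul_comm]
  gcongr
  rcases le_total z.re 1 with h1 | h1
  · exact (hC z ⟨hz, h1⟩).trans (le_max_left _ _)
  refine le_trans ?_ (le_max_right _ _)
  have h0 : z ≠ 0 := by rintro rfl; norm_num at h1
  have hq := expQuot_ne_zero_of_mem_wideSector hz
  have h2 : expQuotSlope z / expQuot z = (1 - cexp (-z))⁻¹ - z⁻¹ := by
    have : expQuotSlope z = (1 - expQuot z) / z := by
      rw [← mul_expQuotSlope, mul_div_cancel_left₀ _ h0]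
    rw [this, ← mul_expQuot z]
    field_simp
  rw [h2]
  refine (norm_sub_le _ _).trans (add_le_add ?_ ?_)
  · rw [norm_inv]
    have h3 : Real.exp (-1) < 1 := by simp
    have h4 : ‖cexp (-z)‖ ≤ Real.exp (-1) := by
      rw [Complex.norm_exp, neg_re]; exact Real.exp_le_exp.2 (by linarith)
    have h5 : 1 - Real.exp (-1) ≤ ‖1 - cexp (-z)‖ := by
      have := norm_sub_norm_le (1 : ℂ) (cexp (-z))
      rw [norm_one] at this; linarith
    exact inv_anti₀ (by linarith) h5
  · rw [norm_inv]
    exact inv_le_one_of_one_le₀ (h1.trans ((le_abs_self _).trans (abs_re_le_norm z)))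

theorem mem_wideSector_of_near {z w : ℂ} (hz : |z.im| ≤ z.re) (hw : ‖w - z‖ ≤ 1 / 2) :
    w ∈ wideSector := by
  have h1 := (abs_re_le_norm (w - z)).trans hw
  have h2 := (abs_im_le_norm (w - z)).trans hw
  rw [sub_re, abs_le] at h1
  rw [sub_im, abs_le] at h2
  rw [abs_le] at hz
  change |w.im| ≤ w.re + 1
  exact abs_le.2 ⟨by linarith [h1.1, h2.1, hz.1], by linarith [h1.1, h2.2, hz.2]⟩

theorem differentiableAt_boseKernel_of_mem {z : ℂ} (hz : z ∈ wideSector) :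
    DifferentiableAt ℂ boseKernel z :=
  differentiableAt_boseKernel (expQuot_ne_zero_of_mem_wideSector hz)

theorem analyticAt_boseKernel {z : ℂ} (hz : |z.im| ≤ z.re) : AnalyticAt ℂ boseKernel z := by
  refine DifferentiableOn.analyticAt (s := Metric.ball z (1 / 2)) (fun w hw => ?_)
    (Metric.ball_mem_nhds z (by norm_num))
  refine (differentiableAt_boseKernel_of_mem (mem_wideSector_of_near hz ?_)).differentiableWithinAt
  rw [← dist_eq_norm]; exact (Metric.mem_ball.1 hw).le

theorem hasDerivAt_iteratedDeriv_boseKernel (k : ℕ) {z : ℂ} (hz : |z.im| ≤ z.re) :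
    HasDerivAt (iteratedDeriv k boseKernel) (iteratedDeriv (k + 1) boseKernel z) z := by
  rw [iteratedDeriv_succ]
  have : AnalyticAt ℂ (iteratedDeriv k boseKernel) z := by
    have h := (analyticAt_boseKernel hz)
    rw [iteratedDeriv_eq_iterate]
    exact h.iterated_deriv k
  exact this.differentiableAt.hasDerivAt

/-- Cauchy's estimates on circles of radius `1/2`. -/
theorem exists_norm_iteratedDeriv_boseKernel_le (k : ℕ) :
    ∃ C, 0 ≤ C ∧ ∀ z : ℂ, |z.im| ≤ z.re →
      ‖iteratedDeriv k boseKernel z‖ ≤ C * Real.exp (-z.re) := by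
  obtain ⟨C, hC0, hC⟩ := exists_norm_boseKernel_le
  refine ⟨k.factorial * (C * Real.exp (1 / 2)) / (1 / 2) ^ k, by positivity, fun z hz => ?_⟩
  have hsub : Metric.closedBall z (1 / 2) ⊆ wideSector := fun w hw =>
    mem_wideSector_of_near hz (by rw [← dist_eq_norm]; exact hw)
  have h := Complex.norm_iteratedDeriv_le_of_forall_mem_sphere_norm_le (f := boseKernel) (c := z)
    (R := 1 / 2) (C := C * Real.exp (1 / 2) * Real.exp (-z.re)) k (by norm_num) ?_ ?_
  · refine h.trans (le_of_eq ?_); ring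
  · refine DifferentiableOn.diffContOnCl ?_
    rw [closure_ball _ (by norm_num)]
    exact fun w hw => (differentiableAt_boseKernel_of_mem (hsub hw)).differentiableWithinAt
  · intro w hw
    refine (hC w (hsub (Metric.sphere_subset_closedBall hw))).trans ?_
    rw [mul_assoc, ← Real.exp_add]
    gcongr
    have h1 : |(w - z).re| ≤ 1 / 2 := by
      refine (abs_re_le_norm _).trans ?_
      rw [← dist_eq_norm]; exact (Metric.mem_sphere.1 hw).le
    rw [sub_re, abs_le] at h1
    linarith [h1.1]

/-! ### Euler–Maclaurin summation on the half-line -/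

/-- The Bernoulli polynomials divided by `n!`, so that each is a primitive of the previous one. -/
noncomputable def normBernoulli (n : ℕ) (x : ℝ) : ℝ := bernoulliFun n x / n.factorial

theorem hasDerivAt_normBernoulli (n : ℕ) (x : ℝ) :
    HasDerivAt (normBernoulli (n + 1)) (normBernoulli n x) x := by
  have h := (hasDerivAt_bernoulliFun (n + 1) x).div_const ((n + 1).factorial : ℝ)
  change HasDerivAt (fun x => bernoulliFun (n + 1) x / ((n + 1).factorial : ℝ)) _ x
  convert! h using 1
  rw [normBernoulli, Nat.factorial_succ, Nat.add_sub_cancel]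
  have : (n.factorial : ℝ) ≠ 0 := by positivity
  push_cast
  field_simp

theorem continuous_normBernoulli (n : ℕ) : Continuous (normBernoulli n) :=
  (continuous_bernoulliFun n).div_const _

theorem normBernoulli_endpoints (n : ℕ) : normBernoulli (n + 2) 1 = normBernoulli (n + 2) 0 := by
  rw [normBernoulli, normBernoulli, bernoulliFun_endpoints_eq_of_ne_one (by omega)]

/-- Integration by parts on a unit interval, for a weight `p` with primitive `q`. -/
theorem integral_mul_eq_of_hasDerivAt {p q : ℝ → ℝ} {g g' : ℝ → ℂ} {a : ℝ}
    (hq : ∀ x, HasDerivAt q (p x) x) (hp : Continuous p)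
    (hg : ∀ x ∈ Icc a (a + 1), HasDerivAt g (g' x) x)
    (hg' : ContinuousOn g' (Icc a (a + 1))) :
    ∫ x in a..a + 1, (p (x - a) : ℂ) * g x
      = q 1 * g (a + 1) - q 0 * g a - ∫ x in a..a + 1, (q (x - a) : ℂ) * g' x := by
  have hle : a ≤ a + 1 := by linarith
  have hu : uIcc a (a + 1) = Icc a (a + 1) := uIcc_of_le hle
  have h := intervalIntegral.integral_deriv_mul_eq_sub (a := a) (b := a + 1)
    (u := fun x => (q (x - a) : ℂ)) (v := g) (u' := fun x => (p (x - a) : ℂ)) (v' := g')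
    (fun x _ => ((hq (x - a)).comp_sub_const x a).ofReal_comp)
    (fun x hx => hg x (hu ▸ hx))
    (by
      apply Continuous.intervalIntegrable
      fun_prop)
    (by
      apply ContinuousOn.intervalIntegrable
      rwa [hu])
  rw [intervalIntegral.integral_add] at h
  · simp only [add_sub_cancel_left, sub_self] at h
    rw [← h]; ring
  · apply ContinuousOn.intervalIntegrable
    rw [hu]
    exact (by fun_prop : Continuous fun x : ℝ => (p (x - a) : ℂ)).continuousOn.mul
      fun x hx => (hg x hx).continuousAt.continuousWithinAt
  · apply ContinuousOn.intervalIntegrable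
    rw [hu]
    have hqc : Continuous q := continuous_iff_continuousAt.2 fun x => (hq x).continuousAt
    exact (by fun_prop : Continuous fun x : ℝ => (q (x - a) : ℂ)).continuousOn.mul hg'

/-- The coefficients `(-1)^{k+1} B_{k+1} / (k+1)!` of the Euler–Maclaurin formula, for sums that omit
the left endpoint. -/
noncomputable def eulerMaclaurinCoeff (k : ℕ) : ℝ := (-1) ^ (k + 1) * normBernoulli (k + 1) 0

theorem eulerMaclaurin_unit {f : ℕ → ℝ → ℂ} {a : ℝ}
    (hf : ∀ k, ∀ x ∈ Icc a (a + 1), HasDerivAt (f k) (f (k + 1) x) x) (N : ℕ) :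
    f 0 (a + 1) = (∫ x in a..a + 1, f 0 x)
      + ∑ k ∈ Finset.range (N + 1), (eulerMaclaurinCoeff k : ℂ) * (f k (a + 1) - f k a)
      + (-1) ^ N * ∫ x in a..a + 1, (normBernoulli (N + 1) (x - a) : ℂ) * f (N + 1) x := by
  have hc : ∀ k, ContinuousOn (f k) (Icc a (a + 1)) := fun k x hx =>
    (hf k x hx).continuousAt.continuousWithinAt
  induction N with
  | zero =>
    have h := integral_mul_eq_of_hasDerivAt (g := f 0) (g' := f 1)
      (hasDerivAt_normBernoulli 0) (continuous_normBernoulli 0) (hf 0) (hc 1)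
    have h0 : ∀ x, normBernoulli 0 x = 1 := fun x => by simp [normBernoulli]
    have h1 : normBernoulli 1 1 = 1 / 2 := by simp [normBernoulli]; norm_num
    have h2 : normBernoulli 1 0 = -(1 / 2) := by simp [normBernoulli]
    simp only [h0, zero_add, h1, h2, ofReal_one, one_mul] at h
    simp only [zero_add, Finset.sum_range_one, eulerMaclaurinCoeff, h2, pow_one, pow_zero, one_mul]
    rw [h]; push_cast; ring
  | succ N ih =>
    have h := integral_mul_eq_of_hasDerivAt (g := f (N + 1)) (g' := f (N + 2))
      (hasDerivAt_normBernoulli (N + 1)) (continuous_normBernoulli (N + 1)) (hf (N + 1)) (hc (N + 2))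
    rw [normBernoulli_endpoints] at h
    rw [Finset.sum_range_succ, ih, h, eulerMaclaurinCoeff]
    push_cast
    ring

theorem eulerMaclaurin_nat {f : ℕ → ℝ → ℂ}
    (hf : ∀ k, ∀ x, 0 ≤ x → HasDerivAt (f k) (f (k + 1) x) x) (N M : ℕ) :
    ∑ m ∈ Finset.range M, f 0 (m + 1) = (∫ x in (0 : ℝ)..M, f 0 x)
      + ∑ k ∈ Finset.range (N + 1), (eulerMaclaurinCoeff k : ℂ) * (f k M - f k 0)
      + ∑ m ∈ Finset.range M,
        (-1) ^ N * ∫ x in (m : ℝ)..m + 1, (normBernoulli (N + 1) (x - m) : ℂ) * f (N + 1) x := by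
  have hint : ∀ a b : ℝ, 0 ≤ a → 0 ≤ b → IntervalIntegrable (f 0) volume a b := fun a b ha hb => by
    apply ContinuousOn.intervalIntegrable
    intro x hx
    exact (hf 0 x ((le_min ha hb).trans hx.1)).continuousAt.continuousWithinAt
  induction M with
  | zero => simp
  | succ M ih =>
    have hM : (0 : ℝ) ≤ M := M.cast_nonneg
    have h := eulerMaclaurin_unit (a := M) (fun k x hx => hf k x (hM.trans hx.1)) N
    rw [Finset.sum_range_succ, ih, h, Finset.sum_range_succ _ M, Nat.cast_add_one,
      ← intervalIntegral.integral_add_adjacent_intervals (hint 0 M le_rfl hM)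
        (hint M (M + 1) hM (by linarith))]
    have hs : ∑ k ∈ Finset.range (N + 1), (eulerMaclaurinCoeff k : ℂ) * (f k (M + 1) - f k 0)
        = ∑ k ∈ Finset.range (N + 1), (eulerMaclaurinCoeff k : ℂ) * (f k M - f k 0)
        + ∑ k ∈ Finset.range (N + 1), (eulerMaclaurinCoeff k : ℂ) * (f k (M + 1) - f k M) := by
      rw [← Finset.sum_add_distrib]; exact Finset.sum_congr rfl fun k _ => by ring
    rw [hs]; ring

theorem exists_normBernoulli_bound (n : ℕ) :
    ∃ B, 0 ≤ B ∧ ∀ x ∈ Icc (0 : ℝ) 1, |normBernoulli n x| ≤ B := by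
  obtain ⟨B, hB⟩ := isCompact_Icc.exists_bound_of_continuousOn
    (continuous_normBernoulli n).continuousOn (s := Icc (0 : ℝ) 1)
  exact ⟨B, (abs_nonneg _).trans (hB 0 (by simp)), hB⟩

theorem integral_exp_neg_mul_le {c : ℝ} (hc : 0 < c) (M : ℝ) :
    ∫ x in (0 : ℝ)..M, Real.exp (-(c * x)) ≤ 1 / c := by
  have h : ∫ x in (0 : ℝ)..M, Real.exp (-(c * x)) = (1 - Real.exp (-(c * M))) / c := by
    rw [intervalIntegral.integral_eq_sub_of_hasDerivAt (f := fun x => -Real.exp (-(c * x)) / c)]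
    · simp; ring
    · intro x _
      have h1 : HasDerivAt (fun x : ℝ => -(c * x)) (-c) x := by
        simpa using ((hasDerivAt_id x).const_mul c).fun_neg
      convert! (h1.exp.fun_neg.div_const c) using 1
      field_simp
    · apply Continuous.intervalIntegrable; fun_prop
  rw [h]
  gcongr
  linarith [Real.exp_pos (-(c * M))]

/-- The Euler–Maclaurin formula on the half-line for exponentially decaying functions; `f k` is the
`k`-th derivative of `f 0`. The constant `B` depends on the order alone, which makes the bound
uniform over the functions `x ↦ boseKernel (x * w)` to which it is applied. -/
theorem norm_tsum_sub_eulerMaclaurin_le (N : ℕ) : ∃ B, 0 ≤ B ∧ ∀ (f : ℕ → ℝ → ℂ) (c K : ℝ),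
    0 < c → (∀ k, ∀ x, 0 ≤ x → HasDerivAt (f k) (f (k + 1) x) x) →
    (∀ k, ∃ C, ∀ x, 0 ≤ x → ‖f k x‖ ≤ C * Real.exp (-(c * x))) →
    (∀ x, 0 ≤ x → ‖f (N + 1) x‖ ≤ K * Real.exp (-(c * x))) →
    ‖(∑' m : ℕ, f 0 (m + 1)) - (∫ x in Ioi (0 : ℝ), f 0 x)
      + ∑ k ∈ Finset.range (N + 1), (eulerMaclaurinCoeff k : ℂ) * f k 0‖ ≤ B * K / c := by
  obtain ⟨B, hB0, hB⟩ := exists_normBernoulli_bound (N + 1)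
  refine ⟨B, hB0, fun f c K hc hf hbd hK => ?_⟩
  have hexp : Tendsto (fun M : ℕ => Real.exp (-(c * (M : ℝ)))) atTop (𝓝 0) :=
    Real.tendsto_exp_neg_atTop_nhds_zero.comp
      (tendsto_natCast_atTop_atTop.const_mul_atTop hc)
  have hlim : ∀ k, Tendsto (fun M : ℕ => f k M) atTop (𝓝 0) := fun k => by
    obtain ⟨C, hC⟩ := hbd k
    refine squeeze_zero_norm (fun M => hC M M.cast_nonneg) ?_
    simpa using hexp.const_mul C
  have hcont : ∀ k, ContinuousOn (f k) (Ici 0) := fun k x hx =>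
    (hf k x hx).continuousAt.continuousWithinAt
  have hint : IntegrableOn (f 0) (Ioi 0) := by
    obtain ⟨C, hC⟩ := hbd 0
    refine ((exp_neg_integrableOn_Ioi 0 hc).const_mul C).mono'
      ((hcont 0).mono Ioi_subset_Ici_self |>.aestronglyMeasurable measurableSet_Ioi) ?_
    refine (ae_restrict_iff' measurableSet_Ioi).2 (Eventually.of_forall fun x hx => ?_)
    have := hC x (le_of_lt hx)
    rwa [← neg_mul] at this
  have hsum : Summable fun m : ℕ => f 0 (m + 1) := by
    obtain ⟨C, hC⟩ := hbd 0
    have hg : Summable fun m : ℕ => C * Real.exp (-c) ^ (m + 1) :=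
      ((summable_nat_add_iff 1).2 (summable_geometric_of_lt_one (Real.exp_pos _).le
        (by simpa using hc))).mul_left C
    refine Summable.of_norm_bounded hg fun m => ?_
    refine (hC (m + 1) (by positivity)).trans (le_of_eq ?_)
    rw [← Real.exp_nat_mul]; congr 2; push_cast; ring
  have hL : Tendsto (fun M : ℕ => (∑ m ∈ Finset.range M, f 0 (m + 1)) - (∫ x in (0 : ℝ)..M, f 0 x)
      - ∑ k ∈ Finset.range (N + 1), (eulerMaclaurinCoeff k : ℂ) * (f k M - f k 0)) atTop
      (𝓝 ((∑' m : ℕ, f 0 (m + 1)) - (∫ x in Ioi (0 : ℝ), f 0 x)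
        - ∑ k ∈ Finset.range (N + 1), (eulerMaclaurinCoeff k : ℂ) * (0 - f k 0))) :=
    (hsum.hasSum.tendsto_sum_nat.sub
      (intervalIntegral_tendsto_integral_Ioi 0 hint tendsto_natCast_atTop_atTop)).sub
      (tendsto_finsetSum _ fun k _ => ((hlim k).sub_const _).const_mul _)
  have heq : (∑' m : ℕ, f 0 (m + 1)) - (∫ x in Ioi (0 : ℝ), f 0 x)
      + ∑ k ∈ Finset.range (N + 1), (eulerMaclaurinCoeff k : ℂ) * f k 0
      = (∑' m : ℕ, f 0 (m + 1)) - (∫ x in Ioi (0 : ℝ), f 0 x)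
        - ∑ k ∈ Finset.range (N + 1), (eulerMaclaurinCoeff k : ℂ) * (0 - f k 0) := by
    simp [sub_eq_add_neg]
  rw [heq]
  refine le_of_tendsto hL.norm (Eventually.of_forall fun M => ?_)
  -- what is left of the partial sum is the remainder integral over `[0, M]`
  have hcancel : ∀ A B R : ℂ, A + B + R - A - B = R := fun _ _ _ => by ring
  rw [eulerMaclaurin_nat hf N M, hcancel]
  have hrem : ∀ m : ℕ, ‖(-1 : ℂ) ^ N * ∫ x in (m : ℝ)..m + 1,
      (normBernoulli (N + 1) (x - m) : ℂ) * f (N + 1) x‖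
      ≤ ∫ x in (m : ℝ)..m + 1, B * K * Real.exp (-(c * x)) := fun m => by
    rw [norm_mul, norm_pow, norm_neg, norm_one, one_pow, one_mul]
    refine intervalIntegral.norm_integral_le_of_norm_le (by linarith) ?_
      (Continuous.intervalIntegrable (by fun_prop) _ _)
    refine Eventually.of_forall fun x hx => ?_
    rw [norm_mul, norm_real, Real.norm_eq_abs, mul_assoc]
    have hx0 : 0 ≤ x := (Nat.cast_nonneg m).trans hx.1.le
    exact mul_le_mul (hB _ ⟨by linarith [hx.1], by linarith [hx.2]⟩) (hK x hx0) (norm_nonneg _) hB0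
  refine (norm_sum_le _ _).trans ((Finset.sum_le_sum fun m _ => hrem m).trans ?_)
  have hadj := intervalIntegral.sum_integral_adjacent_intervals (μ := volume) (a := fun m : ℕ => (m : ℝ))
    (f := fun x => B * K * Real.exp (-(c * x))) (n := M)
    (fun k _ => Continuous.intervalIntegrable (by fun_prop) _ _)
  simp only [Nat.cast_add_one, Nat.cast_zero] at hadj
  rw [hadj, intervalIntegral.integral_const_mul]
  have hK0 : 0 ≤ K := by
    have := (norm_nonneg _).trans (hK 0 le_rfl)
    simpa using this
  calc B * K * _ ≤ B * K * (1 / c) := by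
        gcongr
        exact integral_exp_neg_mul_le hc M
    _ = B * K / c := by ring

/-! ### The integral of the kernel -/

theorem mem_wideSector_ofReal {x : ℝ} (hx : 0 ≤ x) : (x : ℂ) ∈ wideSector := by
  change |(x : ℂ).im| ≤ (x : ℂ).re + 1
  simp; linarith

theorem continuousOn_boseKernel_ofReal : ContinuousOn (fun x : ℝ => boseKernel x) (Ici 0) :=
  fun _ hx => ((differentiableAt_boseKernel_of_mem (mem_wideSector_ofReal hx)).continuousAt.comp
    (f := fun x : ℝ => (x : ℂ)) continuous_ofReal.continuousAt).continuousWithinAt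

theorem boseKernel_isBigO_top :
    (fun x : ℝ => boseKernel x) =O[atTop] fun x : ℝ => Real.exp (-1 * x) := by
  obtain ⟨C, -, hC⟩ := exists_norm_boseKernel_le
  refine Asymptotics.IsBigO.of_bound C ?_
  filter_upwards [eventually_ge_atTop 0] with x hx
  rw [Real.norm_of_nonneg (Real.exp_pos _).le, neg_one_mul]
  simpa using hC x (mem_wideSector_ofReal hx)

theorem boseKernel_isBigO_zero :
    (fun x : ℝ => boseKernel x) =O[𝓝[>] 0] fun x : ℝ => x ^ (-(0 : ℝ)) := by
  obtain ⟨C, hC0, hC⟩ := exists_norm_boseKernel_le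
  refine Asymptotics.IsBigO.of_bound C ?_
  filter_upwards [self_mem_nhdsWithin] with x hx
  have hx0 : 0 ≤ x := le_of_lt hx
  simp only [neg_zero, Real.rpow_zero, norm_one, mul_one]
  refine (hC x (mem_wideSector_ofReal hx0)).trans ?_
  rw [ofReal_re]
  exact mul_le_of_le_one_right hC0 (Real.exp_le_one_iff.2 (by linarith))

theorem locallyIntegrableOn_boseKernel :
    LocallyIntegrableOn (fun x : ℝ => boseKernel x) (Ioi 0) :=
  (continuousOn_boseKernel_ofReal.mono Ioi_subset_Ici_self).locallyIntegrableOn measurableSet_Ioi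

/-- Subtracting `e^{-x}/x`, whose Mellin transform is `Γ(s - 1) = Γ(s)/(s - 1)`, removes the pole of
zeta: `riemannZeta₀ s = ζ(s) - 1/(s - 1)`. -/
theorem mellin_boseKernel {s : ℂ} (hs : 1 < s.re) :
    mellin (fun x : ℝ => boseKernel x) s = Gamma s * riemannZeta₀ s := by
  have hs1 : s ≠ 1 := by rintro rfl; simp at hs
  have hs1' : s - 1 ≠ 0 := sub_ne_zero.2 hs1
  have h1 : MellinConvergent (fun x : ℝ => boseKernel x) s :=
    mellinConvergent_of_isBigO_rpow_exp one_pos locallyIntegrableOn_boseKernel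
      boseKernel_isBigO_top boseKernel_isBigO_zero (by linarith)
  have hG : (fun x : ℝ => cexp (-(x : ℂ)) * (x : ℂ) ^ (s - 1 - 1))
      =ᵐ[volume.restrict (Ioi 0)] fun x : ℝ => (x : ℂ) ^ (s - 1) • (cexp (-(x : ℂ)) / x) := by
    refine (ae_restrict_iff' measurableSet_Ioi).2 (Eventually.of_forall fun x hx => ?_)
    have hx0 : (x : ℂ) ≠ 0 := by exact_mod_cast (ne_of_gt hx)
    change cexp (-(x : ℂ)) * (x : ℂ) ^ (s - 1 - 1) = (x : ℂ) ^ (s - 1) * (cexp (-(x : ℂ)) / x)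
    rw [cpow_sub (s - 1) 1 hx0, cpow_one]; ring
  have h2 : MellinConvergent (fun x : ℝ => cexp (-(x : ℂ)) / x) s := by
    have h := (Complex.GammaIntegral_convergent (s := s - 1) (by simpa using hs))
    refine Integrable.congr ?_ hG
    exact h.congr (Eventually.of_forall fun x => by push_cast; rfl)
  have h3 : mellin (fun x : ℝ => cexp (-(x : ℂ)) / x) s = Gamma (s - 1) := by
    rw [Complex.Gamma_eq_integral (by simpa using hs), GammaIntegral, mellin, ← integral_congr_ae hG]
    refine integral_congr_ae (Eventually.of_forall fun x => by push_cast; rfl)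
  have h4 := (hasMellin_add h1 h2).2
  have h5 : mellin (fun x : ℝ => boseKernel x + cexp (-(x : ℂ)) / x) s
      = mellin (fun x : ℝ => cexp (-(x : ℂ)) / (1 - cexp (-(x : ℂ)))) s := by
    refine setIntegral_congr_fun measurableSet_Ioi fun x hx => ?_
    have hx0 : (x : ℂ) ≠ 0 := by exact_mod_cast (ne_of_gt hx)
    simp only [boseKernel_eq hx0
      (expQuot_ne_zero_of_mem_wideSector (mem_wideSector_ofReal (le_of_lt hx))), sub_add_cancel]
  rw [h5, mellin_exp_div_one_sub_exp hs, h3] at h4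
  have h6 : Gamma s = (s - 1) * Gamma (s - 1) := by
    have := Complex.Gamma_add_one (s - 1) hs1'
    rwa [sub_add_cancel] at this
  have h7 : mellin (fun x : ℝ => boseKernel x) s = Gamma s * riemannZeta s - Gamma (s - 1) := by
    rw [h4]; ring
  rw [h7, riemannZeta_eq_inv_sub_add hs1, mul_add, h6]
  field_simp
  ring

/-- The integral of the regularised kernel over the positive axis is Euler's constant, the value at
`1` of `ζ(s) - 1/(s - 1)`. -/
theorem integral_boseKernel :
    ∫ x in Ioi (0 : ℝ), boseKernel x = (Real.eulerMascheroniConstant : ℂ) := by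
  have hcont : ContinuousAt (mellin fun x : ℝ => boseKernel x) 1 :=
    (mellin_differentiableAt_of_isBigO_rpow_exp one_pos locallyIntegrableOn_boseKernel
      boseKernel_isBigO_top boseKernel_isBigO_zero (by simp)).continuousAt
  have hcont2 : ContinuousAt (fun s => Gamma s * riemannZeta₀ s) 1 := by
    refine ContinuousAt.mul (Complex.differentiableAt_Gamma _ fun m h => ?_).continuousAt
      differentiable_riemannZeta₀.continuous.continuousAt
    have := congrArg re h
    simp at this
    linarith [m.cast_nonneg (α := ℝ)]
  have hseq : Tendsto (fun n : ℕ => ((1 + 1 / ((n : ℝ) + 1) : ℝ) : ℂ)) atTop (𝓝 1) := by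
    have h := (tendsto_const_nhds (x := (1 : ℝ))).add (tendsto_one_div_add_atTop_nhds_zero_nat (𝕜 := ℝ))
    rw [add_zero] at h
    have := (continuous_ofReal.tendsto (1 : ℝ)).comp h
    rw [ofReal_one] at this
    exact this
  have hlim := tendsto_nhds_unique ((hcont.tendsto.comp hseq).congr fun n => mellin_boseKernel
    (by rw [ofReal_re]; have : (0 : ℝ) < 1 / ((n : ℝ) + 1) := by positivity
        linarith)) (hcont2.tendsto.comp hseq)
  simp only [Complex.Gamma_one, riemannZeta₀_one, one_mul] at hlim
  rw [← hlim, mellin]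
  simp

theorem isOpen_sector : IsOpen {w : ℂ | |w.im| < w.re} :=
  isOpen_lt (continuous_abs.comp continuous_im) continuous_re

theorem convex_sector : Convex ℝ {w : ℂ | |w.im| < w.re} := by
  intro a ha b hb p q hp hq hpq
  have ha' : |a.im| < a.re := ha
  have hb' : |b.im| < b.re := hb
  change |(p • a + q • b).im| < (p • a + q • b).re
  simp only [add_im, smul_im, add_re, smul_re, smul_eq_mul]
  rw [abs_lt] at *
  rcases hp.eq_or_lt with rfl | hp'
  · have : q = 1 := by linarith
    subst this
    constructor <;> linarith
  · constructor <;> nlinarith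

theorem mul_mem_sector {w : ℂ} (hw : |w.im| < w.re) {x : ℝ} (hx : 0 ≤ x) :
    |((x : ℂ) * w).im| ≤ ((x : ℂ) * w).re := by
  rw [im_ofReal_mul, re_ofReal_mul, abs_mul, abs_of_nonneg hx]
  gcongr

theorem hasDerivAt_iteratedDeriv_boseKernel_mul (k : ℕ) {w : ℂ} (hw : |w.im| < w.re) {x : ℝ}
    (hx : 0 ≤ x) : HasDerivAt (fun x : ℝ => w ^ k * iteratedDeriv k boseKernel (x * w))
      (w ^ (k + 1) * iteratedDeriv (k + 1) boseKernel (x * w)) x := by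
  have h1 : HasDerivAt (fun x : ℝ => (x : ℂ) * w) w x := by
    simpa using (hasDerivAt_id x).ofReal_comp.mul_const w
  have h2 := ((hasDerivAt_iteratedDeriv_boseKernel k (mul_mem_sector hw hx)).comp x h1).const_mul
    (w ^ k)
  convert! h2 using 1
  ring

theorem continuousOn_iteratedDeriv_boseKernel_mul (k : ℕ) {w : ℂ} (hw : |w.im| < w.re) :
    ContinuousOn (fun x : ℝ => iteratedDeriv k boseKernel (x * w)) (Ici 0) := fun x hx =>
  ((hasDerivAt_iteratedDeriv_boseKernel k (mul_mem_sector hw hx)).continuousAt.comp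
    (f := fun x : ℝ => (x : ℂ) * w)
    (by fun_prop : Continuous fun x : ℝ => (x : ℂ) * w).continuousAt).continuousWithinAt

theorem integral_boseKernel_mul_of_pos {b : ℝ} (hb : 0 < b) :
    ∫ x in Ioi (0 : ℝ), boseKernel (x * b) = Real.eulerMascheroniConstant / (b : ℂ) := by
  have h := integral_comp_mul_right_Ioi (fun x : ℝ => boseKernel x) 0 hb
  simp only [zero_mul, ofReal_mul] at h
  rw [h, integral_boseKernel, real_smul, ofReal_inv, div_eq_inv_mul]

theorem differentiableOn_integral_boseKernel_mul :
    DifferentiableOn ℂ (fun w : ℂ => ∫ x in Ioi (0 : ℝ), boseKernel (x * w))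
      {w | |w.im| < w.re} := by
  intro w hw
  obtain ⟨C₀, hC₀, h₀⟩ := exists_norm_iteratedDeriv_boseKernel_le 0
  obtain ⟨C₁, hC₁, h₁⟩ := exists_norm_iteratedDeriv_boseKernel_le 1
  have hpos : 0 < w.re := (abs_nonneg _).trans_lt hw
  have hc : 0 < w.re / 4 := by linarith
  have hU : {z : ℂ | |z.im| < z.re} ∩ {z | w.re / 2 < z.re} ∈ 𝓝 w :=
    inter_mem (isOpen_sector.mem_nhds hw) ((isOpen_lt continuous_const continuous_re).mem_nhds
      (show w.re / 2 < w.re by linarith))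
  have hcont : ∀ z : ℂ, |z.im| < z.re → ∀ k, AEStronglyMeasurable
      (fun x : ℝ => iteratedDeriv k boseKernel (x * z)) (volume.restrict (Ioi 0)) := fun z hz k =>
    ((continuousOn_iteratedDeriv_boseKernel_mul k hz).mono
      Ioi_subset_Ici_self).aestronglyMeasurable measurableSet_Ioi
  have hzero : (fun w : ℂ => ∫ x in Ioi (0 : ℝ), boseKernel (x * w))
      = fun w : ℂ => ∫ x in Ioi (0 : ℝ), iteratedDeriv 0 boseKernel (x * w) := by
    simp only [iteratedDeriv_zero]
  rw [hzero]
  refine (hasDerivAt_integral_of_dominated_loc_of_deriv_le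
    (F' := fun z (x : ℝ) => iteratedDeriv 1 boseKernel (x * z) * x)
    (bound := fun x => C₁ * (w.re / 4)⁻¹ * Real.exp (-(w.re / 4) * x)) hU
    ?_ ?_ ?_ ?_ ?_ ?_).2.differentiableAt.differentiableWithinAt
  · filter_upwards [isOpen_sector.mem_nhds hw] with z hz using hcont z hz 0
  · refine ((exp_neg_integrableOn_Ioi 0 hpos).const_mul C₀).mono' (hcont w hw 0) ?_
    refine (ae_restrict_iff' measurableSet_Ioi).2 (Eventually.of_forall fun x hx => ?_)
    refine (h₀ _ (mul_mem_sector hw (le_of_lt hx))).trans (le_of_eq ?_)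
    rw [re_ofReal_mul]; ring_nf
  · exact (hcont w hw 1).mul continuous_ofReal.aestronglyMeasurable
  · refine (ae_restrict_iff' measurableSet_Ioi).2 (Eventually.of_forall fun x hx z hz => ?_)
    have hx0 : 0 ≤ x := le_of_lt hx
    rw [norm_mul, norm_real, Real.norm_of_nonneg hx0]
    have hb := h₁ _ (mul_mem_sector hz.1 hx0)
    have hx1 := abs_le_exp_div hc x
    rw [abs_of_nonneg hx0] at hx1
    have hz2 : w.re / 2 < z.re := hz.2
    calc _ ≤ (C₁ * Real.exp (-(w.re / 2 * x))) * (Real.exp (w.re / 4 * x) / (w.re / 4)) := by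
          refine mul_le_mul (hb.trans ?_) hx1 hx0 (by positivity)
          rw [re_ofReal_mul, mul_comm x]
          gcongr
      _ = C₁ * (w.re / 4)⁻¹ * (Real.exp (-(w.re / 2 * x)) * Real.exp (w.re / 4 * x)) := by ring
      _ = _ := by rw [← Real.exp_add]; congr 2; ring
  · exact (exp_neg_integrableOn_Ioi 0 hc).const_mul _
  · refine (ae_restrict_iff' measurableSet_Ioi).2 (Eventually.of_forall fun x hx z hz => ?_)
    have h1 : HasDerivAt (fun z : ℂ => (x : ℂ) * z) x z := by
      simpa using (hasDerivAt_id z).const_mul (x : ℂ)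
    exact (hasDerivAt_iteratedDeriv_boseKernel 0 (mul_mem_sector hz.1 (le_of_lt hx))).comp z h1

/-- The substitution `x ↦ x / w` remains valid for `w` in the sector, by analytic continuation from
the positive axis. -/
theorem integral_boseKernel_mul {w : ℂ} (hw : |w.im| < w.re) :
    ∫ x in Ioi (0 : ℝ), boseKernel (x * w) = Real.eulerMascheroniConstant / w := by
  refine eqOn_of_eventually_eq_ofReal isOpen_sector convex_sector.isPreconnected
    differentiableOn_integral_boseKernel_mul
    (g := fun w => Real.eulerMascheroniConstant / w) ?_ (x₀ := 1) (by simp) ?_ hw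
  · intro z hz
    have : z ≠ 0 := by rintro rfl; simp at hz
    exact ((differentiableAt_const _).div differentiableAt_id this).differentiableWithinAt
  · filter_upwards [Ioi_mem_nhds one_pos] with x hx using integral_boseKernel_mul_of_pos hx

/-! ### Expansion of the Lambert series at the origin -/

/-- The sum of the kernel over the positive multiples of `w`. -/
noncomputable def boseSum (w : ℂ) : ℂ := ∑' m : ℕ, boseKernel (((m : ℝ) + 1 : ℝ) * w)

theorem norm_le_two_mul_re {w : ℂ} (hw : |w.im| < w.re) : ‖w‖ ≤ 2 * w.re := by
  have h := norm_le_abs_re_add_abs_im w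
  rw [abs_of_pos ((abs_nonneg _).trans_lt hw)] at h
  linarith

/-- Euler–Maclaurin summation of `x ↦ boseKernel (x * w)`, uniformly for `w` in the sector. -/
theorem exists_boseSum_expansion : ∃ c : ℕ → ℂ, ∀ N : ℕ, ∃ C : ℝ, ∀ w : ℂ, |w.im| < w.re →
    ‖boseSum w - Real.eulerMascheroniConstant / w - ∑ k ∈ Finset.range (N + 1), c k * w ^ k‖
      ≤ C * ‖w‖ ^ N := by
  refine ⟨fun k => -(eulerMaclaurinCoeff k * iteratedDeriv k boseKernel 0), fun N => ?_⟩
  obtain ⟨B, hB0, hB⟩ := norm_tsum_sub_eulerMaclaurin_le N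
  obtain ⟨K, hK0, hK⟩ := exists_norm_iteratedDeriv_boseKernel_le (N + 1)
  refine ⟨B * K * 2, fun w hw => ?_⟩
  have hpos : 0 < w.re := (abs_nonneg _).trans_lt hw
  have hbound : ∀ k C, (∀ z : ℂ, |z.im| ≤ z.re →
      ‖iteratedDeriv k boseKernel z‖ ≤ C * Real.exp (-z.re)) → ∀ x : ℝ, 0 ≤ x →
      ‖w ^ k * iteratedDeriv k boseKernel (x * w)‖ ≤ ‖w‖ ^ k * C * Real.exp (-(w.re * x)) :=
    fun k C hC x hx => by
    rw [norm_mul, norm_pow, mul_assoc, mul_comm w.re, ← re_ofReal_mul]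
    gcongr
    exact hC _ (mul_mem_sector hw hx)
  have h := hB (fun k x => w ^ k * iteratedDeriv k boseKernel (x * w)) w.re (‖w‖ ^ (N + 1) * K) hpos
    (fun k x hx => hasDerivAt_iteratedDeriv_boseKernel_mul k hw hx)
    (fun k => by
      obtain ⟨C, _, hC⟩ := exists_norm_iteratedDeriv_boseKernel_le k
      exact ⟨_, hbound k C hC⟩)
    (hbound (N + 1) K hK)
  simp only [pow_zero, one_mul, iteratedDeriv_zero, integral_boseKernel_mul hw, ofReal_zero,
    zero_mul] at h
  have hsum : ∑ k ∈ Finset.range (N + 1), -(eulerMaclaurinCoeff k * iteratedDeriv k boseKernel 0)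
      * w ^ k = -∑ k ∈ Finset.range (N + 1),
        (eulerMaclaurinCoeff k : ℂ) * (w ^ k * iteratedDeriv k boseKernel 0) := by
    rw [← Finset.sum_neg_distrib]; exact Finset.sum_congr rfl fun k _ => by ring
  rw [hsum, sub_neg_eq_add]
  refine h.trans ?_
  rw [div_le_iff₀ hpos, pow_succ]
  have := norm_le_two_mul_re hw
  have h2 : 0 ≤ B * K * ‖w‖ ^ N := by positivity
  nlinarith

/-- Summing the Lambert series over one variable gives `∑ 1/(e^{mw} - 1)`, and the part
`∑ e^{-mw}/(mw)` of it is a logarithm. -/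
theorem divisorExp_eq_boseSum {w : ℂ} (hw : |w.im| < w.re) :
    divisorExp w = boseSum w - Complex.log (1 - cexp (-w)) / w := by
  have hpos : 0 < w.re := (abs_nonneg _).trans_lt hw
  have hw0 : w ≠ 0 := by rintro rfl; simp at hpos
  have h1 : HasSum (fun m : ℕ => cexp (-(((m + 1 : ℕ) : ℂ) * w))
      / (1 - cexp (-(((m + 1 : ℕ) : ℂ) * w)))) (divisorExp w) :=
    (summable_divisorExp hpos).hasSum.prod_fiberwise (hasSum_exp_geometric hpos)
  have hlt : ‖cexp (-w)‖ < 1 := by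
    rw [Complex.norm_exp, Real.exp_lt_one_iff]; simpa using hpos
  have h2 : HasSum (fun m : ℕ => cexp (-(((m + 1 : ℕ) : ℂ) * w)) / (((m + 1 : ℕ) : ℂ) * w))
      (-Complex.log (1 - cexp (-w)) / w) := by
    have h := (hasSum_nat_add_iff' 1).2 (Complex.hasSum_taylorSeries_neg_log hlt)
    simp only [Finset.sum_range_one, Nat.cast_zero, div_zero, sub_zero] at h
    refine (h.div_const w).congr_fun fun m => ?_
    rw [← Complex.exp_nat_mul, mul_neg, div_div]
  have h3 := h1.sub h2
  rw [boseSum, eq_sub_iff_add_eq, ← sub_neg_eq_add, ← neg_div, ← h3.tsum_eq]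
  refine tsum_congr fun m => ?_
  have hm : ((((m : ℝ) + 1 : ℝ) : ℂ)) = ((m + 1 : ℕ) : ℂ) := by push_cast; rfl
  have hmem := mul_mem_sector hw (x := (m : ℝ) + 1) (by positivity)
  have hmem' := mem_wideSector_of_near hmem (w := (((m : ℝ) + 1 : ℝ) : ℂ) * w) (by simp)
  rw [boseKernel_eq (mul_ne_zero (by rw [hm]; exact_mod_cast m.succ_ne_zero) hw0)
    (expQuot_ne_zero_of_mem_wideSector hmem'), hm]

/-! ### Mellin transforms of truncated powers -/

theorem locallyIntegrableOn_indicator {f : ℝ → ℂ} {s A : Set ℝ}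
    (hf : LocallyIntegrableOn f s) (hA : MeasurableSet A) :
    LocallyIntegrableOn (indicator A f) s := fun x hx => by
  obtain ⟨t, ht, hft⟩ := hf x hx
  exact ⟨t, ht, hft.indicator hA⟩

theorem locallyIntegrableOn_cpow (a : ℂ) : LocallyIntegrableOn (fun t : ℝ => (t : ℂ) ^ a) (Ioi 0) := by
  refine ContinuousOn.locallyIntegrableOn (fun t ht => ?_) measurableSet_Ioi
  exact (continuousAt_ofReal_cpow_const t a (Or.inr (ne_of_gt ht))).continuousWithinAt

/-- The power `t^a`, cut off to `(0, 1]`. -/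
noncomputable def powNearZero (a : ℂ) : ℝ → ℂ := indicator (Ioc 0 1) fun t : ℝ => (t : ℂ) ^ a

/-- The power `t^a`, cut off to `(1, ∞)`. -/
noncomputable def powNearTop (a : ℂ) : ℝ → ℂ := indicator (Ioi 1) fun t : ℝ => (t : ℂ) ^ a

theorem locallyIntegrableOn_powNearZero (a : ℂ) : LocallyIntegrableOn (powNearZero a) (Ioi 0) :=
  locallyIntegrableOn_indicator (locallyIntegrableOn_cpow a) measurableSet_Ioc

theorem locallyIntegrableOn_powNearTop (a : ℂ) : LocallyIntegrableOn (powNearTop a) (Ioi 0) :=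
  locallyIntegrableOn_indicator (locallyIntegrableOn_cpow a) measurableSet_Ioi

theorem powNearZero_eventuallyEq_top (a : ℂ) : powNearZero a =ᶠ[atTop] 0 := by
  filter_upwards [eventually_gt_atTop 1] with t ht
  exact indicator_of_notMem (fun h => absurd h.2 (not_le.2 ht)) _

theorem powNearZero_eventuallyEq_zero (a : ℂ) :
    powNearZero a =ᶠ[𝓝[>] 0] fun t : ℝ => (t : ℂ) ^ a := by
  filter_upwards [Ioc_mem_nhdsGT one_pos] with t ht
  exact indicator_of_mem ht _

theorem powNearTop_eventuallyEq_top (a : ℂ) :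
    powNearTop a =ᶠ[atTop] fun t : ℝ => (t : ℂ) ^ a := by
  filter_upwards [eventually_gt_atTop 1] with t ht
  exact indicator_of_mem (s := Ioi (1 : ℝ)) ht _

theorem powNearTop_eventuallyEq_zero (a : ℂ) : powNearTop a =ᶠ[𝓝[>] 0] 0 := by
  filter_upwards [Ioc_mem_nhdsGT one_pos] with t ht
  exact indicator_of_notMem (fun h => absurd ht.2 (not_le.2 h)) _

theorem hasMellin_powNearZero (a : ℂ) {s : ℂ} (hs : 0 < (s + a).re) :
    HasMellin (powNearZero a) s (1 / (s + a)) :=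
  hasMellin_cpow_Ioc a (by simpa using hs)

/-- Obtained from `hasMellin_powNearZero` by differentiation in `s`. -/
theorem hasMellin_log_mul_powNearZero (a : ℂ) {s : ℂ} (hs : 0 < (s + a).re) :
    HasMellin (fun t => (Real.log t : ℂ) * powNearZero a t) s (-(1 / (s + a) ^ 2)) := by
  have hO : powNearZero a =O[𝓝[>] 0] fun t : ℝ => t ^ (-(-a.re)) := by
    refine ((powNearZero_eventuallyEq_zero a).trans_isBigO ?_)
    refine Asymptotics.IsBigO.of_bound 1 ?_
    filter_upwards [self_mem_nhdsWithin] with t ht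
    rw [norm_cpow_eq_rpow_re_of_pos ht, neg_neg, one_mul]
    exact Real.le_norm_self _
  have h := mellin_hasDerivAt_of_isBigO_rpow (locallyIntegrableOn_powNearZero a)
    ((powNearZero_eventuallyEq_top a).trans_isBigO (Asymptotics.isBigO_zero _ _))
    (lt_add_one s.re) hO (by simp at hs; linarith)
  simp only [real_smul] at h
  refine ⟨h.1, h.2.unique ?_⟩
  have hd : HasDerivAt (fun z : ℂ => 1 / (z + a)) (-(1 / (s + a) ^ 2)) s := by
    have hne : s + a ≠ 0 := by intro h0; rw [h0] at hs; simp at hs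
    have := ((hasDerivAt_id s).add_const a).inv hne
    simp only [id] at this
    convert! this using 1
    · ext z; simp
    · ring
  refine hd.congr_of_eventuallyEq ?_
  filter_upwards [(isOpen_lt continuous_const
    (continuous_re.comp (continuous_id.add continuous_const))).mem_nhds
    (show 0 < (s + a).re from hs)] with z hz using (hasMellin_powNearZero a hz).2

theorem hasMellin_powNearTop (a : ℂ) {s : ℂ} (hs : (s + a).re < 0) :
    HasMellin (powNearTop a) s (-(1 / (s + a))) := by
  have heq : ∀ t : ℝ, (t : ℂ) ^ (s - 1) • powNearTop a t
      = indicator (Ioi 1) (fun t : ℝ => (t : ℂ) ^ (s + a - 1)) t := fun t => by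
    by_cases ht : t ∈ Ioi (1 : ℝ)
    · have ht0 : (t : ℂ) ≠ 0 := by exact_mod_cast (one_pos.trans ht).ne'
      rw [powNearTop, indicator_of_mem ht, indicator_of_mem ht, smul_eq_mul, ← cpow_add _ _ ht0]
      ring_nf
    · rw [powNearTop, indicator_of_notMem ht, indicator_of_notMem ht, smul_zero]
  have hre : (s + a - 1).re < -1 := by rw [sub_re, one_re]; linarith
  have hinter : Ioi (0 : ℝ) ∩ Ioi 1 = Ioi 1 :=
    inter_eq_self_of_subset_right (Ioi_subset_Ioi zero_le_one)
  refine ⟨?_, ?_⟩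
  · simp only [MellinConvergent, heq]
    exact (integrable_indicator_iff measurableSet_Ioi).2
      (integrableOn_Ioi_cpow_of_lt hre one_pos) |>.integrableOn
  · simp only [mellin, heq]
    rw [setIntegral_indicator measurableSet_Ioi, hinter, integral_Ioi_cpow_of_lt hre one_pos,
      sub_add_cancel, ofReal_one, one_cpow, neg_div]

theorem hasMellin_log_mul_powNearTop (a : ℂ) {s : ℂ} (hs : (s + a).re < 0) :
    HasMellin (fun t => (Real.log t : ℂ) * powNearTop a t) s (1 / (s + a) ^ 2) := by
  have hO : powNearTop a =O[atTop] fun t : ℝ => t ^ (-(-a.re)) := by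
    refine ((powNearTop_eventuallyEq_top a).trans_isBigO ?_)
    refine Asymptotics.IsBigO.of_bound 1 ?_
    filter_upwards [eventually_gt_atTop 0] with t ht
    rw [norm_cpow_eq_rpow_re_of_pos ht, neg_neg, one_mul]
    exact Real.le_norm_self _
  have h := mellin_hasDerivAt_of_isBigO_rpow (locallyIntegrableOn_powNearTop a)
    hO (s := s) (by simp at hs; linarith)
    ((powNearTop_eventuallyEq_zero a).trans_isBigO (Asymptotics.isBigO_zero _ _))
    (sub_one_lt s.re)
  simp only [real_smul] at h
  refine ⟨h.1, h.2.unique ?_⟩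
  have hd : HasDerivAt (fun z : ℂ => -(1 / (z + a))) (1 / (s + a) ^ 2) s := by
    have hne : s + a ≠ 0 := by intro h0; rw [h0] at hs; simp at hs
    have := (((hasDerivAt_id s).add_const a).inv hne).fun_neg
    simp only [id] at this
    convert! this using 1
    · ext z; simp
    · ring
  refine hd.congr_of_eventuallyEq ?_
  filter_upwards [(isOpen_lt (continuous_re.comp (continuous_id.add continuous_const))
    continuous_const).mem_nhds (show (s + a).re < 0 from hs)] with z hz
      using (hasMellin_powNearTop a hz).2

/-! ### The Mellin transform of the Lambert series in the critical strip -/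

/-- The Lambert series minus its singular part at the origin. -/
noncomputable def divisorExpReg (x : ℝ) : ℂ :=
  divisorExp x - (Real.eulerMascheroniConstant - (Real.log x : ℂ)) * (x : ℂ) ^ (-1 : ℂ)

theorem continuousOn_divisorExp_ofReal : ContinuousOn (fun x : ℝ => divisorExp x) (Ioi 0) :=
  differentiableOn_divisorExp.continuousOn.comp continuous_ofReal.continuousOn
    fun x hx => by simpa using hx

theorem log_one_sub_exp_eq {x : ℝ} (hx : 0 < x) :
    Complex.log (1 - cexp (-(x : ℂ))) = Real.log x + Complex.log (expQuot x) := by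
  rw [← mul_expQuot, Complex.log_ofReal_mul hx
    (expQuot_ne_zero_of_mem_wideSector (mem_wideSector_ofReal hx.le))]

theorem divisorExpReg_isBigO_zero : divisorExpReg =O[𝓝[>] 0] fun x : ℝ => x ^ (-(0 : ℝ)) := by
  simp only [neg_zero, Real.rpow_zero]
  obtain ⟨c, hc⟩ := exists_boseSum_expansion
  obtain ⟨C, hC⟩ := hc 0
  have h1 : (fun x : ℝ => boseSum x - Real.eulerMascheroniConstant / (x : ℂ))
      =O[𝓝[>] 0] fun _ : ℝ => (1 : ℝ) := by
    refine Asymptotics.IsBigO.of_bound (C + ‖c 0‖) ?_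
    filter_upwards [self_mem_nhdsWithin] with x hx
    have h := hC x (by simpa using hx)
    simp only [zero_add, Finset.sum_range_one, pow_zero, mul_one] at h
    rw [norm_one, mul_one]
    have := norm_add_le (boseSum x - Real.eulerMascheroniConstant / (x : ℂ) - c 0) (c 0)
    rw [sub_add_cancel] at this
    linarith
  have h2 : (fun x : ℝ => Complex.log (expQuot x) / (x : ℂ)) =O[𝓝[>] 0] fun _ : ℝ => (1 : ℝ) := by
    have hd : DifferentiableAt ℂ (fun z => Complex.log (expQuot z)) 0 :=
      (differentiable_expQuot 0).clog (by rw [expQuot_zero]; simp [slitPlane])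
    have hO := hd.isBigO_sub
    simp only [expQuot_zero, Complex.log_one, sub_zero] at hO
    have ht : Tendsto (fun x : ℝ => (x : ℂ)) (𝓝[>] 0) (𝓝 0) :=
      (continuous_ofReal.tendsto' 0 0 (by simp)).mono_left nhdsWithin_le_nhds
    have hO2 := (hO.comp_tendsto ht).mul (Asymptotics.isBigO_refl (fun x : ℝ => (x : ℂ)⁻¹) (𝓝[>] 0))
    refine hO2.trans (Asymptotics.IsBigO.of_bound 1 ?_)
    filter_upwards [self_mem_nhdsWithin] with x hx
    have : (x : ℂ) ≠ 0 := by exact_mod_cast (ne_of_gt hx)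
    simp [mul_inv_cancel₀ this]
  refine (h1.sub h2).congr' ?_ EventuallyEq.rfl
  filter_upwards [self_mem_nhdsWithin] with x hx
  rw [divisorExpReg, divisorExp_eq_boseSum (by simpa using hx), log_one_sub_exp_eq hx, cpow_neg_one]
  ring

/-- `divisorExp` minus its singular part at the origin, the latter cut off to `(0, 1]`. Its Mellin
transform converges in all of `Re s > 0`, which links the range `Re s > 1`, where that of `divisorExp`
converges, to the critical strip, where that of `divisorExpReg` does. -/
noncomputable def divisorExpCut (x : ℝ) : ℂ :=
  divisorExp x - (Real.eulerMascheroniConstant * powNearZero (-1) x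
    - (Real.log x : ℂ) * powNearZero (-1) x)

theorem divisorExpCut_eventuallyEq_zero : divisorExpCut =ᶠ[𝓝[>] 0] divisorExpReg := by
  filter_upwards [powNearZero_eventuallyEq_zero (-1)] with x hx
  rw [divisorExpCut, divisorExpReg, hx]; ring

theorem divisorExpCut_eventuallyEq_top :
    divisorExpCut =ᶠ[atTop] fun x : ℝ => divisorExp x := by
  filter_upwards [powNearZero_eventuallyEq_top (-1)] with x hx
  rw [divisorExpCut, hx]; simp

theorem continuousOn_log_ofReal : ContinuousOn (fun x : ℝ => (Real.log x : ℂ)) (Ioi 0) :=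
  continuous_ofReal.comp_continuousOn
    (Real.continuousOn_log.mono fun _ hx => ne_of_gt hx)

theorem locallyIntegrableOn_log_mul_powNearZero (a : ℂ) :
    LocallyIntegrableOn (fun x : ℝ => (Real.log x : ℂ) * powNearZero a x) (Ioi 0) := by
  have h : LocallyIntegrableOn (fun x : ℝ => (Real.log x : ℂ) * (x : ℂ) ^ a) (Ioi 0) :=
    ContinuousOn.locallyIntegrableOn (continuousOn_log_ofReal.mul fun t ht =>
      (continuousAt_ofReal_cpow_const t a (Or.inr (ne_of_gt ht))).continuousWithinAt)
      measurableSet_Ioi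
  convert locallyIntegrableOn_indicator h (measurableSet_Ioc (a := (0 : ℝ)) (b := 1)) using 1
  ext x
  rw [powNearZero, indicator_mul_right]

theorem locallyIntegrableOn_divisorExpCut : LocallyIntegrableOn divisorExpCut (Ioi 0) :=
  (continuousOn_divisorExp_ofReal.locallyIntegrableOn measurableSet_Ioi).sub
    (((locallyIntegrableOn_powNearZero (-1)).smul (Real.eulerMascheroniConstant : ℂ)).sub
      (locallyIntegrableOn_log_mul_powNearZero (-1)))

theorem divisorExpCut_isBigO_top :
    divisorExpCut =O[atTop] fun x : ℝ => Real.exp (-(1 / 2) * x) :=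
  divisorExpCut_eventuallyEq_top.trans_isBigO divisorExp_isBigO_top

theorem divisorExpCut_isBigO_zero : divisorExpCut =O[𝓝[>] 0] fun x : ℝ => x ^ (-(0 : ℝ)) :=
  divisorExpCut_eventuallyEq_zero.trans_isBigO divisorExpReg_isBigO_zero

theorem mellinConvergent_divisorExpCut {s : ℂ} (hs : 0 < s.re) :
    MellinConvergent divisorExpCut s :=
  mellinConvergent_of_isBigO_rpow_exp (by norm_num) locallyIntegrableOn_divisorExpCut
    divisorExpCut_isBigO_top divisorExpCut_isBigO_zero hs

theorem differentiableAt_mellin_divisorExpCut {s : ℂ} (hs : 0 < s.re) :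
    DifferentiableAt ℂ (mellin divisorExpCut) s :=
  mellin_differentiableAt_of_isBigO_rpow_exp (by norm_num) locallyIntegrableOn_divisorExpCut
    divisorExpCut_isBigO_top divisorExpCut_isBigO_zero hs

theorem mellin_divisorExpCut_of_one_lt {s : ℂ} (hs : 1 < s.re) :
    mellin divisorExpCut s = Gamma s * riemannZeta s ^ 2
      - Real.eulerMascheroniConstant / (s - 1) - 1 / (s - 1) ^ 2 := by
  have hs' : 0 < (s + -1).re := by simp; linarith
  have h1 := hasMellin_const_smul (hasMellin_powNearZero (-1) hs').1
    (Real.eulerMascheroniConstant : ℂ)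
  have h2 := hasMellin_log_mul_powNearZero (-1) hs'
  have h3 := hasMellin_sub h1.1 h2.1
  have h4 := hasMellin_add (mellinConvergent_divisorExpCut (by linarith)) h3.1
  have heq : (fun x : ℝ => divisorExpCut x + ((Real.eulerMascheroniConstant : ℂ)
      • powNearZero (-1) x - (Real.log x : ℂ) * powNearZero (-1) x))
      = fun x : ℝ => divisorExp x := by
    ext x; simp only [divisorExpCut, smul_eq_mul, sub_add_cancel]
  have h5 := h4.2
  rw [heq, mellin_divisorExp hs, h3.2, h1.2, h2.2, (hasMellin_powNearZero (-1) hs').2,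
    smul_eq_mul, ← sub_eq_add_neg s 1] at h5
  rw [h5]; ring

/-- The continuation to `Re s > 0`, multiplied by `(s - 1)^2` to keep clear of the pole. -/
theorem mellin_divisorExpCut {s : ℂ} (hs : 0 < s.re) :
    (s - 1) ^ 2 * mellin divisorExpCut s = Gamma s * riemannZeta₁ s ^ 2
      - Real.eulerMascheroniConstant * (s - 1) - 1 := by
  refine eqOn_of_eventually_eq_ofReal (f := fun s => (s - 1) ^ 2 * mellin divisorExpCut s)
    (g := fun s => Gamma s * riemannZeta₁ s ^ 2 - Real.eulerMascheroniConstant * (s - 1) - 1)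
    isOpen_re_pos isPreconnected_re_pos ?_ ?_ (x₀ := 2) (by simp) ?_ hs
  · intro z hz
    exact (DifferentiableAt.mul (by fun_prop)
      (differentiableAt_mellin_divisorExpCut hz)).differentiableWithinAt
  · intro z hz
    have hz' : 0 < z.re := hz
    have hG : DifferentiableAt ℂ Gamma z := Complex.differentiableAt_Gamma _ fun m h => by
      have := congrArg re h
      simp at this
      linarith [m.cast_nonneg (α := ℝ)]
    have h1 : DifferentiableAt ℂ (fun s => riemannZeta₁ s ^ 2) z :=
      (differentiable_riemannZeta₁ z).pow 2
    exact (((hG.mul h1).sub (by fun_prop)).sub_const 1).differentiableWithinAt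
  · filter_upwards [Ioi_mem_nhds (show (1 : ℝ) < 2 by norm_num)] with x hx
    have hx1 : (x : ℂ) - 1 ≠ 0 := by
      have : x - 1 ≠ 0 := sub_ne_zero.2 (mem_Ioi.1 hx).ne'
      exact_mod_cast this
    rw [mellin_divisorExpCut_of_one_lt (by simpa using hx),
      riemannZeta_eq_inv_sub_mul (sub_ne_zero.1 hx1)]
    field_simp

/-- In the critical strip the regularised Lambert series has Mellin transform `Γ(s) ζ(s)²`. -/
theorem hasMellin_divisorExpReg {s : ℂ} (hs0 : 0 < s.re) (hs1 : s.re < 1) :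
    HasMellin divisorExpReg s (Gamma s * riemannZeta s ^ 2) := by
  have hs' : (s + -1).re < 0 := by simp; linarith
  have h1 := hasMellin_const_smul (hasMellin_powNearTop (-1) hs').1
    (Real.eulerMascheroniConstant : ℂ)
  have h2 := hasMellin_log_mul_powNearTop (-1) hs'
  have h3 := hasMellin_sub h1.1 h2.1
  have h4 := hasMellin_sub (mellinConvergent_divisorExpCut hs0) h3.1
  have hne : s ≠ 1 := by rintro rfl; simp at hs1
  have hne' : s - 1 ≠ 0 := sub_ne_zero.2 hne
  have heq : EqOn (fun x : ℝ => divisorExpCut x - ((Real.eulerMascheroniConstant : ℂ)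
      • powNearTop (-1) x - (Real.log x : ℂ) * powNearTop (-1) x)) divisorExpReg (Ioi 0) := by
    intro x hx
    simp only [divisorExpCut, divisorExpReg, smul_eq_mul]
    rcases le_or_gt x 1 with h | h
    · have hm : x ∈ Ioc (0 : ℝ) 1 := ⟨hx, h⟩
      have hn : x ∉ Ioi (1 : ℝ) := not_lt.2 h
      rw [powNearZero, powNearTop, indicator_of_mem hm, indicator_of_notMem hn]
      ring
    · have hm : x ∈ Ioi (1 : ℝ) := h
      have hn : x ∉ Ioc (0 : ℝ) 1 := fun h' => absurd h'.2 (not_le.2 h)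
      rw [powNearZero, powNearTop, indicator_of_notMem hn, indicator_of_mem hm]
      ring
  have heq' : EqOn (fun x : ℝ => (x : ℂ) ^ (s - 1) • (divisorExpCut x
      - ((Real.eulerMascheroniConstant : ℂ)
      • powNearTop (-1) x - (Real.log x : ℂ) * powNearTop (-1) x)))
      (fun x : ℝ => (x : ℂ) ^ (s - 1) • divisorExpReg x) (Ioi 0) := fun x hx => by
    simp only [heq hx]
  refine ⟨h4.1.congr_fun heq' measurableSet_Ioi, ?_⟩
  have h5 : mellin divisorExpReg s = _ := (setIntegral_congr_fun measurableSet_Ioi heq').symm.trans h4.2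
  have h6 := mellin_divisorExpCut hs0
  rw [h5, h3.2, h1.2, h2.2, (hasMellin_powNearTop (-1) hs').2, riemannZeta_eq_inv_sub_mul hne,
    smul_eq_mul, ← sub_eq_add_neg]
  have h7 : mellin divisorExpCut s = (Gamma s * riemannZeta₁ s ^ 2
      - Real.eulerMascheroniConstant * (s - 1) - 1) / (s - 1) ^ 2 := by
    rw [← h6]; field_simp
  rw [h7]
  field_simp
  ring

theorem continuousOn_divisorExpReg : ContinuousOn divisorExpReg (Ioi 0) :=
  continuousOn_divisorExp_ofReal.sub ((continuousOn_const.sub continuousOn_log_ofReal).mul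
    fun t ht => (continuousAt_ofReal_cpow_const t (-1) (Or.inr (ne_of_gt ht))).continuousWithinAt)

/-! ### The Laplace transform of the weighted mean square -/

theorem norm_two_pi_cpow (t : ℝ) :
    ‖(2 * Real.pi : ℂ) ^ (1 / 2 + I * t : ℂ)‖ = (2 * Real.pi) ^ (1 / 2 : ℝ) := by
  rw [show (2 * Real.pi : ℂ) = ((2 * Real.pi : ℝ) : ℂ) by push_cast; ring,
    norm_cpow_eq_rpow_re_of_pos Real.two_pi_pos]
  congr 1
  simp

theorem mellin_divisorExpReg_critical (t : ℝ) :
    mellin divisorExpReg (((1 / 2 : ℝ) : ℂ) + t * I)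
      = (2 * Real.pi : ℂ) ^ (1 / 2 + I * t : ℂ) * cexp (I * Real.pi / 4)
        * (cexp (-(Real.pi / 2 * t)) * zetaWeight t) := by
  have hs : (((1 / 2 : ℝ) : ℂ) + t * I) = 1 / 2 + I * t := by push_cast; ring
  rw [hs, ← Gamma_mul_riemannZeta_sq]
  exact (hasMellin_divisorExpReg (by simp) (by simp; norm_num)).2

theorem verticalIntegrable_mellin_divisorExpReg :
    VerticalIntegrable (mellin divisorExpReg) (1 / 2) := by
  have h := integrable_exp_mul_zetaWeight (a := 0) (by positivity)
  simp only [zero_mul, Real.exp_zero, mul_one] at h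
  have h2 := (integrable_norm_iff continuous_exp_mul_zetaWeight.aestronglyMeasurable).1 h
  have hbase : (2 * Real.pi : ℂ) ≠ 0 := by exact_mod_cast Real.two_pi_pos.ne'
  unfold VerticalIntegrable
  simp only [mellin_divisorExpReg_critical]
  refine h2.bdd_mul (c := (2 * Real.pi) ^ (1 / 2 : ℝ) * ‖cexp (I * Real.pi / 4)‖) ?_ ?_
  · refine Continuous.aestronglyMeasurable (Continuous.mul ?_ continuous_const)
    exact Continuous.const_cpow (by fun_prop) (Or.inl hbase)
  · refine Eventually.of_forall fun t => ?_
    rw [norm_mul, norm_two_pi_cpow]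

/-- The Fourier integral of the weighted mean square, as a function of a complex frequency. It
converges for `|im z| < π/2`. -/
noncomputable def weightFourier (z : ℂ) : ℂ :=
  ∫ t : ℝ, cexp (-(Real.pi / 2 * t)) * zetaWeight t * cexp (-(I * z) * t)

/-- The Lambert series minus its singular part in the variable `z`, where `w = 2π e^z`. -/
noncomputable def divisorExpRegExp (z : ℂ) : ℂ :=
  divisorExp (2 * Real.pi * cexp z) - (Real.eulerMascheroniConstant - Real.log (2 * Real.pi) - z)
    / (2 * Real.pi * cexp z)

/-- Mellin inversion on the critical line, at the point `2π e^r`. -/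
theorem weightFourier_ofReal (r : ℝ) :
    weightFourier r = 2 * Real.pi * cexp (-(I * Real.pi / 4)) * cexp (r / 2)
      * divisorExpRegExp r := by
  have hx : 0 < 2 * Real.pi * Real.exp r := by positivity
  have hinv := mellinInv_mellin_eq (1 / 2) divisorExpReg hx
    (by
      have := (hasMellin_divisorExpReg (s := ((1 / 2 : ℝ) : ℂ)) (by simp) (by
        rw [ofReal_re]; norm_num)).1
      exact this)
    verticalIntegrable_mellin_divisorExpReg
    (continuousOn_divisorExpReg.continuousAt (Ioi_mem_nhds hx))
  have hreg : divisorExpReg (2 * Real.pi * Real.exp r) = divisorExpRegExp r := by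
    rw [divisorExpReg, divisorExpRegExp, Real.log_mul Real.two_pi_pos.ne' (Real.exp_pos r).ne',
      Real.log_exp, cpow_neg_one]
    push_cast
    rw [div_eq_mul_inv]; ring
  rw [hreg, mellinInv] at hinv
  rw [← hinv, weightFourier]
  simp only [mellin_divisorExpReg_critical]
  have hbase : (2 * Real.pi : ℂ) ≠ 0 := by exact_mod_cast Real.two_pi_pos.ne'
  have hpt : ∀ t : ℝ, (((2 * Real.pi * Real.exp r : ℝ) : ℂ)) ^ (-(((1 / 2 : ℝ) : ℂ) + t * I)) •
      ((2 * Real.pi : ℂ) ^ (1 / 2 + I * t : ℂ) * cexp (I * Real.pi / 4)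
        * (cexp (-(Real.pi / 2 * t)) * zetaWeight t))
      = cexp (I * Real.pi / 4) * cexp (-(r / 2)) *
        (cexp (-(Real.pi / 2 * t)) * zetaWeight t * cexp (-(I * r) * t)) := by
    intro t
    have hs : (((1 / 2 : ℝ) : ℂ) + t * I) = 1 / 2 + I * t := by push_cast; ring
    rw [hs, ofReal_mul, mul_cpow_ofReal_nonneg Real.two_pi_pos.le (Real.exp_pos r).le,
      ofReal_mul, ofReal_ofNat, smul_eq_mul]
    have h1 : (2 * Real.pi : ℂ) ^ (-(1 / 2 + I * t) : ℂ) * (2 * Real.pi : ℂ) ^ (1 / 2 + I * t : ℂ)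
        = 1 := by
      rw [← cpow_add _ _ hbase, neg_add_cancel, cpow_zero]
    have h2 : ((Real.exp r : ℝ) : ℂ) ^ (-(1 / 2 + I * t) : ℂ)
        = cexp (-(r / 2)) * cexp (-(I * r) * t) := by
      rw [cpow_def_of_ne_zero (by exact_mod_cast (Real.exp_pos r).ne'), ← ofReal_log
        (Real.exp_pos r).le, Real.log_exp, ← Complex.exp_add]
      congr 1; ring
    rw [h2]
    linear_combination (cexp (-(r / 2)) * cexp (-(I * r) * t) * cexp (I * Real.pi / 4)
        * (cexp (-(Real.pi / 2 * t)) * zetaWeight t)) * h1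
  simp only [hpt]
  rw [integral_const_mul, real_smul]
  have h3 : cexp (-(I * Real.pi / 4)) * cexp (I * Real.pi / 4) = 1 := by
    rw [← Complex.exp_add, neg_add_cancel, Complex.exp_zero]
  have h4 : cexp (r / 2) * cexp (-(r / 2)) = 1 := by
    rw [← Complex.exp_add, add_neg_cancel, Complex.exp_zero]
  set J := ∫ t : ℝ, cexp (-(Real.pi / 2 * t)) * zetaWeight t * cexp (-(I * r) * t)
  have h5 : (2 * Real.pi : ℂ) * ((1 / (2 * Real.pi) : ℝ) : ℂ) = 1 := by
    push_cast; field_simp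
  have h6 : ∀ a b c d e f : ℂ, a * b * c * (d * (e * f * J)) = (a * d) * (b * e) * (c * f) * J :=
    fun _ _ _ _ _ _ => by ring
  rw [h6, h5, h3, h4]; ring

theorem isOpen_strip : IsOpen {z : ℂ | |z.im| < Real.pi / 2} :=
  isOpen_lt (continuous_abs.comp continuous_im) continuous_const

theorem convex_strip : Convex ℝ {z : ℂ | |z.im| < Real.pi / 2} := by
  have h : {z : ℂ | |z.im| < Real.pi / 2} = Complex.imLm ⁻¹' Ioo (-(Real.pi / 2)) (Real.pi / 2) := by
    ext z; simp [abs_lt]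
  rw [h]
  exact (convex_Ioo _ _).linear_preimage _

theorem re_two_pi_exp_pos {z : ℂ} (hz : |z.im| < Real.pi / 2) : 0 < (2 * Real.pi * cexp z).re := by
  rw [show (2 * Real.pi : ℂ) = ((2 * Real.pi : ℝ) : ℂ) by push_cast; ring, re_ofReal_mul, exp_re]
  have := Real.cos_pos_of_mem_Ioo (x := z.im) ⟨by linarith [(abs_lt.1 hz).1], (abs_lt.1 hz).2⟩
  positivity

/-- Continuation of the inversion formula to the strip, which `z ↦ 2π e^z` maps onto the right
half-plane. -/
theorem weightFourier_eq {z : ℂ} (hz : |z.im| < Real.pi / 2) :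
    weightFourier z = 2 * Real.pi * cexp (-(I * Real.pi / 4)) * cexp (z / 2)
      * divisorExpRegExp z := by
  refine eqOn_of_eventually_eq_ofReal (f := weightFourier)
    (g := fun z => 2 * Real.pi * cexp (-(I * Real.pi / 4)) * cexp (z / 2) * divisorExpRegExp z)
    isOpen_strip convex_strip.isPreconnected ?_ ?_ (x₀ := 0) (by simpa using Real.pi_pos)
    (Eventually.of_forall weightFourier_ofReal) hz
  · intro z hz
    have h := differentiableAt_integral_mul_cexp
      continuous_exp_mul_zetaWeight.aestronglyMeasurable
      (fun a ha => integrable_exp_mul_zetaWeight ha) (z := -(I * z)) (by simpa using hz)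
    exact (h.comp z (by fun_prop : DifferentiableAt ℂ (fun z => -(I * z)) z)).differentiableWithinAt
  · intro z hz
    have hre := re_two_pi_exp_pos hz
    have hD : DifferentiableAt ℂ (fun z => divisorExp (2 * Real.pi * cexp z)) z :=
      DifferentiableAt.comp (g := divisorExp) (f := fun z => 2 * Real.pi * cexp z) z
        (differentiableOn_divisorExp.differentiableAt (isOpen_re_pos.mem_nhds hre)) (by fun_prop)
    have hne : 2 * Real.pi * cexp z ≠ 0 := by intro h; rw [h] at hre; simp at hre
    have hS : DifferentiableAt ℂ divisorExpRegExp z :=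
      hD.sub (DifferentiableAt.div (by fun_prop) (by fun_prop) hne)
    exact (DifferentiableAt.mul (by fun_prop) hS).differentiableWithinAt

/-- The argument of the Lambert series after removal of a period: `2πi (e^{-iδ} - 1)`. -/
noncomputable def lambertArg (δ : ℂ) : ℂ := 2 * Real.pi * I * (cexp (-(I * δ)) - 1)

theorem lambertArg_re (δ : ℝ) : (lambertArg δ).re = 2 * Real.pi * Real.sin δ := by
  have h : lambertArg δ = ((2 * Real.pi : ℝ) : ℂ) * (I * (cexp ((-δ : ℝ) * I) - 1)) := by
    rw [lambertArg]; push_cast; ring_nf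
  rw [h, re_ofReal_mul, I_mul_re, sub_im, exp_ofReal_mul_I_im, one_im, Real.sin_neg]
  ring

theorem lambertArg_im (δ : ℝ) : (lambertArg δ).im = 2 * Real.pi * (Real.cos δ - 1) := by
  have h : lambertArg δ = ((2 * Real.pi : ℝ) : ℂ) * (I * (cexp ((-δ : ℝ) * I) - 1)) := by
    rw [lambertArg]; push_cast; ring_nf
  rw [h, im_ofReal_mul, I_mul_im, sub_re, exp_ofReal_mul_I_re, one_re, Real.cos_neg]

/-- **Atkinson's formula**: the weighted Laplace transform of `|ζ(1/2 + it)|²` is a Lambert series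
evaluated near the origin, up to an elementary function. -/
theorem integral_zetaWeight_mul_exp {δ : ℝ} (h0 : 0 < δ) (hπ : δ < Real.pi) :
    ∫ t : ℝ, zetaWeight t * cexp (-(δ * t))
      = 2 * Real.pi * cexp (-(I * δ / 2)) * divisorExp (lambertArg δ)
        - 2 * Real.pi * cexp (-(I * δ / 2)) * ((Real.eulerMascheroniConstant
          - Real.log (2 * Real.pi) - I * (Real.pi / 2 - δ)) / (2 * Real.pi * I * cexp (-(I * δ)))) := by
  -- for small `δ` this point is near the upper edge of the strip, and `2π e^z` is near `2πi`
  have h := weightFourier_eq (z := I * (Real.pi / 2 - δ)) (by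
    rw [I_mul_im, abs_lt]
    simp only [sub_re, ofReal_re]
    have : ((Real.pi : ℂ) / 2).re = Real.pi / 2 := by
      rw [show (Real.pi : ℂ) / 2 = ((Real.pi / 2 : ℝ) : ℂ) by push_cast; ring, ofReal_re]
    rw [this]
    constructor <;> linarith)
  have hexp : cexp (I * (Real.pi / 2 - δ)) = I * cexp (-(I * δ)) := by
    rw [mul_sub, sub_eq_add_neg, Complex.exp_add, mul_comm I, exp_pi_div_two_mul_I]
  have hL : weightFourier (I * (Real.pi / 2 - δ)) = ∫ t : ℝ, zetaWeight t * cexp (-(δ * t)) := by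
    refine integral_congr_ae (Eventually.of_forall fun t => ?_)
    simp only
    rw [mul_comm (cexp _) (zetaWeight t), mul_assoc, ← Complex.exp_add]
    congr 2
    linear_combination (-(Real.pi / 2 - δ) * t : ℂ) * I_mul_I
  have hhalf : cexp (-(I * Real.pi / 4)) * cexp (I * (Real.pi / 2 - δ) / 2)
      = cexp (-(I * δ / 2)) := by
    rw [← Complex.exp_add]; congr 1; ring
  have hper : 2 * Real.pi * (I * cexp (-(I * δ))) = lambertArg δ + 2 * Real.pi * I := by
    rw [lambertArg]; ring
  rw [← hL, h, divisorExpRegExp, hexp, mul_assoc (2 * Real.pi : ℂ), hhalf, mul_sub, hper,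
    divisorExp_add_two_pi_I, ← hper, ← mul_assoc (2 * Real.pi : ℂ) I]

/-! ### Asymptotic power expansions at the origin -/

/-- A function on the positive axis has an asymptotic power expansion at `0⁺` if, to every order, it
agrees with some function holomorphic at `0`. -/
def HasPowerExpansion (f : ℝ → ℂ) : Prop :=
  ∀ N : ℕ, ∃ p : ℂ → ℂ, AnalyticAt ℂ p 0 ∧
    (fun δ : ℝ => f δ - p δ) =O[𝓝[>] 0] fun δ : ℝ => δ ^ N

theorem tendsto_ofReal_nhdsGT_zero : Tendsto (fun δ : ℝ => (δ : ℂ)) (𝓝[>] 0) (𝓝 0) :=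
  (continuous_ofReal.tendsto' 0 0 (by simp)).mono_left nhdsWithin_le_nhds

theorem AnalyticAt.hasPowerExpansion {f : ℂ → ℂ} (hf : AnalyticAt ℂ f 0) :
    HasPowerExpansion fun δ => f δ := fun N => ⟨f, hf, by simpa using isBigO_zero _ _⟩

theorem AnalyticAt.isBigO_one_ofReal {f : ℂ → ℂ} (hf : AnalyticAt ℂ f 0) :
    (fun δ : ℝ => f δ) =O[𝓝[>] 0] fun _ : ℝ => (1 : ℝ) :=
  (hf.continuousAt.tendsto.comp tendsto_ofReal_nhdsGT_zero).isBigO_one ℝ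

theorem HasPowerExpansion.add {f g : ℝ → ℂ} (hf : HasPowerExpansion f) (hg : HasPowerExpansion g) :
    HasPowerExpansion fun δ => f δ + g δ := fun N => by
  obtain ⟨p, hp, hp'⟩ := hf N
  obtain ⟨q, hq, hq'⟩ := hg N
  refine ⟨fun z => p z + q z, hp.add hq, (hp'.add hq').congr_left fun δ => by ring⟩

theorem HasPowerExpansion.analytic_mul {f : ℝ → ℂ} {g : ℂ → ℂ} (hg : AnalyticAt ℂ g 0)
    (hf : HasPowerExpansion f) : HasPowerExpansion fun δ => g δ * f δ := fun N => by
  obtain ⟨p, hp, hp'⟩ := hf N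
  refine ⟨fun z => g z * p z, hg.mul hp, ?_⟩
  have := hg.isBigO_one_ofReal.mul hp'
  simp only [one_mul] at this
  exact this.congr_left fun δ => by ring

theorem HasPowerExpansion.isBigO_one {f : ℝ → ℂ} (hf : HasPowerExpansion f) :
    f =O[𝓝[>] 0] fun _ : ℝ => (1 : ℝ) := by
  obtain ⟨p, hp, hp'⟩ := hf 0
  simp only [pow_zero] at hp'
  exact (hp'.add hp.isBigO_one_ofReal).congr_left fun δ => by ring

/-- A function holomorphic at `0` that is `O(δ^N)` along the positive axis vanishes to order `N`. -/
theorem iteratedDeriv_eq_zero_of_isBigO {d : ℂ → ℂ} (hd : AnalyticAt ℂ d 0) {N : ℕ}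
    (hO : (fun δ : ℝ => d δ) =O[𝓝[>] 0] fun δ : ℝ => δ ^ N) {k : ℕ} (hk : k < N) :
    iteratedDeriv k d 0 = 0 := by
  refine (natCast_le_analyticOrderAt_iff_iteratedDeriv_eq_zero hd (n := N)).1 ?_ k hk
  by_contra hlt
  rw [not_le] at hlt
  have htop : analyticOrderAt d 0 ≠ ⊤ := hlt.ne_top
  obtain ⟨g, hg, hg0, hdg⟩ := hd.analyticOrderAt_ne_top.1 htop
  set n := analyticOrderNatAt d 0
  have hn : n < N := by
    rw [← Nat.cast_analyticOrderNatAt htop] at hlt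
    exact_mod_cast hlt
  have h1 : (fun δ : ℝ => g δ) =O[𝓝[>] 0] fun δ : ℝ => δ ^ (N - n) := by
    have h2 := hO.mul (isBigO_refl (fun δ : ℝ => ((δ : ℂ) ^ n)⁻¹) (𝓝[>] 0)).norm_right
    refine h2.congr' ?_ ?_
    · filter_upwards [tendsto_ofReal_nhdsGT_zero.eventually hdg, self_mem_nhdsWithin] with δ h hδ
      have h0 : (δ : ℂ) ≠ 0 := by exact_mod_cast (ne_of_gt hδ)
      rw [h, sub_zero, smul_eq_mul]
      field_simp
    · filter_upwards [self_mem_nhdsWithin] with δ hδ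
      have h0 : 0 < δ := hδ
      rw [norm_inv, norm_pow, norm_real, Real.norm_of_nonneg h0.le, ← Nat.sub_add_cancel hn.le,
        pow_add, Nat.add_sub_cancel]
      field_simp
  have h3 : Tendsto (fun δ : ℝ => δ ^ (N - n)) (𝓝[>] 0) (𝓝 0) := by
    have : Tendsto (fun δ : ℝ => δ ^ (N - n)) (𝓝 0) (𝓝 0) :=
      (continuous_pow _).tendsto' 0 0 (zero_pow (by omega))
    exact this.mono_left nhdsWithin_le_nhds
  exact hg0 (tendsto_nhds_unique (hg.continuousAt.tendsto.comp tendsto_ofReal_nhdsGT_zero)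
    (h1.trans_tendsto h3))

theorem taylor_isBigO {f : ℂ → ℂ} (hf : AnalyticAt ℂ f 0) (N : ℕ) :
    (fun δ : ℝ => f δ - ∑ k ∈ Finset.range N, (iteratedDeriv k f 0 / k.factorial) * (δ : ℂ) ^ k)
      =O[𝓝[>] 0] fun δ : ℝ => δ ^ N := by
  obtain ⟨F, hF, h⟩ := hf.exists_eventuallyEq_sum_add_pow_mul N
  have h1 := (isBigO_refl (fun δ : ℝ => δ ^ N) (𝓝[>] 0)).mul hF.isBigO_one_ofReal.norm_left
  simp only [mul_one] at h1
  refine (IsBigO.trans (isBigO_of_le _ fun δ => ?_) h1).congr' (EventuallyEq.symm ?_) EventuallyEq.rfl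
    (f₁ := fun δ : ℝ => (δ : ℂ) ^ N * F δ)
  · rw [norm_mul, norm_mul, norm_norm, norm_pow, norm_pow, norm_real]
  · filter_upwards [tendsto_ofReal_nhdsGT_zero.eventually h] with δ hδ
    rw [hδ, smul_eq_mul, add_sub_right_comm, ← Finset.sum_sub_distrib, add_eq_right]
    exact Finset.sum_eq_zero fun k _ => by rw [smul_eq_mul]; ring

/-- The coefficients of an asymptotic power expansion do not depend on the order. -/
theorem HasPowerExpansion.exists_coeff {f : ℝ → ℂ} (hf : HasPowerExpansion f) :
    ∃ c : ℕ → ℂ, ∀ N : ℕ, (fun δ : ℝ => f δ - ∑ k ∈ Finset.range N, c k * (δ : ℂ) ^ k)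
      =O[𝓝[>] 0] fun δ : ℝ => δ ^ N := by
  choose p hp hp' using hf
  refine ⟨fun k => iteratedDeriv k (p (k + 1)) 0 / k.factorial, fun N => ?_⟩
  have hcoef : ∀ k ∈ Finset.range N, iteratedDeriv k (p (k + 1)) 0 = iteratedDeriv k (p N) 0 := by
    intro k hk
    have hkN : k + 1 ≤ N := Finset.mem_range.1 hk
    have hpow : (fun δ : ℝ => δ ^ N) =O[𝓝[>] 0] fun δ : ℝ => δ ^ (k + 1) :=
      (IsBigO.of_bound 1 (by
        filter_upwards [Ioc_mem_nhdsGT one_pos] with δ hδ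
        rw [norm_pow, norm_pow, Real.norm_of_nonneg hδ.1.le, one_mul]
        exact pow_le_pow_of_le_one hδ.1.le hδ.2 hkN))
    have h1 : (fun δ : ℝ => (p N - p (k + 1)) δ) =O[𝓝[>] 0] fun δ : ℝ => δ ^ (k + 1) :=
      ((hp' (k + 1)).sub ((hp' N).trans hpow)).congr_left fun δ => by simp
    have h2 := iteratedDeriv_eq_zero_of_isBigO ((hp N).sub (hp (k + 1))) h1 (Nat.lt_succ_self k)
    rw [iteratedDeriv_sub (hp N).contDiffAt (hp (k + 1)).contDiffAt, sub_eq_zero] at h2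
    exact h2.symm
  have hsum : ∀ δ : ℝ, ∑ k ∈ Finset.range N, iteratedDeriv k (p (k + 1)) 0 / k.factorial * (δ : ℂ) ^ k
      = ∑ k ∈ Finset.range N, iteratedDeriv k (p N) 0 / k.factorial * (δ : ℂ) ^ k := fun δ =>
    Finset.sum_congr rfl fun k hk => by rw [hcoef k hk]
  simp only [hsum]
  exact ((hp' N).add (taylor_isBigO (hp N) N)).congr_left fun δ => by ring

theorem coeff_zero_eq_of_tendsto {f : ℝ → ℂ} {c : ℕ → ℂ} {l : ℂ}
    (hc : (fun δ : ℝ => f δ - ∑ k ∈ Finset.range 1, c k * (δ : ℂ) ^ k)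
      =O[𝓝[>] 0] fun δ : ℝ => δ ^ 1) (hl : Tendsto f (𝓝[>] 0) (𝓝 l)) : c 0 = l := by
  simp only [Finset.sum_range_one, pow_zero, mul_one, pow_one] at hc
  have h1 : Tendsto (fun δ : ℝ => f δ - c 0) (𝓝[>] 0) (𝓝 0) :=
    hc.trans_tendsto (tendsto_id.mono_left nhdsWithin_le_nhds)
  have h2 := tendsto_nhds_unique h1 (hl.sub_const (c 0))
  exact (sub_eq_zero.1 h2.symm).symm

/-! ### The Laplace transform of the mean square near the origin -/

/-- The Laplace transform `∫_1^∞ |ζ(1/2 + it)|² e^{-δt} dt`. -/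
noncomputable def laplaceTail (δ : ℝ) : ℂ := ∫ t in Ioi (1 : ℝ), (zetaSq t : ℂ) * cexp (-(δ * t))

/-- The difference between `zetaWeight` and the restriction of `|ζ|²` to `(1, ∞)`. It decays like
`e^{-π|t|}` up to a power, so its Laplace transform is holomorphic near `0`. -/
noncomputable def weightRest (t : ℝ) : ℂ :=
  zetaWeight t - indicator (Ioi 1) (fun t => (zetaSq t : ℂ)) t

theorem norm_weightRest_le (t : ℝ) :
    ‖weightRest t‖ ≤ Real.exp (2 * Real.pi) * zetaSq t * Real.exp (-(Real.pi * |t|)) := by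
  have h0 := zetaSq_nonneg t
  have hK : 1 ≤ Real.exp (2 * Real.pi) := Real.one_le_exp (by positivity)
  rw [weightRest]
  rcases lt_or_ge 1 t with ht | ht
  · have hm : t ∈ Ioi (1 : ℝ) := ht
    have h1 := one_add_I_mul_ne_zero (Real.exp (-(Real.pi * t)))
    have h2 : zetaWeight t - (zetaSq t : ℂ)
        = -(I * Real.exp (-(Real.pi * t))) * zetaWeight t := by
      rw [zetaWeight]; field_simp; ring
    rw [indicator_of_mem hm, h2, norm_mul, norm_neg, norm_mul, norm_I, one_mul, norm_real,
      Real.norm_of_nonneg (Real.exp_pos _).le, abs_of_pos (one_pos.trans ht), mul_comm]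
    gcongr
    exact (norm_zetaWeight_le t).trans (le_mul_of_one_le_left h0 hK)
  · have hm : t ∉ Ioi (1 : ℝ) := not_lt.2 ht
    rw [indicator_of_notMem hm, sub_zero]
    rcases le_total 0 t with ht0 | ht0
    · refine (norm_zetaWeight_le t).trans ?_
      rw [mul_right_comm, ← Real.exp_add, abs_of_nonneg ht0]
      refine le_mul_of_one_le_left h0 (Real.one_le_exp ?_)
      nlinarith [Real.pi_pos]
    · refine (norm_zetaWeight_le' t).trans ?_
      rw [abs_of_nonpos ht0, mul_neg, neg_neg]
      gcongr
      exact le_mul_of_one_le_left h0 hK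

theorem measurable_weightRest : Measurable weightRest :=
  continuous_zetaWeight.measurable.sub
    ((measurable_ofReal.comp continuous_zetaSq.measurable).indicator measurableSet_Ioi)

theorem integrable_weightRest {a : ℝ} (ha : a < Real.pi) :
    Integrable fun t => ‖weightRest t‖ * Real.exp (a * |t|) := by
  have hε : 0 < (Real.pi - a) / 2 := by linarith
  refine ((integrable_exp_neg_mul_abs hε).const_mul
    (Real.exp (2 * Real.pi) * (2 + 4 / ((Real.pi - a) / 2)) ^ 2)).mono
    (measurable_weightRest.norm.mul (by fun_prop)).aestronglyMeasurable
    (Eventually.of_forall fun t => ?_)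
  rw [Real.norm_of_nonneg (by positivity), Real.norm_of_nonneg (by positivity)]
  calc ‖weightRest t‖ * Real.exp (a * |t|)
      ≤ Real.exp (2 * Real.pi) * ((2 + 4 / ((Real.pi - a) / 2)) ^ 2
          * Real.exp ((Real.pi - a) / 2 * |t|)) * Real.exp (-(Real.pi * |t|))
          * Real.exp (a * |t|) := by
        gcongr
        refine (norm_weightRest_le t).trans ?_
        gcongr
        exact zetaSq_le hε t
    _ = Real.exp (2 * Real.pi) * (2 + 4 / ((Real.pi - a) / 2)) ^ 2
          * (Real.exp ((Real.pi - a) / 2 * |t|) * Real.exp (-(Real.pi * |t|))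
          * Real.exp (a * |t|)) := by ring
    _ = _ := by rw [← Real.exp_add, ← Real.exp_add]; congr 2; ring

theorem integrableOn_zetaSq_mul_exp {δ : ℝ} (hδ : 0 < δ) :
    IntegrableOn (fun t : ℝ => (zetaSq t : ℂ) * cexp (-(δ * t))) (Ioi 1) := by
  refine ((integrable_exp_neg_mul_abs (half_pos hδ)).const_mul
    ((2 + 4 / (δ / 2)) ^ 2)).integrableOn.mono' ?_ ?_
  · exact ((continuous_ofReal.comp continuous_zetaSq).mul (by fun_prop)).aestronglyMeasurable
  · refine (ae_restrict_iff' measurableSet_Ioi).2 (Eventually.of_forall fun t ht => ?_)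
    have ht0 : 0 < t := one_pos.trans ht
    rw [norm_mul, norm_real, Real.norm_of_nonneg (zetaSq_nonneg t),
      show -((δ : ℂ) * t) = ((-(δ * t) : ℝ) : ℂ) by push_cast; ring, ← ofReal_exp, norm_real,
      Real.norm_of_nonneg (Real.exp_pos _).le]
    calc zetaSq t * Real.exp (-(δ * t))
        ≤ (2 + 4 / (δ / 2)) ^ 2 * Real.exp (δ / 2 * |t|) * Real.exp (-(δ * t)) := by
          gcongr; exact zetaSq_le (half_pos hδ) t
      _ = _ := by
          rw [mul_assoc, ← Real.exp_add, abs_of_pos ht0]; congr 2; ring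

theorem analyticAt_integral_weightRest :
    AnalyticAt ℂ (fun z : ℂ => ∫ t : ℝ, weightRest t * cexp (-z * t)) 0 := by
  refine DifferentiableOn.analyticAt (s := {z : ℂ | |z.re| < Real.pi}) (fun z hz => ?_)
    ((isOpen_lt (continuous_abs.comp continuous_re) continuous_const).mem_nhds
      (by simpa using Real.pi_pos))
  have h := differentiableAt_integral_mul_cexp measurable_weightRest.aestronglyMeasurable
    (fun a ha => integrable_weightRest ha) (z := -z) (by simpa using hz)
  exact (DifferentiableAt.comp (g := fun z : ℂ => ∫ t : ℝ, weightRest t * cexp (z * t)) z h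
    (by fun_prop : DifferentiableAt ℂ (fun z : ℂ => -z) z)).differentiableWithinAt

theorem laplaceTail_eq {δ : ℝ} (h0 : 0 < δ) (hπ : δ < Real.pi) :
    laplaceTail δ = (∫ t : ℝ, zetaWeight t * cexp (-(δ * t)))
      - ∫ t : ℝ, weightRest t * cexp (-(δ : ℂ) * t) := by
  have h1 : Integrable fun t : ℝ => weightRest t * cexp (-(δ : ℂ) * t) := by
    refine (integrable_weightRest hπ).mono (measurable_weightRest.mul
      (by fun_prop)).aestronglyMeasurable (Eventually.of_forall fun t => ?_)
    rw [norm_mul, Real.norm_of_nonneg (by positivity)]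
    gcongr
    refine (norm_cexp_mul_ofReal_le _ t).trans ?_
    rw [neg_re, ofReal_re, abs_neg, abs_of_pos h0]
  have h2 : Integrable (indicator (Ioi 1) fun t : ℝ => (zetaSq t : ℂ) * cexp (-(δ * t))) :=
    (integrable_indicator_iff measurableSet_Ioi).2 (integrableOn_zetaSq_mul_exp h0)
  have h3 := integral_add h2 h1
  rw [integral_indicator measurableSet_Ioi] at h3
  rw [laplaceTail, eq_sub_iff_add_eq, ← h3]
  refine integral_congr_ae (Eventually.of_forall fun t => ?_)
  have h4 : indicator (Ioi 1) (fun t : ℝ => (zetaSq t : ℂ) * cexp (-(δ * t))) t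
      = indicator (Ioi 1) (fun t : ℝ => (zetaSq t : ℂ)) t * cexp (-(δ * t)) := by
    rw [indicator_mul_left]
  simp only [h4, weightRest, neg_mul]
  ring

theorem differentiable_lambertArg : Differentiable ℂ lambertArg := by
  unfold lambertArg; fun_prop

theorem lambertArg_zero : lambertArg 0 = 0 := by simp [lambertArg]

/-- The entire function `lambertArg z / z`. -/
noncomputable def lambertSlope (z : ℂ) : ℂ := dslope lambertArg 0 z

theorem differentiable_lambertSlope : Differentiable ℂ lambertSlope :=
  differentiable_dslope differentiable_lambertArg 0

theorem mul_lambertSlope (z : ℂ) : z * lambertSlope z = lambertArg z := by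
  have := sub_smul_dslope lambertArg 0 z
  simpa [lambertSlope, lambertArg_zero] using this

theorem lambertSlope_zero : lambertSlope 0 = 2 * Real.pi := by
  have h : HasDerivAt lambertArg (2 * Real.pi * I * (cexp (-(I * 0)) * -(I * 1))) 0 :=
    ((((hasDerivAt_id (0 : ℂ)).const_mul I).fun_neg.cexp).sub_const 1).const_mul _
  rw [lambertSlope, dslope_same, h.deriv]
  simp only [mul_zero, neg_zero, Complex.exp_zero, mul_one, one_mul]
  linear_combination -2 * Real.pi * I_mul_I

theorem lambertSlope_neg (z : ℂ) : lambertSlope (-z) = lambertSlope z * cexp (I * z) := by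
  rcases eq_or_ne z 0 with rfl | hz
  · simp
  refine mul_left_cancel₀ hz ?_
  have h1 := mul_lambertSlope (-z)
  have h2 := mul_lambertSlope z
  have h3 : cexp (-(I * z)) * cexp (I * z) = 1 := by rw [← Complex.exp_add]; simp
  rw [lambertArg] at h1 h2
  rw [show -(I * -z) = I * z by ring] at h1
  linear_combination -h1 - cexp (I * z) * h2 - 2 * Real.pi * I * h3

/-- The coefficient of `-log δ` in `δ` times the Laplace transform. It equals `(z/2) / sin (z/2)`. -/
noncomputable def laplaceLogCoeff (z : ℂ) : ℂ := 2 * Real.pi * cexp (-(I * z / 2)) / lambertSlope z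

theorem two_pi_ne_zero : (2 * Real.pi : ℂ) ≠ 0 := by exact_mod_cast Real.two_pi_pos.ne'

theorem analyticAt_laplaceLogCoeff : AnalyticAt ℂ laplaceLogCoeff 0 := by
  have h : Differentiable ℂ fun z : ℂ => 2 * (Real.pi : ℂ) * cexp (-(I * z / 2)) := by fun_prop
  exact (h.analyticAt 0).div (differentiable_lambertSlope.analyticAt 0)
    (by rw [lambertSlope_zero]; exact two_pi_ne_zero)

theorem laplaceLogCoeff_zero : laplaceLogCoeff 0 = 1 := by
  rw [laplaceLogCoeff, lambertSlope_zero]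
  simp

theorem laplaceLogCoeff_neg (z : ℂ) : laplaceLogCoeff (-z) = laplaceLogCoeff z := by
  have h : cexp (-(I * -z / 2)) = cexp (-(I * z / 2)) * cexp (I * z) := by
    rw [← Complex.exp_add]; congr 1; ring
  rw [laplaceLogCoeff, laplaceLogCoeff, lambertSlope_neg, h, ← mul_assoc,
    mul_div_mul_right _ _ (Complex.exp_ne_zero _)]

theorem iteratedDeriv_laplaceLogCoeff_of_odd {k : ℕ} (hk : Odd k) :
    iteratedDeriv k laplaceLogCoeff 0 = 0 := by
  have h := iteratedDeriv_comp_neg k laplaceLogCoeff 0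
  simp only [laplaceLogCoeff_neg, hk.neg_one_pow, neg_zero, neg_smul, one_smul] at h
  exact self_eq_neg.1 h

/-- The entire function `(1 - e^{-w}) / z` for `w = lambertArg z`. -/
noncomputable def laplaceLogArg (z : ℂ) : ℂ := lambertSlope z * expQuot (lambertArg z)

theorem laplaceLogArg_zero : laplaceLogArg 0 = 2 * Real.pi := by
  rw [laplaceLogArg, lambertArg_zero, expQuot_zero, lambertSlope_zero, mul_one]

theorem analyticAt_laplaceLogArg : AnalyticAt ℂ laplaceLogArg 0 :=
  (differentiable_lambertSlope.mul
    (differentiable_expQuot.comp differentiable_lambertArg)).analyticAt 0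

theorem mul_laplaceLogArg (z : ℂ) : z * laplaceLogArg z = 1 - cexp (-lambertArg z) := by
  rw [laplaceLogArg, ← mul_assoc, mul_lambertSlope, mul_expQuot]

theorem analyticAt_log_laplaceLogArg :
    AnalyticAt ℂ (fun z => Complex.log (laplaceLogArg z)) 0 :=
  analyticAt_laplaceLogArg.clog (by
    rw [laplaceLogArg_zero]
    exact_mod_cast Complex.ofReal_mem_slitPlane.2 Real.two_pi_pos)

theorem log_laplaceLogArg_zero : Complex.log (laplaceLogArg 0) = Real.log (2 * Real.pi) := by
  rw [laplaceLogArg_zero, Complex.ofReal_log Real.two_pi_pos.le]; push_cast; rfl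

/-- For small `δ > 0` the argument lies in the sector around the positive axis. -/
theorem eventually_lambertArg_mem_sector :
    ∀ᶠ δ : ℝ in 𝓝[>] 0, |(lambertArg δ).im| < (lambertArg δ).re := by
  filter_upwards [Ioo_mem_nhdsGT (zero_lt_one' ℝ)] with δ hδ
  rw [lambertArg_re, lambertArg_im, abs_of_nonpos
    (mul_nonpos_of_nonneg_of_nonpos Real.two_pi_pos.le (by linarith [Real.cos_le_one δ])),
    ← mul_neg]
  refine mul_lt_mul_of_pos_left ?_ Real.two_pi_pos
  have h1 := Real.cos_sq_add_sin_sq δ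
  have h2 : 0 < Real.sin δ := Real.sin_pos_of_pos_of_lt_pi hδ.1
    (hδ.2.trans (by linarith [Real.pi_gt_three]))
  have h3 : 0 < Real.cos δ := Real.cos_pos_of_mem_Ioo
    ⟨by linarith [Real.pi_gt_three, hδ.1], by linarith [Real.pi_gt_three, hδ.2]⟩
  nlinarith

/-- The Euler-Maclaurin part of the Lambert series has a power expansion along the arc
`lambertArg`. -/
theorem hasPowerExpansion_boseSum_lambertArg :
    HasPowerExpansion fun δ : ℝ =>
      boseSum (lambertArg δ) - Real.eulerMascheroniConstant / lambertArg δ := fun N => by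
  obtain ⟨c, hc⟩ := exists_boseSum_expansion
  obtain ⟨C, hC⟩ := hc N
  refine ⟨fun z => ∑ k ∈ Finset.range (N + 1), c k * lambertArg z ^ k, ?_, ?_⟩
  · refine Differentiable.analyticAt ?_ 0
    exact Differentiable.fun_sum fun k _ => (differentiable_lambertArg.pow k).const_mul (c k)
  · have h1 : (fun δ : ℝ => boseSum (lambertArg δ) - Real.eulerMascheroniConstant / lambertArg δ
        - ∑ k ∈ Finset.range (N + 1), c k * lambertArg δ ^ k)
        =O[𝓝[>] 0] fun δ : ℝ => ‖lambertArg δ‖ ^ N := by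
      refine IsBigO.of_bound C ?_
      filter_upwards [eventually_lambertArg_mem_sector] with δ hδ
      rw [norm_pow, norm_norm]
      exact hC _ hδ
    have h2 : (fun δ : ℝ => lambertArg δ) =O[𝓝[>] 0] fun δ : ℝ => δ := by
      have h3 := (isBigO_refl (fun δ : ℝ => δ) (𝓝[>] 0)).mul
        (differentiable_lambertSlope.analyticAt 0).isBigO_one_ofReal.norm_left
      simp only [mul_one] at h3
      refine IsBigO.trans (isBigO_of_le _ fun δ => ?_) h3
      rw [← mul_lambertSlope, norm_mul, norm_mul, norm_norm, norm_real]
    exact h1.trans (h2.norm_left.pow N)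

/-- The part of `δ` times the Laplace transform that has no logarithm. The terms in the factor of `δ`
are the Euler–Maclaurin sum without its pole, the elementary term of Atkinson's formula, and the
correction for the weight. -/
noncomputable def laplaceRegular (δ : ℝ) : ℂ :=
  laplaceLogCoeff δ * (Real.eulerMascheroniConstant - Complex.log (laplaceLogArg δ))
    + δ * (2 * Real.pi * cexp (-(I * δ / 2))
        * (boseSum (lambertArg δ) - Real.eulerMascheroniConstant / lambertArg δ)
      + (-(2 * Real.pi * cexp (-(I * δ / 2))
          * ((Real.eulerMascheroniConstant - Real.log (2 * Real.pi) - I * (Real.pi / 2 - δ))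
            / (2 * Real.pi * I * cexp (-(I * δ)))))
        - ∫ t : ℝ, weightRest t * cexp (-(δ : ℂ) * t)))

theorem hasPowerExpansion_laplaceRegular_correction :
    HasPowerExpansion fun δ : ℝ => 2 * Real.pi * cexp (-(I * δ / 2))
        * (boseSum (lambertArg δ) - Real.eulerMascheroniConstant / lambertArg δ)
      + (-(2 * Real.pi * cexp (-(I * δ / 2))
          * ((Real.eulerMascheroniConstant - Real.log (2 * Real.pi) - I * (Real.pi / 2 - δ))
            / (2 * Real.pi * I * cexp (-(I * δ)))))
        - ∫ t : ℝ, weightRest t * cexp (-(δ : ℂ) * t)) := by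
  have h1 : Differentiable ℂ fun z : ℂ => 2 * (Real.pi : ℂ) * cexp (-(I * z / 2)) := by fun_prop
  have h2 : Differentiable ℂ fun z : ℂ => -(2 * Real.pi * cexp (-(I * z / 2))
          * ((Real.eulerMascheroniConstant - Real.log (2 * Real.pi) - I * (Real.pi / 2 - z))
            / (2 * Real.pi * I * cexp (-(I * z))))) := by
    refine (h1.mul (Differentiable.div (by fun_prop) (by fun_prop) fun z => ?_)).fun_neg
    exact mul_ne_zero (mul_ne_zero two_pi_ne_zero I_ne_zero) (Complex.exp_ne_zero _)
  exact ((hasPowerExpansion_boseSum_lambertArg).analytic_mul (h1.analyticAt 0)).add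
    ((h2.analyticAt 0).sub analyticAt_integral_weightRest).hasPowerExpansion

theorem analyticAt_laplaceRegular_main : AnalyticAt ℂ (fun z => laplaceLogCoeff z
    * (Real.eulerMascheroniConstant - Complex.log (laplaceLogArg z))) 0 :=
  analyticAt_laplaceLogCoeff.mul (analyticAt_const.sub analyticAt_log_laplaceLogArg)

theorem hasPowerExpansion_laplaceRegular : HasPowerExpansion laplaceRegular :=
  analyticAt_laplaceRegular_main.hasPowerExpansion.add
    (hasPowerExpansion_laplaceRegular_correction.analytic_mul analyticAt_id)

theorem tendsto_laplaceRegular : Tendsto laplaceRegular (𝓝[>] 0)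
    (𝓝 (Real.eulerMascheroniConstant - Real.log (2 * Real.pi))) := by
  have h1 := analyticAt_laplaceRegular_main.continuousAt.tendsto.comp tendsto_ofReal_nhdsGT_zero
  rw [laplaceLogCoeff_zero, log_laplaceLogArg_zero, one_mul] at h1
  have h2 := ((isBigO_refl (fun δ : ℝ => (δ : ℂ)) (𝓝[>] 0)).norm_right.mul
    hasPowerExpansion_laplaceRegular_correction.isBigO_one).trans_tendsto
    (by simpa using tendsto_ofReal_nhdsGT_zero.norm)
  have := h1.add h2
  rw [add_zero] at this
  exact this

theorem eventually_mul_laplaceTail_eq : ∀ᶠ δ : ℝ in 𝓝[>] 0,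
    δ * laplaceTail δ = laplaceLogCoeff δ * -(Real.log δ : ℂ) + laplaceRegular δ := by
  have hne : ∀ᶠ z in 𝓝 (0 : ℂ), lambertSlope z ≠ 0 :=
    (differentiable_lambertSlope.continuous.tendsto 0).eventually_ne
      (by rw [lambertSlope_zero]; exact two_pi_ne_zero)
  have hne' : ∀ᶠ z in 𝓝 (0 : ℂ), laplaceLogArg z ≠ 0 :=
    analyticAt_laplaceLogArg.continuousAt.tendsto.eventually_ne
      (by rw [laplaceLogArg_zero]; exact two_pi_ne_zero)
  filter_upwards [eventually_lambertArg_mem_sector, tendsto_ofReal_nhdsGT_zero.eventually hne,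
    tendsto_ofReal_nhdsGT_zero.eventually hne', Ioo_mem_nhdsGT Real.pi_pos] with δ hw hq hL hδ
  have hδ0 : (δ : ℂ) ≠ 0 := by exact_mod_cast hδ.1.ne'
  rw [laplaceTail_eq hδ.1 hδ.2, integral_zetaWeight_mul_exp hδ.1 hδ.2, divisorExp_eq_boseSum hw,
    ← mul_laplaceLogArg, Complex.log_ofReal_mul hδ.1 hL, laplaceRegular, laplaceLogCoeff]
  have hs := mul_lambertSlope δ
  rw [← hs]
  generalize cexp (-(I * δ / 2)) = A
  generalize (Real.eulerMascheroniConstant - Real.log (2 * Real.pi) - I * (Real.pi / 2 - δ) : ℂ)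
            / (2 * Real.pi * I * cexp (-(I * δ))) = B
  generalize boseSum _ = S
  field_simp
  ring

/-- The asymptotic expansion of the Laplace transform at `0⁺`. That the logarithmic coefficients of
odd index vanish is what confines the poles of the Mellin transform to odd integers. -/
theorem exists_laplaceTail_expansion : ∃ a b : ℕ → ℂ, a 0 = 1 ∧
    b 0 = Real.eulerMascheroniConstant - Real.log (2 * Real.pi) ∧ (∀ k, Odd k → a k = 0) ∧
    ∀ N : ℕ, (fun δ : ℝ => laplaceTail δ
        - ∑ k ∈ Finset.range N, (b k - a k * Real.log δ) * (δ : ℂ) ^ ((k : ℂ) - 1))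
      =O[𝓝[>] 0] fun δ : ℝ => δ ^ ((N : ℝ) - 2) := by
  obtain ⟨b, hb⟩ := hasPowerExpansion_laplaceRegular.exists_coeff
  refine ⟨fun k => iteratedDeriv k laplaceLogCoeff 0 / k.factorial, b,
    by simp [laplaceLogCoeff_zero], coeff_zero_eq_of_tendsto (hb 1) tendsto_laplaceRegular,
    fun k hk => by simp [iteratedDeriv_laplaceLogCoeff_of_odd hk], fun N => ?_⟩
  -- the crude bound `log δ = O(1/δ)` costs one power of `δ`, whence the exponent `N - 2`
  have hlog : (fun δ : ℝ => (Real.log δ : ℂ)) =O[𝓝[>] 0] fun δ : ℝ => δ⁻¹ := by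
    refine IsBigO.of_bound 1 ?_
    filter_upwards [Ioc_mem_nhdsGT one_pos] with δ hδ
    have := Real.abs_log_mul_self_lt δ hδ.1 hδ.2
    rw [norm_real, norm_inv, Real.norm_of_nonneg hδ.1.le, one_mul, Real.norm_eq_abs,
      ← one_div, le_div_iff₀ hδ.1]
    rw [abs_mul, abs_of_pos hδ.1] at this
    exact this.le
  have h1 := (taylor_isBigO analyticAt_laplaceLogCoeff N).mul hlog.neg_left
  have h2 : (fun δ : ℝ => δ ^ N) =O[𝓝[>] 0] fun δ : ℝ => δ ^ N * δ⁻¹ := by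
    refine IsBigO.of_bound 1 ?_
    filter_upwards [Ioc_mem_nhdsGT one_pos] with δ hδ
    rw [norm_mul, one_mul, norm_inv, Real.norm_of_nonneg hδ.1.le]
    exact le_mul_of_one_le_right (norm_nonneg _) ((one_le_inv₀ hδ.1).2 hδ.2)
  have h3 := (h1.add ((hb N).trans h2)).mul
    (isBigO_refl (fun δ : ℝ => ((δ : ℂ))⁻¹) (𝓝[>] 0)).norm_right
  refine h3.congr' ?_ ?_
  · filter_upwards [eventually_mul_laplaceTail_eq, self_mem_nhdsWithin] with δ h hδ
    have hδ0 : (δ : ℂ) ≠ 0 := by exact_mod_cast (ne_of_gt hδ)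
    have hF : laplaceTail δ = (laplaceLogCoeff δ * -(Real.log δ : ℂ) + laplaceRegular δ)
        * (δ : ℂ)⁻¹ := by rw [← h]; field_simp
    have hsum : ∑ k ∈ Finset.range N, (b k - iteratedDeriv k laplaceLogCoeff 0 / k.factorial
          * Real.log δ) * (δ : ℂ) ^ ((k : ℂ) - 1)
        = (∑ k ∈ Finset.range N, b k * (δ : ℂ) ^ k - (∑ k ∈ Finset.range N,
          iteratedDeriv k laplaceLogCoeff 0 / k.factorial * (δ : ℂ) ^ k) * Real.log δ)
          * (δ : ℂ)⁻¹ := by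
      rw [Finset.sum_mul, ← Finset.sum_sub_distrib, Finset.sum_mul]
      refine Finset.sum_congr rfl fun k _ => ?_
      rw [cpow_sub _ _ hδ0, cpow_natCast, cpow_one]
      ring
    rw [hF, hsum]
    ring
  · filter_upwards [self_mem_nhdsWithin] with δ hδ
    have h0 : 0 < δ := hδ
    rw [norm_inv, norm_real, Real.norm_of_nonneg h0.le, Real.rpow_sub h0, Real.rpow_natCast,
      Real.rpow_two]
    field_simp

/-! ### The Mellin transform of the Laplace transform -/

theorem norm_zetaSq_mul_exp (δ t : ℝ) :
    ‖(zetaSq t : ℂ) * cexp (-(δ * t))‖ = zetaSq t * Real.exp (-(δ * t)) := by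
  rw [norm_mul, norm_real, Real.norm_of_nonneg (zetaSq_nonneg t), norm_exp]
  simp

/-- The integrand is non-negative, so taking norms inside the integral loses nothing. -/
theorem norm_laplaceTail (δ : ℝ) :
    ‖laplaceTail δ‖ = ∫ t in Ioi (1 : ℝ), ‖(zetaSq t : ℂ) * cexp (-(δ * t))‖ := by
  have h : laplaceTail δ = ((∫ t in Ioi (1 : ℝ), ‖(zetaSq t : ℂ) * cexp (-(δ * t))‖ : ℝ) : ℂ) := by
    rw [laplaceTail, ← integral_complex_ofReal]
    refine integral_congr_ae (Eventually.of_forall fun t => ?_)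
    simp only [norm_zetaSq_mul_exp]
    push_cast
    rfl
  rw [h, norm_real, Real.norm_of_nonneg (integral_nonneg fun t => norm_nonneg _)]

theorem continuousOn_laplaceTail : ContinuousOn laplaceTail (Ioi 0) := by
  intro δ₀ hδ₀
  have h0 : 0 < δ₀ := hδ₀
  refine ContinuousAt.continuousWithinAt ?_
  refine continuousAt_of_dominated (bound := fun t => ‖(zetaSq t : ℂ) * cexp (-((δ₀ / 2 : ℝ) * t))‖)
    ?_ ?_ (integrableOn_zetaSq_mul_exp (half_pos h0)).norm ?_
  · exact Eventually.of_forall fun δ =>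
      ((continuous_ofReal.comp continuous_zetaSq).mul (by fun_prop)).aestronglyMeasurable
  · filter_upwards [Ioi_mem_nhds (half_lt_self h0)] with δ hδ
    refine (ae_restrict_iff' measurableSet_Ioi).2 (Eventually.of_forall fun t ht => ?_)
    have ht0 : 0 < t := one_pos.trans ht
    have hδ' : δ₀ / 2 < δ := hδ
    rw [norm_zetaSq_mul_exp, norm_zetaSq_mul_exp]
    gcongr
    exact zetaSq_nonneg t
  · exact Eventually.of_forall fun t => by fun_prop

theorem laplaceTail_isBigO_top : laplaceTail =O[atTop] fun δ : ℝ => Real.exp (-1 * δ) := by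
  refine IsBigO.of_bound (Real.exp 1 * ‖laplaceTail 1‖) ?_
  filter_upwards [eventually_ge_atTop 1] with δ hδ
  rw [norm_laplaceTail, norm_laplaceTail, Real.norm_of_nonneg (Real.exp_pos _).le, mul_right_comm,
    ← Real.exp_add, ← integral_const_mul]
  have h1 := (integrableOn_zetaSq_mul_exp one_pos).norm
  refine setIntegral_mono_on (integrableOn_zetaSq_mul_exp (one_pos.trans_le hδ)).norm
    (h1.const_mul _) measurableSet_Ioi fun t ht => ?_
  have ht1 : 1 < t := ht
  rw [norm_zetaSq_mul_exp, norm_zetaSq_mul_exp, mul_left_comm, ← Real.exp_add]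
  refine mul_le_mul_of_nonneg_left (Real.exp_le_exp.2 ?_) (zetaSq_nonneg t)
  nlinarith

theorem integrable_mellin_laplace {s : ℂ} (h : MellinConvergent laplaceTail s) :
    Integrable (Function.uncurry fun δ t : ℝ =>
      (δ : ℂ) ^ (s - 1) * ((zetaSq t : ℂ) * cexp (-(δ * t))))
      ((volume.restrict (Ioi (0 : ℝ))).prod (volume.restrict (Ioi (1 : ℝ)))) := by
  have hmeas : Measurable (Function.uncurry fun δ t : ℝ =>
      (δ : ℂ) ^ (s - 1) * ((zetaSq t : ℂ) * cexp (-(δ * t)))) := by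
    have h1 := continuous_zetaSq.measurable
    unfold Function.uncurry
    fun_prop
  refine (integrable_prod_iff hmeas.aestronglyMeasurable).2 ⟨?_, ?_⟩
  · refine (ae_restrict_iff' measurableSet_Ioi).2 (Eventually.of_forall fun δ hδ => ?_)
    exact (integrableOn_zetaSq_mul_exp hδ).const_mul ((δ : ℂ) ^ (s - 1))
  · refine (MeasureTheory.Integrable.norm h).congr (Eventually.of_forall fun δ => ?_)
    simp only [Function.uncurry_apply_pair]
    rw [norm_smul, norm_laplaceTail, ← integral_const_mul]
    simp only [norm_mul]

theorem integral_cpow_mul_zetaSq_mul_exp {s : ℂ} (hs : 0 < s.re) {t : ℝ} (ht : 0 < t) :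
    ∫ δ in Ioi (0 : ℝ), (δ : ℂ) ^ (s - 1) * ((zetaSq t : ℂ) * cexp (-(δ * t)))
      = Gamma s * mellinSqIntegrand s t := by
  have h1 := integral_cpow_mul_exp_neg_mul_Ioi (a := s) (r := t) hs (by simpa using ht)
  have h2 : (1 / (t : ℂ)) ^ s = (t : ℂ) ^ (-s) := by
    rw [one_div, inv_cpow _ _ (by rw [arg_ofReal_of_nonneg ht.le]; exact Real.pi_pos.ne), cpow_neg]
  calc ∫ δ in Ioi (0 : ℝ), (δ : ℂ) ^ (s - 1) * ((zetaSq t : ℂ) * cexp (-(δ * t)))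
      = ∫ δ in Ioi (0 : ℝ), (zetaSq t : ℂ) * ((δ : ℂ) ^ (s - 1) * cexp (-(t * δ))) := by
        congr 1; ext δ; rw [mul_comm (δ : ℂ) t]; ring
    _ = _ := by
        rw [integral_const_mul, h1, h2, mellinSqIntegrand, zetaSq]; ring

/-- Absolute convergence passes from the Mellin transform of the Laplace transform to the Mellin
transform of `|ζ(1/2 + ix)|²`, by Tonelli's theorem. -/
theorem integrableOn_mellinSqIntegrand {s : ℂ} (hs : 0 < s.re)
    (h : MellinConvergent laplaceTail s) : IntegrableOn (mellinSqIntegrand s) (Ioi 1) := by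
  have h1 := (integrable_mellin_laplace h).integral_prod_right
  have h2 : IntegrableOn (fun t : ℝ => Gamma s * mellinSqIntegrand s t) (Ioi 1) := by
    refine IntegrableOn.congr_fun h1 (fun t ht => ?_) measurableSet_Ioi
    exact integral_cpow_mul_zetaSq_mul_exp hs (one_pos.trans ht)
  refine (h2.const_mul (Gamma s)⁻¹).congr (Eventually.of_forall fun t => ?_)
  exact inv_mul_cancel_left₀ (Gamma_ne_zero_of_re_pos hs) _

/-- The inner integral over `δ` is `Γ(s) t^{-s}`. -/
theorem mellin_laplaceTail {s : ℂ} (hs : 0 < s.re) (h : MellinConvergent laplaceTail s) :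
    mellin laplaceTail s = Gamma s * mellinSqIntegral s := by
  have h1 := integral_integral_swap (integrable_mellin_laplace h)
  rw [mellin, mellinSqIntegral, ← integral_const_mul]
  calc ∫ δ in Ioi (0 : ℝ), (δ : ℂ) ^ (s - 1) • laplaceTail δ
      = ∫ δ in Ioi (0 : ℝ), ∫ t in Ioi (1 : ℝ),
          (δ : ℂ) ^ (s - 1) * ((zetaSq t : ℂ) * cexp (-(δ * t))) := by
        simp only [integral_const_mul, smul_eq_mul, laplaceTail]
    _ = _ := h1
    _ = _ := setIntegral_congr_fun measurableSet_Ioi fun t ht =>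
        integral_cpow_mul_zetaSq_mul_exp hs (one_pos.trans ht)

/-! ### Analytic continuation of the Mellin transform -/

/-- The `k`-th term of an expansion in powers and logarithms, cut off to `(0, 1]`. -/
noncomputable def expansionTerm (a b : ℕ → ℂ) (k : ℕ) (δ : ℝ) : ℂ :=
  b k * powNearZero ((k : ℂ) - 1) δ - a k * ((Real.log δ : ℂ) * powNearZero ((k : ℂ) - 1) δ)

theorem hasMellin_expansionTerm (a b : ℕ → ℂ) {k : ℕ} {s : ℂ} (hs : 1 - (k : ℝ) < s.re) :
    HasMellin (expansionTerm a b k) s (b k / (s + (k - 1)) + a k / (s + (k - 1)) ^ 2) := by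
  have hs' : 0 < (s + ((k : ℂ) - 1)).re := by simp; linarith
  obtain ⟨h1, h1'⟩ := hasMellin_powNearZero ((k : ℂ) - 1) hs'
  obtain ⟨h2, h2'⟩ := hasMellin_log_mul_powNearZero ((k : ℂ) - 1) hs'
  obtain ⟨h3, h3'⟩ := hasMellin_const_smul h1 (b k)
  obtain ⟨h4, h4'⟩ := hasMellin_const_smul h2 (a k)
  obtain ⟨h5, h5'⟩ := hasMellin_sub h3 h4
  refine ⟨h5, h5'.trans ?_⟩
  rw [h3', h4', h1', h2', smul_eq_mul, smul_eq_mul]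
  ring

/-- The Laplace transform minus the first `N` terms of its expansion. -/
noncomputable def laplaceCut (a b : ℕ → ℂ) (N : ℕ) (δ : ℝ) : ℂ :=
  laplaceTail δ - ∑ k ∈ Finset.range N, expansionTerm a b k δ

theorem laplaceCut_succ (a b : ℕ → ℂ) (N : ℕ) :
    laplaceCut a b N = fun δ => laplaceCut a b (N + 1) δ + expansionTerm a b N δ := by
  ext δ
  rw [laplaceCut, laplaceCut, Finset.sum_range_succ]
  ring

theorem laplaceCut_zero (a b : ℕ → ℂ) : laplaceCut a b 0 = laplaceTail := by
  ext δ; simp [laplaceCut]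

theorem locallyIntegrableOn_laplaceCut (a b : ℕ → ℂ) (N : ℕ) :
    LocallyIntegrableOn (laplaceCut a b N) (Ioi 0) := by
  induction N with
  | zero =>
    rw [laplaceCut_zero]
    exact continuousOn_laplaceTail.locallyIntegrableOn measurableSet_Ioi
  | succ N ih =>
    have h : laplaceCut a b (N + 1) = laplaceCut a b N - expansionTerm a b N := by
      rw [laplaceCut_succ a b N]; ext δ; simp
    rw [h]
    exact ih.sub (((locallyIntegrableOn_powNearZero _).smul (b N)).sub
      ((locallyIntegrableOn_log_mul_powNearZero _).smul (a N)))

theorem laplaceCut_isBigO_top (a b : ℕ → ℂ) (N : ℕ) :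
    laplaceCut a b N =O[atTop] fun δ : ℝ => Real.exp (-1 * δ) := by
  refine laplaceTail_isBigO_top.congr' (EventuallyEq.symm ?_) EventuallyEq.rfl
  have h : ∀ k ∈ Finset.range N, ∀ᶠ δ in atTop, expansionTerm a b k δ = 0 := fun k _ => by
    filter_upwards [powNearZero_eventuallyEq_top ((k : ℂ) - 1)] with δ hδ
    simp [expansionTerm, hδ]
  filter_upwards [(Filter.eventually_all_finset _).2 h] with δ hδ
  rw [laplaceCut, Finset.sum_eq_zero hδ, sub_zero]

/-- The coefficients `a`, `b` give an asymptotic expansion of the Laplace transform at `0⁺`. -/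
def IsLaplaceExpansion (a b : ℕ → ℂ) : Prop :=
  ∀ N : ℕ, (fun δ : ℝ => laplaceTail δ
      - ∑ k ∈ Finset.range N, (b k - a k * Real.log δ) * (δ : ℂ) ^ ((k : ℂ) - 1))
    =O[𝓝[>] 0] fun δ : ℝ => δ ^ ((N : ℝ) - 2)

variable {a b : ℕ → ℂ}

theorem laplaceCut_isBigO_zero (h : IsLaplaceExpansion a b) (N : ℕ) :
    laplaceCut a b N =O[𝓝[>] 0] fun δ : ℝ => δ ^ (-(2 - N : ℝ)) := by
  refine (h N).congr' ?_ (Eventually.of_forall fun δ => by simp only [neg_sub])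
  have h : ∀ k ∈ Finset.range N, ∀ᶠ δ : ℝ in 𝓝[>] 0, expansionTerm a b k δ
      = (b k - a k * Real.log δ) * (δ : ℂ) ^ ((k : ℂ) - 1) := fun k _ => by
    filter_upwards [powNearZero_eventuallyEq_zero ((k : ℂ) - 1)] with δ hδ
    rw [expansionTerm, hδ]
    ring
  filter_upwards [(Filter.eventually_all_finset _).2 h] with δ hδ
  rw [laplaceCut, Finset.sum_congr rfl hδ]

theorem mellinConvergent_laplaceCut (h : IsLaplaceExpansion a b) {N : ℕ} {s : ℂ}
    (hs : 2 - (N : ℝ) < s.re) : MellinConvergent (laplaceCut a b N) s :=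
  mellinConvergent_of_isBigO_rpow_exp one_pos (locallyIntegrableOn_laplaceCut a b N)
    (laplaceCut_isBigO_top a b N) (laplaceCut_isBigO_zero h N) hs

theorem analyticAt_mellin_laplaceCut (h : IsLaplaceExpansion a b) {N : ℕ} {s : ℂ}
    (hs : 2 - (N : ℝ) < s.re) : AnalyticAt ℂ (mellin (laplaceCut a b N)) s := by
  refine DifferentiableOn.analyticAt (s := {z : ℂ | 2 - (N : ℝ) < z.re}) (fun z hz => ?_)
    ((isOpen_lt continuous_const continuous_re).mem_nhds hs)
  exact (mellin_differentiableAt_of_isBigO_rpow_exp one_pos (locallyIntegrableOn_laplaceCut a b N)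
    (laplaceCut_isBigO_top a b N) (laplaceCut_isBigO_zero h N) hz).differentiableWithinAt

/-- One term of the expansion moves the line of convergence by one to the left. -/
theorem hasMellin_laplaceCut_succ (h : IsLaplaceExpansion a b) {N : ℕ} {s : ℂ}
    (hs : 1 - (N : ℝ) < s.re) : HasMellin (laplaceCut a b N) s
      (mellin (laplaceCut a b (N + 1)) s + (b N / (s + (N - 1)) + a N / (s + (N - 1)) ^ 2)) := by
  obtain ⟨h1, h1'⟩ := hasMellin_expansionTerm a b hs
  have h2 := mellinConvergent_laplaceCut h (N := N + 1) (s := s) (by push_cast; linarith)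
  rw [laplaceCut_succ a b N, ← h1']
  exact hasMellin_add h2 h1

theorem mellinConvergent_laplaceTail (h : IsLaplaceExpansion a b) {s : ℂ} (hs : 1 < s.re) :
    MellinConvergent laplaceTail s := by
  have h1 := (hasMellin_laplaceCut_succ h (N := 0) (s := s) (by simpa using hs)).1
  rwa [laplaceCut_zero] at h1

/-- The Mellin transform of the Laplace transform, continued past the first `N` poles. It is the
intended function where `Re s > 1 - N`. -/
noncomputable def mellinPartial (a b : ℕ → ℂ) (N : ℕ) (s : ℂ) : ℂ :=
  mellin (laplaceCut a b N) s
    + ∑ k ∈ Finset.range N, (b k / (s + (k - 1)) + a k / (s + (k - 1)) ^ 2)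

theorem mellinPartial_eq_of_le (h : IsLaplaceExpansion a b) {N M : ℕ} (hNM : N ≤ M) {s : ℂ}
    (hs : 1 - (N : ℝ) < s.re) : mellinPartial a b N s = mellinPartial a b M s := by
  induction M, hNM using Nat.le_induction with
  | base => rfl
  | succ M hM ih =>
    have hs' : 1 - (M : ℝ) < s.re := by
      have : (N : ℝ) ≤ M := by exact_mod_cast hM
      linarith
    rw [ih, mellinPartial, mellinPartial, Finset.sum_range_succ, (hasMellin_laplaceCut_succ h hs').2]
    ring

theorem mellinPartial_of_one_lt (h : IsLaplaceExpansion a b) (N : ℕ) {s : ℂ} (hs : 1 < s.re) :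
    mellinPartial a b N s = mellin laplaceTail s := by
  rw [← mellinPartial_eq_of_le h (Nat.zero_le N) (by simpa using hs), mellinPartial,
    laplaceCut_zero]
  simp

/-- The continuation of `mellinSqIntegral`, except that division by zero gives it arbitrary values at
the points `1 - k`. The order of the expansion that is used grows with `‖s‖`, so that
`Re s > 1 - N` always holds. -/
noncomputable def mellinSqCont (a b : ℕ → ℂ) (s : ℂ) : ℂ :=
  (Gamma s)⁻¹ * mellinPartial a b (⌈‖s‖⌉₊ + 2) s

theorem mellinSqCont_of_one_lt (h : IsLaplaceExpansion a b) {s : ℂ} (hs : 1 < s.re) :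
    mellinSqCont a b s = mellinSqIntegral s := by
  have h0 : 0 < s.re := one_pos.trans hs
  rw [mellinSqCont, mellinPartial_of_one_lt h _ hs,
    mellin_laplaceTail h0 (mellinConvergent_laplaceTail h hs),
    inv_mul_cancel_left₀ (Gamma_ne_zero_of_re_pos h0)]

/-- Near any point the varying order in `mellinSqCont` can be replaced by a fixed one. -/
theorem mellinSqCont_eventuallyEq (h : IsLaplaceExpansion a b) (p : ℂ) :
    ∃ M : ℕ, 2 - (M : ℝ) < p.re ∧
      mellinSqCont a b =ᶠ[𝓝 p] fun s => (Gamma s)⁻¹ * mellinPartial a b M s := by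
  refine ⟨⌈‖p‖⌉₊ + 3, ?_, ?_⟩
  · have h1 := Nat.le_ceil ‖p‖
    have h2 := (abs_le.1 (abs_re_le_norm p)).1
    push_cast
    linarith
  · have h1 : ∀ᶠ s in 𝓝 p, ‖s‖ < ‖p‖ + 1 :=
      (continuous_norm.tendsto p).eventually_lt_const (lt_add_one _)
    filter_upwards [h1] with s hs
    rw [mellinSqCont, mellinPartial_eq_of_le h (M := ⌈‖p‖⌉₊ + 3)]
    · have h2 : ⌈‖s‖⌉₊ ≤ ⌈‖p‖ + 1⌉₊ := Nat.ceil_le_ceil hs.le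
      rw [Nat.ceil_add_one (norm_nonneg p)] at h2
      omega
    · have h2 := Nat.le_ceil ‖s‖
      have h3 := (abs_le.1 (abs_re_le_norm s)).1
      push_cast
      linarith

theorem analyticAt_poleSum (a b : ℕ → ℂ) {S : Finset ℕ} {p : ℂ}
    (hp : ∀ k ∈ S, p ≠ 1 - k) :
    AnalyticAt ℂ (fun s => ∑ k ∈ S, (b k / (s + (k - 1)) + a k / (s + (k - 1)) ^ 2)) p := by
  refine Finset.analyticAt_fun_sum _ fun k hk => ?_
  have h0 : p + ((k : ℂ) - 1) ≠ 0 := fun h => hp k hk (by linear_combination h)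
  have h1 : AnalyticAt ℂ (fun s : ℂ => s + ((k : ℂ) - 1)) p := analyticAt_id.add analyticAt_const
  exact (analyticAt_const.div h1 h0).add (analyticAt_const.div (h1.pow 2) (pow_ne_zero 2 h0))

theorem analyticAt_mellinSqCont (h : IsLaplaceExpansion a b) {p : ℂ} (hp : ∀ k : ℕ, p ≠ 1 - k) :
    AnalyticAt ℂ (mellinSqCont a b) p := by
  obtain ⟨M, hM, hEq⟩ := mellinSqCont_eventuallyEq h p
  refine AnalyticAt.congr ?_ hEq.symm
  exact (differentiable_one_div_Gamma.analyticAt p).mul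
    ((analyticAt_mellin_laplaceCut h hM).add (analyticAt_poleSum a b fun k _ => hp k))

/-- Only the `k`-th term of the expansion is singular at `1 - k`. -/
theorem mellinSqCont_eventuallyEq_pole (h : IsLaplaceExpansion a b) (k : ℕ) :
    ∃ G : ℂ → ℂ, AnalyticAt ℂ G (1 - k) ∧ mellinSqCont a b =ᶠ[𝓝 (1 - k : ℂ)] fun s =>
      (Gamma s)⁻¹ * (G s + b k / (s - (1 - k)) + a k / (s - (1 - k)) ^ 2) := by
  obtain ⟨M, hM, hEq⟩ := mellinSqCont_eventuallyEq h (1 - k)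
  have hk : k ∈ Finset.range M := by
    simp only [sub_re, one_re, natCast_re] at hM
    have : (k : ℝ) < M := by linarith
    exact Finset.mem_range.2 (by exact_mod_cast this)
  refine ⟨fun s => mellin (laplaceCut a b M) s + ∑ j ∈ (Finset.range M).erase k,
      (b j / (s + (j - 1)) + a j / (s + (j - 1)) ^ 2),
    (analyticAt_mellin_laplaceCut h hM).add (analyticAt_poleSum a b fun j hj hjk => ?_), ?_⟩
  · have : (k : ℂ) = j := by linear_combination -hjk
    exact Finset.ne_of_mem_erase hj (by exact_mod_cast this.symm)
  · refine hEq.trans (Eventually.of_forall fun s => ?_)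
    simp only [mellinPartial]
    rw [← Finset.sum_erase_add _ _ hk, show s + ((k : ℂ) - 1) = s - (1 - k) by ring]
    ring

/-- The simple zeros of `1 / Γ` at the non-positive integers. -/
theorem exists_inv_Gamma_eq_mul (m : ℕ) :
    ∃ r : ℂ → ℂ, Differentiable ℂ r ∧ ∀ s, (Gamma s)⁻¹ = (s + m) * r s := by
  refine ⟨dslope (fun s => (Gamma s)⁻¹) (-m), differentiable_dslope differentiable_one_div_Gamma _,
    fun s => ?_⟩
  have := sub_smul_dslope (fun s => (Gamma s)⁻¹) (-(m : ℂ)) s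
  rw [smul_eq_mul, Gamma_neg_nat_eq_zero, inv_zero, sub_zero, sub_neg_eq_add] at this
  exact this.symm

/-- At a non-positive integer the zero of `1 / Γ` lowers the order of the pole by one. -/
theorem mellinSqCont_eventuallyEq_neg_nat (h : IsLaplaceExpansion a b) (m : ℕ) :
    ∃ G r : ℂ → ℂ, AnalyticAt ℂ G (-m) ∧ AnalyticAt ℂ r (-m) ∧
      mellinSqCont a b =ᶠ[𝓝[≠] (-m : ℂ)] fun s => G s + r s * (a (m + 1) / (s + m)) := by
  obtain ⟨G, hG, hEq⟩ := mellinSqCont_eventuallyEq_pole h (m + 1)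
  obtain ⟨r, hr, hr'⟩ := exists_inv_Gamma_eq_mul m
  have hp : (1 - ((m + 1 : ℕ) : ℂ)) = -m := by push_cast; ring
  rw [hp] at hG hEq
  refine ⟨fun s => r s * ((s + m) * G s + b (m + 1)), r, (hr.analyticAt _).mul
    (((analyticAt_id.add analyticAt_const).mul hG).add analyticAt_const), hr.analyticAt _, ?_⟩
  filter_upwards [hEq.filter_mono nhdsWithin_le_nhds, self_mem_nhdsWithin] with s hs hne
  have h0 : s + m ≠ 0 := fun h0 => hne (by rw [mem_singleton_iff]; linear_combination h0)
  rw [hs, hr', sub_neg_eq_add]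
  field_simp

/-- The Laurent expansion `1 / Γ(s) = 1 + γ (s - 1) + O((s - 1)^2)`. -/
theorem exists_inv_Gamma_eq_near_one : ∃ v : ℂ → ℂ, Differentiable ℂ v ∧ ∀ s,
    (Gamma s)⁻¹ = 1 + (s - 1) * (Real.eulerMascheroniConstant + (s - 1) * v s) := by
  have hd : Differentiable ℂ (dslope (fun s => (Gamma s)⁻¹) 1) :=
    differentiable_dslope differentiable_one_div_Gamma 1
  have h1 : dslope (fun s => (Gamma s)⁻¹) 1 1 = Real.eulerMascheroniConstant := by
    have := (hasDerivAt_Gamma_one).fun_inv (by rw [Gamma_one]; exact one_ne_zero)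
    rw [dslope_same, this.deriv]
    simp
  refine ⟨dslope (dslope (fun s => (Gamma s)⁻¹) 1) 1, differentiable_dslope hd 1, fun s => ?_⟩
  have h2 := sub_smul_dslope (fun s => (Gamma s)⁻¹) 1 s
  have h3 := sub_smul_dslope (dslope (fun s => (Gamma s)⁻¹) 1) 1 s
  simp only [smul_eq_mul, Gamma_one, inv_one] at h2 h3
  rw [h3, h1]
  linear_combination -h2

/-- The residue is `b 0` plus the contribution `γ` of the factor `1 / Γ` to the double pole. -/
theorem mellinSqCont_eventuallyEq_one (h : IsLaplaceExpansion a b) (ha : a 0 = 1) :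
    ∃ g : ℂ → ℂ, AnalyticAt ℂ g 1 ∧ mellinSqCont a b =ᶠ[𝓝[≠] 1] fun s =>
      1 / (s - 1) ^ 2 + (Real.eulerMascheroniConstant + b 0) / (s - 1) + g s := by
  obtain ⟨G, hG, hEq⟩ := mellinSqCont_eventuallyEq_pole h 0
  obtain ⟨v, hv, hv'⟩ := exists_inv_Gamma_eq_near_one
  rw [Nat.cast_zero, sub_zero, ha] at *
  refine ⟨fun s => (Gamma s)⁻¹ * G s + b 0 * (Real.eulerMascheroniConstant + (s - 1) * v s) + v s,
    (((differentiable_one_div_Gamma.analyticAt 1).mul hG).add (analyticAt_const.mul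
      (analyticAt_const.add ((analyticAt_id.sub analyticAt_const).mul (hv.analyticAt 1))))).add
      (hv.analyticAt 1), ?_⟩
  filter_upwards [hEq.filter_mono nhdsWithin_le_nhds, self_mem_nhdsWithin] with s hs hne
  have h0 : s - 1 ≠ 0 := sub_ne_zero.2 hne
  rw [hs, hv']
  field_simp
  ring

/-! ### Meromorphy and the order of the poles -/

theorem meromorphicOn_mellinSqCont (h : IsLaplaceExpansion a b) :
    MeromorphicOn (mellinSqCont a b) univ := fun p _ => by
  by_cases hp : ∀ k : ℕ, p ≠ 1 - k
  · exact (analyticAt_mellinSqCont h hp).meromorphicAt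
  · push Not at hp
    obtain ⟨k, rfl⟩ := hp
    obtain ⟨G, hG, hEq⟩ := mellinSqCont_eventuallyEq_pole h k
    refine MeromorphicAt.congr ?_ (hEq.filter_mono nhdsWithin_le_nhds).symm
    have h1 := (differentiable_one_div_Gamma.analyticAt (1 - (k : ℂ))).meromorphicAt
    have h2 := hG.meromorphicAt
    fun_prop

/-- The continuation of `mellinSqIntegral` in meromorphic normal form: the values at removable
singularities are the limits, those at poles are `0`. -/
noncomputable def mellinSqMero (a b : ℕ → ℂ) : ℂ → ℂ := toMeromorphicNFOn (mellinSqCont a b) univ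

theorem mellinSqMero_eventuallyEq (h : IsLaplaceExpansion a b) (p : ℂ) :
    mellinSqMero a b =ᶠ[𝓝[≠] p] mellinSqCont a b :=
  (meromorphicOn_mellinSqCont h).toMeromorphicNFOn_eq_self_on_nhdsNE (mem_univ p)

theorem meromorphicOn_mellinSqMero : MeromorphicOn (mellinSqMero a b) univ :=
  (meromorphicNFOn_toMeromorphicNFOn _ _).meromorphicOn

/-- Removable singularities of `mellinSqCont` are removed in `mellinSqMero`. -/
theorem analyticAt_mellinSqMero (h : IsLaplaceExpansion a b) {p : ℂ} {f : ℂ → ℂ}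
    (hf : AnalyticAt ℂ f p) (hEq : mellinSqCont a b =ᶠ[𝓝[≠] p] f) :
    AnalyticAt ℂ (mellinSqMero a b) p := by
  have h1 : MeromorphicNFAt (mellinSqMero a b) p :=
    meromorphicNFOn_toMeromorphicNFOn _ _ (mem_univ p)
  rw [← h1.meromorphicOrderAt_nonneg_iff_analyticAt,
    meromorphicOrderAt_congr ((mellinSqMero_eventuallyEq h p).trans hEq)]
  exact hf.meromorphicOrderAt_nonneg

theorem mellinSqMero_of_one_lt (h : IsLaplaceExpansion a b) {s : ℂ} (hs : 1 < s.re) :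
    mellinSqMero a b s = mellinSqIntegral s := by
  have h1 : AnalyticAt ℂ (mellinSqCont a b) s := analyticAt_mellinSqCont h fun k hk => by
    rw [hk] at hs
    simp at hs
    linarith [(Nat.cast_nonneg k : (0 : ℝ) ≤ k)]
  have h2 := analyticAt_mellinSqMero h h1 EventuallyEq.rfl
  rw [← mellinSqCont_of_one_lt h hs]
  exact ((h2.continuousAt.eventuallyEq_nhds_iff_eventuallyEq_nhdsNE h1.continuousAt).1
    (mellinSqMero_eventuallyEq h s)).eq_of_nhds

theorem analyticOnNhd_mellinSqMero (h : IsLaplaceExpansion a b) (ha : ∀ k, Odd k → a k = 0) :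
    AnalyticOnNhd ℂ (mellinSqMero a b) ({(1 : ℂ)} ∪ negOddIntegers)ᶜ := fun p hp => by
  by_cases hp' : ∀ k : ℕ, p ≠ 1 - k
  · exact analyticAt_mellinSqMero h (analyticAt_mellinSqCont h hp') EventuallyEq.rfl
  push Not at hp'
  obtain ⟨k, rfl⟩ := hp'
  rcases Nat.even_or_odd k with hk | hk
  · -- an even `k` gives one of the points that are removed
    refine absurd ?_ hp
    obtain ⟨n, rfl⟩ := hk
    cases n with
    | zero => left; simp
    | succ n => exact Or.inr ⟨n, by push_cast; ring⟩
  · obtain ⟨m, rfl⟩ := Nat.exists_eq_succ_of_ne_zero hk.pos.ne'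
    obtain ⟨G, r, hG, hr, hEq⟩ := mellinSqCont_eventuallyEq_neg_nat h m
    rw [ha (m + 1) hk] at hEq
    have hpm : (1 - ((m.succ : ℕ) : ℂ)) = -m := by push_cast; ring
    rw [hpm]
    exact analyticAt_mellinSqMero h hG (hEq.trans (Eventually.of_forall fun s => by simp))

theorem mellinSqMero_eventuallyEq_one (h : IsLaplaceExpansion a b) (ha : a 0 = 1)
    (hb : b 0 = Real.eulerMascheroniConstant - Real.log (2 * Real.pi)) :
    ∃ g : ℂ → ℂ, AnalyticAt ℂ g 1 ∧ ∀ᶠ s in 𝓝[≠] (1 : ℂ), mellinSqMero a b s = 1 / (s - 1) ^ 2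
      + ((2 * Real.eulerMascheroniConstant - Real.log (2 * Real.pi) : ℝ) : ℂ) / (s - 1) + g s := by
  obtain ⟨g, hg, hEq⟩ := mellinSqCont_eventuallyEq_one h ha
  refine ⟨g, hg, ?_⟩
  filter_upwards [mellinSqMero_eventuallyEq h 1, hEq] with s h1 h2
  rw [h1, h2, hb]
  push_cast
  ring

theorem meromorphicOrderAt_mellinSqMero_one (h : IsLaplaceExpansion a b) (ha : a 0 = 1) :
    meromorphicOrderAt (mellinSqMero a b) 1 = ((-2 : ℤ) : WithTop ℤ) := by
  obtain ⟨g, hg, hEq⟩ := mellinSqCont_eventuallyEq_one h ha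
  rw [meromorphicOrderAt_eq_int_iff (meromorphicOn_mellinSqMero 1 (mem_univ 1))]
  refine ⟨fun s => 1 + (Real.eulerMascheroniConstant + b 0) * (s - 1) + (s - 1) ^ 2 * g s,
    by fun_prop, by simp, ?_⟩
  filter_upwards [mellinSqMero_eventuallyEq h 1, hEq, self_mem_nhdsWithin] with s h1 h2 hne
  have h0 : s - 1 ≠ 0 := sub_ne_zero.2 hne
  rw [h1, h2, smul_eq_mul, zpow_neg, zpow_ofNat]
  field_simp

theorem neg_one_le_meromorphicOrderAt_mellinSqMero (h : IsLaplaceExpansion a b) (m : ℕ) :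
    ((-1 : ℤ) : WithTop ℤ) ≤ meromorphicOrderAt (mellinSqMero a b) (-m) := by
  obtain ⟨G, r, hG, hr, hEq⟩ := mellinSqCont_eventuallyEq_neg_nat h m
  have hlin : AnalyticAt ℂ (fun s : ℂ => s - -(m : ℂ)) (-m) := by fun_prop
  have hH : AnalyticAt ℂ (fun s => (s - -(m : ℂ)) * G s + r s * a (m + 1)) (-m) := by fun_prop
  have hEq' : mellinSqMero a b =ᶠ[𝓝[≠] (-m : ℂ)]
      (fun s : ℂ => s - -(m : ℂ))⁻¹ * fun s => (s - -(m : ℂ)) * G s + r s * a (m + 1) := by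
    filter_upwards [mellinSqMero_eventuallyEq h (-m), hEq, self_mem_nhdsWithin] with s h1 h2 hne
    have h0 : s - -(m : ℂ) ≠ 0 := sub_ne_zero.2 hne
    rw [h1, h2, Pi.mul_apply, Pi.inv_apply, ← sub_neg_eq_add s (m : ℂ)]
    field_simp
  have hord : meromorphicOrderAt (fun s : ℂ => s - -(m : ℂ)) (-m) = ((1 : ℤ) : WithTop ℤ) :=
    (meromorphicOrderAt_eq_int_iff hlin.meromorphicAt).2
      ⟨fun _ => 1, analyticAt_const, one_ne_zero, Eventually.of_forall fun s => by simp⟩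
  rw [meromorphicOrderAt_congr hEq', meromorphicOrderAt_mul hlin.meromorphicAt.inv hH.meromorphicAt,
    meromorphicOrderAt_inv, hord]
  exact le_add_of_nonneg_right hH.meromorphicOrderAt_nonneg

end

theorem theorem1 :
    (∀ s : ℂ, 1 < s.re → IntegrableOn (mellinSqIntegrand s) (Set.Ioi (1 : ℝ)) volume) ∧
    ∃ Z : ℂ → ℂ,
      -- `Z` is a meromorphic function on the whole plane extending the integral
      MeromorphicOn Z Set.univ ∧
      (∀ s : ℂ, 1 < s.re → Z s = mellinSqIntegral s) ∧
      -- there are no poles apart from `1` and possibly `-1, -3, -5, …`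
      AnalyticOnNhd ℂ Z ({(1 : ℂ)} ∪ negOddIntegers)ᶜ ∧
      -- the pole at `1` is double, with the given principal part
      meromorphicOrderAt Z 1 = ((-2 : ℤ) : WithTop ℤ) ∧
      (∃ g : ℂ → ℂ, AnalyticAt ℂ g 1 ∧
        ∀ᶠ s in 𝓝[≠] (1 : ℂ),
          Z s = 1 / (s - 1) ^ 2
            + ((2 * Real.eulerMascheroniConstant - Real.log (2 * Real.pi) : ℝ) : ℂ) / (s - 1)
            + g s) ∧
      -- at `-1, -3, -5, …` there is at most a simple pole
      (∀ p ∈ negOddIntegers, ((-1 : ℤ) : WithTop ℤ) ≤ meromorphicOrderAt Z p) := by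
  obtain ⟨a, b, ha, hb, hodd, hab⟩ := exists_laplaceTail_expansion
  have h : IsLaplaceExpansion a b := hab
  refine ⟨fun s hs => integrableOn_mellinSqIntegrand (one_pos.trans hs)
      (mellinConvergent_laplaceTail h hs),
    mellinSqMero a b, meromorphicOn_mellinSqMero, fun s hs => mellinSqMero_of_one_lt h hs,
    analyticOnNhd_mellinSqMero h hodd, meromorphicOrderAt_mellinSqMero_one h ha,
    mellinSqMero_eventuallyEq_one h ha hb, ?_⟩
  rintro p ⟨n, rfl⟩
  have h1 := neg_one_le_meromorphicOrderAt_mellinSqMero h (2 * n + 1)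
  push_cast at h1
  exact h1
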